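/- Let $\epsilon\in\{1,-1\}$, let $\mathbb{E}^{n+1}$ be $\mathbb{R}^{n+1}$ with the metric $\epsilon\,dx_0^2+dx_1^2+\dots+dx_n^2$, let $\mathbb{Q}_\epsilon^n=\{x\in\mathbb{E}^{n+1}:\langle x,x\rangle=\epsilon\}$ (with $x_0>0$ if $\epsilon=-1$), so that $\mathbb{Q}_1^n=\mathbb{S}^n$ and $\mathbb{Q}_{-1}^n=\mathbb{H}^n$, and regard $\mathbb{Q}_\epsilon^n\times\mathbb{R}\subset\mathbb{E}^{n+2}=\mathbb{E}^{n+1}\times\mathbb{R}$. Let $\partial/\partial t$ be the unit vector field tangent to the factor $\mathbb{R}$. All objects are smooth. Let $m\ge 2$ and let $f\colon M^m\to\mathbb{Q}_\epsilon^n\times\mathbb{R}$ be an isometric immersion with second fundamental form $\alpha_f$. Let $T$ be the tangent vector field on $M$ such that $f_*T$ is the tangential component of $\partial/\partial t$, and assume that $T$ vanishes nowhere. *Rotational submanifolds.* Let $A\subset P$ be linear subspaces of $\mathbb{E}^{n+2}$ of dimensions $n-m+2$ and $n-m+3$ that contain $\partial/\partial t$, with $P\cap(\mathbb{Q}_\epsilon^n\times\mathbb{R})\neq\emptyset$;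 the latter is then a totally geodesic submanifold $\mathbb{Q}_\epsilon^{n-m+1}\times\mathbb{R}$. Let $\alpha$ be a regular curve in $P\cap(\mathbb{Q}_\epsilon^n\times\mathbb{R})$, defined on an open interval, that lies in one of the two open half-spaces of $P$ determined by $A$. We say that $f$ is a *rotational submanifold* with profile in a totally geodesic $\mathbb{Q}_\epsilon^{n-m+1}\times\mathbb{R}$ if every point of $M$ has an open neighbourhood $U$ such that, for some such $A$, $P$, $\alpha$, the image $f(U)$ is contained in the orbit of $\alpha$ under the group of isometries of $\mathbb{E}^{n+2}$ that fix the axis $A$ pointwise. It is of *hyperbolic type* if $\epsilon=-1$ and the axes $A$ can be taken Riemannian (that is, the metric is positive definite on $A$). *Partial tubes.* We say that $f$ is *given in terms of* isometric immersions $g$ of a certain kind if every point of $M$ has an open neighbourhood $U$ with a diffeomorphism $\psi\colon N^{m-1}\times I\to U$, $I$ an open interval, such that $$f(\psi(x,s))=\alpha_0(s)\,g(x)+\sum_{i=1}^k\alpha_i(s)\,\xi_i(x)+\alpha_{k+1}(s)\,\frac{\partial}{\partial t},$$ where $g\colon N^{m-1}\to\mathbb{Q}_\epsilon^n$ is an isometric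 immersion of that kind, $\xi_1,\dots,\xi_k$ ($k\ge 0$) is an orthonormal set of parallel normal vector fields along $g$, and $(\alpha_0,\dots,\alpha_{k+1})\colon I\to\mathbb{Q}_\epsilon^k\times\mathbb{R}$ is a curve with $\alpha_{k+1}'$ nowhere zero. A unit-speed curve $g$ in $\mathbb{Q}_\epsilon^n$ is a *geodesic circle* if $\nabla_t\nabla_t g'=-\langle\nabla_tg',\nabla_tg'\rangle g'$ (geodesics are included). An immersion $g\colon N^{m-1}\to\mathbb{H}^n$ is an *equidistant hypersurface* if its image lies in a totally geodesic $\mathbb{H}^m\subset\mathbb{H}^n$, at constant distance $d>0$ from a totally geodesic $\mathbb{H}^{m-1}\subset\mathbb{H}^m$. Then the following assertions are equivalent: (i) $f$ is a rotational submanifold with profile in a totally geodesic $\mathbb{Q}_\epsilon^{n-m+1}\times\mathbb{R}$; (ii) $f$ is given in terms of umbilical isometric immersions $g$ (geodesic circles, if $m=2$); (iii) there is a normal vector field $\zeta$ along $f$ such that $\alpha_f(X,Y)=\langle X,Y\rangle\zeta$ for all $X\in TM$ and all $Y\in\{T\}^\perp$, and, if $m=2$, $\zeta$ is parallel in the normal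 connection along $\{T\}^\perp$. Moreover, if $\epsilon=1$, then these assertions are equivalent to $f$ being given in terms of totally geodesic isometric immersions $g$. If $\epsilon=-1$, then $f$ is a rotational submanifold of hyperbolic type if and only if $f$ is given in terms of totally geodesic isometric immersions $g$, and also, if $m\le n$, if and only if $f$ is given in terms of isometric immersions $g$ as in (ii) that are equidistant hypersurfaces. -/

import Mathlib

open Set Module
open scoped Manifold ContDiff

noncomputable section

namespace QxR

/-! ### The flat spaces and the quadrics -/

/-- The underlying space of `𝔼^{n+1}`, with coordinates `(x₀, …, xₙ)`. -/
abbrev Flat (n : ℕ) : Type := Fin (n + 1) → ℝ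

/-- The underlying space of `𝔼^{n+2} = 𝔼^{n+1} × ℝ`; the last coordinate is the height. -/
abbrev FlatR (n : ℕ) : Type := Flat n × ℝ

/-- The flat metric `ε dx₀² + dx₁² + ⋯ + dxₙ²` of `𝔼^{n+1}`. -/
def form (ε : ℝ) (n : ℕ) : LinearMap.BilinForm ℝ (Flat n) :=
  LinearMap.mk₂ ℝ (fun x y => ε * (x 0 * y 0) + ∑ i : Fin n, x i.succ * y i.succ)
    (fun x x' y => by
      simp only [Pi.add_apply, add_mul, mul_add, Finset.sum_add_distrib]; ring)
    (fun c x y => by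
      simp only [Pi.smul_apply, smul_eq_mul, mul_add, Finset.mul_sum, mul_assoc]; ring_nf)
    (fun x y y' => by
      simp only [Pi.add_apply, mul_add, Finset.sum_add_distrib]; ring)
    (fun c x y => by
      simp only [Pi.smul_apply, smul_eq_mul, mul_add, Finset.mul_sum]
      congr 1
      · ring
      · exact Finset.sum_congr rfl fun i _ => by ring)

/-- The flat metric of `𝔼^{n+2}`, the product of that of `𝔼^{n+1}` with the one of `ℝ`. -/
def formR (ε : ℝ) (n : ℕ) : LinearMap.BilinForm ℝ (FlatR n) :=
  LinearMap.mk₂ ℝ (fun x y => form ε n x.1 y.1 + x.2 * y.2)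
    (fun x x' y => by simp only [Prod.fst_add, Prod.snd_add, map_add, LinearMap.add_apply]; ring)
    (fun c x y => by
      simp only [Prod.smul_fst, Prod.smul_snd, map_smul, LinearMap.smul_apply, smul_eq_mul]; ring)
    (fun x y y' => by simp only [Prod.fst_add, Prod.snd_add, map_add]; ring)
    (fun c x y => by
      simp only [Prod.smul_fst, Prod.smul_snd, map_smul, smul_eq_mul]; ring)

/-- `ℚ_ε^n ⊂ 𝔼^{n+1}`: the unit sphere `𝕊ⁿ` for `ε = 1`, and the hyperbolic space `ℍⁿ` (the
upper sheet of the hyperboloid) for `ε = -1`. -/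
def quadric (ε : ℝ) (n : ℕ) : Set (Flat n) :=
  {x | form ε n x x = ε ∧ (ε = -1 → 0 < x 0)}

/-- The unit vector `∂/∂t` tangent to the factor `ℝ`. -/
def dt (n : ℕ) : FlatR n := (0, 1)

/-! ### Orthogonal projections, second fundamental form, normal connection -/

section Submanifold

variable {E W : Type*} [NormedAddCommGroup E] [NormedSpace ℝ E]
  [NormedAddCommGroup W] [NormedSpace ℝ W]

open Classical in
/-- The `B`-orthogonal projection onto a subspace `S`, where `S` and its `B`-orthogonal complement
are complementary (that is, for `B` nondegenerate on `S`). -/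
def orthProj (B : LinearMap.BilinForm ℝ W) (S : Submodule ℝ W) : W →ₗ[ℝ] W :=
  if h : IsCompl S (B.orthogonal S) then S.projection (B.orthogonal S) h else 0

/-- The tangent space of the immersion `F` at `x`, as a subspace of the flat space. -/
def tangentSpan (F : E → W) (x : E) : Submodule ℝ W :=
  LinearMap.range (fderiv ℝ F x).toLinearMap

/-- The normal space at `x` of the immersion `F` into a hypersurface of the flat space `(W, B)`
whose normal line at `F x` is spanned by `ν`. -/
def normalSpace (B : LinearMap.BilinForm ℝ W) (ν : W) (F : E → W) (x : E) : Submodule ℝ W :=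
  B.orthogonal (tangentSpan F x ⊔ Submodule.span ℝ {ν})

/-- The second fundamental form at `x` of the immersion `F` into the hypersurface with normal
direction `ν` at `F x`: the normal component of the second derivative. -/
def sff (B : LinearMap.BilinForm ℝ W) (ν : W) (F : E → W) (x X Y : E) : W :=
  orthProj B (normalSpace B ν F x) (fderiv ℝ (fderiv ℝ F) x X Y)

/-- The covariant derivative `∇^⊥_X ξ` at `x`, in the normal connection of `F`, of a normal vector
field `ξ` along `F`. -/
def normalDeriv (B : LinearMap.BilinForm ℝ W) (ν : W) (F ξ : E → W) (x X : E) : W :=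
  orthProj B (normalSpace B ν F x) (fderiv ℝ ξ x X)

end Submanifold

/-! ### Immersions of an open set `V` into `ℚ_ε^n` -/

section IntoQuadric

variable {E : Type*} [NormedAddCommGroup E] [NormedSpace ℝ E]

/-- `g` restricts to a smooth immersion `V → ℚ_ε^n`. The open set `V` is given the induced
metric, so that `g` is an isometric immersion. -/
def IsImmersionOn (ε : ℝ) (n : ℕ) (V : Set E) (g : E → Flat n) : Prop :=
  ContDiffOn ℝ ∞ g V ∧ ∀ x ∈ V, g x ∈ quadric ε n ∧ Function.Injective (fderiv ℝ g x)

/-- `g : V → ℚ_ε^n` is umbilical. -/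
def IsUmbilicalOn (ε : ℝ) (n : ℕ) (V : Set E) (g : E → Flat n) : Prop :=
  ∃ ζ : E → Flat n, ContDiffOn ℝ ∞ ζ V ∧ ∀ x ∈ V, ζ x ∈ normalSpace (form ε n) (g x) g x ∧
    ∀ X Y : E, sff (form ε n) (g x) g x X Y
      = form ε n (fderiv ℝ g x X) (fderiv ℝ g x Y) • ζ x

/-- `g : V → ℚ_ε^n` is totally geodesic. -/
def IsTotallyGeodesicOn (ε : ℝ) (n : ℕ) (V : Set E) (g : E → Flat n) : Prop :=
  ∀ x ∈ V, ∀ X Y : E, sff (form ε n) (g x) g x X Y = 0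

/-- `ξ₁, …, ξ_k` is an orthonormal set of parallel normal vector fields along `g : V → ℚ_ε^n`. -/
def IsParallelFrameOn (ε : ℝ) (n : ℕ) (V : Set E) (g : E → Flat n) {k : ℕ}
    (ξ : Fin k → E → Flat n) : Prop :=
  (∀ i, ContDiffOn ℝ ∞ (ξ i) V) ∧
  ∀ x ∈ V,
    (∀ i, ξ i x ∈ normalSpace (form ε n) (g x) g x) ∧
    (∀ i j, form ε n (ξ i x) (ξ j x) = if i = j then 1 else 0) ∧
    ∀ i, ∀ X : E, normalDeriv (form ε n) (g x) g (ξ i) x X = 0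

/-- The covariant derivative in `ℚ_ε^n` of a vector field `Y` along the curve `γ`: the component
of `Y'` tangent to `ℚ_ε^n`. -/
def covDeriv (ε : ℝ) (n : ℕ) (γ Y : ℝ → Flat n) (t : ℝ) : Flat n :=
  deriv Y t - (ε * form ε n (deriv Y t) (γ t)) • γ t

/-- The curve `γ` in `ℚ_ε^n` is a geodesic circle, parametrized by arc length: it satisfies
`∇_t ∇_t γ' = -⟨∇_t γ', ∇_t γ'⟩ γ'`, that is, it has constant curvature (zero allowed) and
vanishing torsion. -/
def IsGeodesicCircleOn (ε : ℝ) (n : ℕ) (J : Set ℝ) (γ : ℝ → Flat n) : Prop :=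
  ∀ t ∈ J, form ε n (deriv γ t) (deriv γ t) = 1 ∧
    covDeriv ε n γ (covDeriv ε n γ (deriv γ)) t
      = -(form ε n (covDeriv ε n γ (deriv γ) t) (covDeriv ε n γ (deriv γ) t)) • deriv γ t

/-- The diagonal line in `ℝ^r`; for `r = 1` the canonical isometry `ℝ → ℝ¹`. -/
def diag (r : ℕ) (t : ℝ) : EuclideanSpace ℝ (Fin r) := WithLp.toLp 2 fun _ => t

/-- The condition on `g : V^r → ℚ_ε^n`: umbilical, and a geodesic circle if `r = 1`. -/
def IsUmbilicalOrCircleOn (ε : ℝ) (n r : ℕ) (V : Set (EuclideanSpace ℝ (Fin r)))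
    (g : EuclideanSpace ℝ (Fin r) → Flat n) : Prop :=
  IsUmbilicalOn ε n V g ∧
    (r = 1 → IsGeodesicCircleOn ε n {t | diag r t ∈ V} fun t => g (diag r t))

/-- The distance of `ℍⁿ`. -/
def hypDist (n : ℕ) (x y : Flat n) : ℝ := Real.arcosh (-(form (-1) n x y))

/-- `g : V^r → ℍⁿ` is an equidistant hypersurface (of a totally geodesic `ℍ^{r+1} ⊂ ℍⁿ`): its image
lies in a totally geodesic `S' ∩ ℍⁿ` of dimension `r + 1`, at constant distance `d > 0` from a
totally geodesic hypersurface `S ∩ ℍⁿ` of it. -/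
def IsEquidistantOn (n r : ℕ) (V : Set (EuclideanSpace ℝ (Fin r)))
    (g : EuclideanSpace ℝ (Fin r) → Flat n) : Prop :=
  ∃ S S' : Submodule ℝ (Flat n), S ≤ S' ∧ finrank ℝ S = r + 1 ∧ finrank ℝ S' = r + 2 ∧
    ((S : Set (Flat n)) ∩ quadric (-1) n).Nonempty ∧
    ∃ d : ℝ, 0 < d ∧ ∀ x ∈ V, g x ∈ S' ∧
      IsGLB (hypDist n (g x) '' ((S : Set (Flat n)) ∩ quadric (-1) n)) d

end IntoQuadric

/-! ### Immersions `f : M^m → ℚ_ε^n × ℝ`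

`f` is regarded as a map into `𝔼^{n+2}`, and `M` carries the metric induced by `f`. -/

section IntoProduct

variable (m : ℕ) {M : Type*} [TopologicalSpace M] [ChartedSpace (EuclideanSpace ℝ (Fin m)) M]

/-- `u` in the preferred chart at `p`. This chart identifies `T_pM` with `ℝ^m`. -/
def inChart {W : Type*} (u : M → W) (p : M) : EuclideanSpace ℝ (Fin m) → W :=
  u ∘ (extChartAt (𝓡 m) p).symm

/-- The image of `p` in the preferred chart at `p`. -/
def pt (p : M) : EuclideanSpace ℝ (Fin m) := extChartAt (𝓡 m) p p

variable {n : ℕ}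

/-- `f_* X` for `X ∈ T_pM`. -/
def push (f : M → FlatR n) (p : M) (X : EuclideanSpace ℝ (Fin m)) : FlatR n :=
  fderiv ℝ (inChart m f p) (pt m p) X

/-- `f_* T` at `p`: the component of `∂/∂t` tangent to `f`. -/
def pushT (ε : ℝ) (f : M → FlatR n) (p : M) : FlatR n :=
  orthProj (formR ε n) (tangentSpan (inChart m f p) (pt m p)) (dt n)

/-- The direction normal to `ℚ_ε^n × ℝ` in `𝔼^{n+2}` at `y`. -/
def nu (y : FlatR n) : FlatR n := (y.1, 0)

/-- `f` is a smooth immersion of `M` into `ℚ_ε^n × ℝ`. -/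
def IsImmersion (ε : ℝ) (f : M → FlatR n) : Prop :=
  ContMDiff (𝓡 m) 𝓘(ℝ, FlatR n) ∞ f ∧
  ∀ p, (f p).1 ∈ quadric ε n ∧ Function.Injective (mfderiv (𝓡 m) 𝓘(ℝ, FlatR n) f p)

/-- There is a normal vector field `ζ` along `f` with `α_f(X, Y) = ⟨X, Y⟩ζ` for all `X ∈ TM` and
`Y ∈ {T}^⊥`, and `ζ` is parallel along `{T}^⊥` in the normal connection if `m = 2`. -/
def HasUmbilicalLeaves (ε : ℝ) (f : M → FlatR n) : Prop :=
  ∃ ζ : M → FlatR n, ContMDiff (𝓡 m) 𝓘(ℝ, FlatR n) ∞ ζ ∧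
    ∀ p, ζ p ∈ normalSpace (formR ε n) (nu (f p)) (inChart m f p) (pt m p) ∧
      ∀ Y, formR ε n (push m f p Y) (pushT m ε f p) = 0 →
        (∀ X, sff (formR ε n) (nu (f p)) (inChart m f p) (pt m p) X Y
          = formR ε n (push m f p X) (push m f p Y) • ζ p) ∧
        (m = 2 →
          normalDeriv (formR ε n) (nu (f p)) (inChart m f p) (inChart m ζ p) (pt m p) Y = 0)

/-- `f` is locally the partial tube
`f(x, s) = α₀(s) g(x) + α₁(s) ξ₁(x) + ⋯ + α_k(s) ξ_k(x) + α_{k+1}(s) ∂/∂t`, `(x, s) ∈ V × I ≃ U ⊂ M`,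
over an immersion `g : V^{m-1} → ℚ_ε^n` with the property `C`, where `ξ₁, …, ξ_k` are orthonormal
parallel normal fields along `g` and `α = (a, α_{k+1}) : I → ℚ_ε^k × ℝ` is a smooth curve with
`α_{k+1}'` nowhere zero (in particular, regular). -/
def IsLocallyPartialTube (ε : ℝ) (f : M → FlatR n)
    (C : Set (EuclideanSpace ℝ (Fin (m - 1))) → (EuclideanSpace ℝ (Fin (m - 1)) → Flat n) → Prop) :
    Prop :=
  ∀ p : M, ∃ (V : Set (EuclideanSpace ℝ (Fin (m - 1)))) (I : Set ℝ)
    (ψ : OpenPartialHomeomorph (EuclideanSpace ℝ (Fin (m - 1)) × ℝ) M)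
    (g : EuclideanSpace ℝ (Fin (m - 1)) → Flat n)
    (k : ℕ) (ξ : Fin k → EuclideanSpace ℝ (Fin (m - 1)) → Flat n) (α : ℝ → FlatR k),
    IsOpen V ∧ IsOpen I ∧ I.OrdConnected ∧
    ψ.source = V ×ˢ I ∧ p ∈ ψ.target ∧
    ContMDiffOn 𝓘(ℝ, EuclideanSpace ℝ (Fin (m - 1)) × ℝ) (𝓡 m) ∞ ψ ψ.source ∧
    ContMDiffOn (𝓡 m) 𝓘(ℝ, EuclideanSpace ℝ (Fin (m - 1)) × ℝ) ∞ ψ.symm ψ.target ∧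
    IsImmersionOn ε n V g ∧ C V g ∧ IsParallelFrameOn ε n V g ξ ∧
    ContDiffOn ℝ ∞ α I ∧
    (∀ s ∈ I, (α s).1 ∈ quadric ε k ∧ deriv (fun s => (α s).2) s ≠ 0) ∧
    ∀ x ∈ V, ∀ s ∈ I,
      f (ψ (x, s)) = ((α s).1 0 • g x + ∑ i : Fin k, (α s).1 i.succ • ξ i x, (α s).2)

/-- `L` belongs to the group of isometries of `𝔼^{n+2}` that fix the subspace `A` pointwise. -/
def FixesAxis (ε : ℝ) (A : Submodule ℝ (FlatR n)) (L : FlatR n ≃ₗ[ℝ] FlatR n) : Prop :=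
  (∀ x y, formR ε n (L x) (L y) = formR ε n x y) ∧ ∀ x ∈ A, L x = x

/-- The orbit of the curve `α : I → 𝔼^{n+2}` under the isometries that fix `A` pointwise. -/
def orbit (ε : ℝ) (A : Submodule ℝ (FlatR n)) (I : Set ℝ) (α : ℝ → FlatR n) : Set (FlatR n) :=
  {y | ∃ L, FixesAxis ε A L ∧ ∃ s ∈ I, y = L (α s)}

/-- `α : I → P ∩ (ℚ_ε^n × ℝ)` is the profile curve of an `m`-dimensional rotational submanifold with
axis `A`. Here `A ⊂ P` are subspaces of `𝔼^{n+2}` of dimensions `n - m + 2` and `n - m + 3` that contain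
`∂/∂t`, so that `P ∩ (ℚ_ε^n × ℝ)`, which is not empty if `I` is not, is a totally geodesic
`ℚ_ε^{n-m+1} × ℝ`. The curve is smooth and regular and lies in one of the two open half-spaces of `P`
determined by `A`. -/
def IsProfile (ε : ℝ) (n m : ℕ) (A P : Submodule ℝ (FlatR n)) (I : Set ℝ) (α : ℝ → FlatR n) : Prop :=
  dt n ∈ A ∧ A ≤ P ∧ finrank ℝ A + m = n + 2 ∧ finrank ℝ P + m = n + 3 ∧
  IsOpen I ∧ I.OrdConnected ∧ ContDiffOn ℝ ∞ α I ∧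
  (∀ s ∈ I, α s ∈ P ∧ (α s).1 ∈ quadric ε n ∧ deriv α s ≠ 0) ∧
  ∃ l : FlatR n →ₗ[ℝ] ℝ, (∀ x ∈ P, l x = 0 ↔ x ∈ A) ∧ ∀ s ∈ I, 0 < l (α s)

/-- `f` is locally a rotational submanifold, with a curve in a totally geodesic
`ℚ_ε^{n-m+1} × ℝ` as profile, and with an axis that has the property `C`. -/
def IsRotationalWith (ε : ℝ) (f : M → FlatR n) (C : Submodule ℝ (FlatR n) → Prop) : Prop :=
  ∀ p : M, ∃ (U : Set M) (A P : Submodule ℝ (FlatR n)) (I : Set ℝ) (α : ℝ → FlatR n),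
    IsOpen U ∧ p ∈ U ∧ IsProfile ε n m A P I α ∧ C A ∧ f '' U ⊆ orbit ε A I α

/-- `f` is a rotational submanifold with profile in a totally geodesic `ℚ_ε^{n-m+1} × ℝ`. -/
def IsRotational (ε : ℝ) (f : M → FlatR n) : Prop :=
  IsRotationalWith m ε f fun _ => True

/-- `f` is a rotational submanifold of hyperbolic type: the axis is Riemannian. -/
def IsRotationalHyperbolic (ε : ℝ) (f : M → FlatR n) : Prop :=
  IsRotationalWith m ε f fun A => ∀ x ∈ A, x ≠ 0 → 0 < formR ε n x x

end IntoProduct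

end QxR

end

open QxR

noncomputable section

namespace QxR

open Filter Topology

/-! ### The flat forms -/

section Forms

variable {ε : ℝ} {n : ℕ}

/-! Every assertion is compared with one local condition, `IsLocallyAxial`: near each point there is
a fixed subspace `A` of `𝔼^{n+1}`, of dimension `n - m + 1`, such that the level sets of the height
function have their tangent spaces in `A^⊥`. By `formR_push_pushT`, `{T}^⊥` is the kernel of the
differential of the height, so these level sets are its leaves. The axis of rotation is `A × ℝ`, and
hyperbolic type means that `A` is positive definite.

Rotational implies axial: isometries that fix the axis preserve the height and every product `⟨·,
a⟩` with `a ∈ A`, so the pair of these functions maps `M` into a plane curve. Such a map cannot have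
rank two (`not_surjective_of_mapsTo_curve`), so `⟨·, a⟩` is stationary along the leaves.

Axial implies rotational: `IsAxial.exists_param` gives coordinates `(x, s)` with height `s` in
which, for fixed `x`, the position moves in `A + ℝ y` for one vector `y`. Such a curve is the
profile. Two points of a leaf have the same products with `A`, so the reflection in their difference
fixes the axis and exchanges them (`exists_fixesAxis`).

Axial implies partial tube: a leaf, translated by a vector of `A` and rescaled back into the
quadric, is the base `g`. Its products with `A` are constant, so the fields `a - ε⟨a, g⟩g` with `a ∈
A` have derivatives that are multiples of `dg`. They form a parallel normal frame, and `g` is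
umbilical with parallel mean curvature (`IsRoundOn`). Expanding the position in this frame gives the
tube formula. The choice of the translation makes `g` totally geodesic or equidistant when `A` is
positive definite.

Partial tube implies axial: since the height has nonzero derivative in `s`, the leaves of a tube are
tangent to the base (`fderiv_tube_mem`), whose tangent spaces lie in a fixed subspace of dimension
`m`.

The fixed subspace, for umbilical bases as well as for condition (iii), comes from
`IsUmbilicalAlong.exists_subspace`: the span of the tangent space of a leaf and of its mean
curvature vector in the flat space is locally constant. This is a Codazzi argument, namely the
symmetry of second derivatives of a field tangent to the leaves. When the leaves are curves, the
argument gives nothing along the leaf, which is where parallelism of `ζ`, or the equation of a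
geodesic circle, is needed. Conversely, an axial immersion has an explicit mean curvature field
`axialMean`; its value at a point is determined by (iii), so the local fields glue. -/

theorem form_apply (x y : Flat n) :
    form ε n x y = ε * (x 0 * y 0) + ∑ i : Fin n, x i.succ * y i.succ := rfl

theorem formR_apply (x y : FlatR n) : formR ε n x y = form ε n x.1 y.1 + x.2 * y.2 := rfl

theorem form_comm (x y : Flat n) : form ε n x y = form ε n y x := by
  simp only [form_apply, mul_comm]

theorem formR_comm (x y : FlatR n) : formR ε n x y = formR ε n y x := by
  simp only [formR_apply, form_comm x.1 y.1, mul_comm]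

theorem sq_eq_one_of_sign (hε : ε = 1 ∨ ε = -1) : ε * ε = 1 := by
  rcases hε with rfl | rfl <;> norm_num

theorem sign_ne_zero (hε : ε = 1 ∨ ε = -1) : ε ≠ 0 := by
  rcases hε with rfl | rfl <;> norm_num

/-- The tangent spaces of the quadric are Riemannian. -/
theorem form_self_pos (hε : ε = 1 ∨ ε = -1) {y w : Flat n} (hy : form ε n y y = ε)
    (hwy : form ε n w y = 0) (hw : w ≠ 0) : 0 < form ε n w w := by
  have hS : 0 ≤ ∑ i : Fin n, w i.succ * w i.succ :=
    Finset.sum_nonneg fun i _ => mul_self_nonneg _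
  rw [form_apply] at hy hwy ⊢
  have hcs := Finset.sum_mul_sq_le_sq_mul_sq Finset.univ (fun i : Fin n => w i.succ)
    (fun i : Fin n => y i.succ)
  simp only [pow_two] at hcs
  have hzero : ∑ i : Fin n, w i.succ * w i.succ = 0 → w 0 = 0 → False := by
    intro h h0
    apply hw
    rw [Finset.sum_eq_zero_iff_of_nonneg fun i _ => mul_self_nonneg _] at h
    funext i
    refine Fin.cases h0 (fun j => ?_) i
    simpa using h j (Finset.mem_univ _)
  set S := ∑ i : Fin n, w i.succ * w i.succ
  set Y := ∑ i : Fin n, y i.succ * y i.succ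
  set Z := ∑ i : Fin n, w i.succ * y i.succ
  rcases hε with rfl | rfl
  · rcases hS.lt_or_eq with h | h
    · nlinarith [mul_self_nonneg (w 0)]
    · rcases eq_or_ne (w 0) 0 with h0 | h0
      · exact (hzero h.symm h0).elim
      · have := mul_self_pos.2 h0
        linarith
  · have hZ : Z = w 0 * y 0 := by linarith
    have hY : Y = y 0 * y 0 - 1 := by linarith
    rw [hZ, hY] at hcs
    have hY0 : 0 ≤ Y := Finset.sum_nonneg fun i _ => mul_self_nonneg _
    have hy0 : 1 ≤ y 0 * y 0 := by linarith
    rcases hS.lt_or_eq with h | h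
    -- If `S ≤ (w 0)²`, then Cauchy–Schwarz, `(w 0 * y 0)² ≤ S * ((y 0)² - 1)`, forces `S ≤ 0`.
    · by_contra hcon
      push Not at hcon
      nlinarith
    · exfalso
      rw [← h] at hcs
      have h1 : w 0 * y 0 = 0 := by nlinarith [mul_self_nonneg (w 0 * y 0)]
      rcases mul_eq_zero.1 h1 with h0 | h0
      · exact hzero h.symm h0
      · rw [h0] at hy0; norm_num at hy0

/-- Cauchy–Schwarz on the last `n` coordinates bounds their product by `((x 0)² - 1)((y 0)² - 1)`,
up to squares, which is less than `(x 0 * y 0)²`; the two first coordinates being positive fixes the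
sign. -/
theorem form_neg_of_mem_hyperbolic {x y : Flat n} (hx : form (-1) n x x = -1) (hx0 : 0 < x 0)
    (hy : y ∈ quadric (-1) n) : form (-1) n x y < 0 := by
  obtain ⟨hy, hy0⟩ := hy
  specialize hy0 rfl
  rw [form_apply] at hx hy ⊢
  have hcs := Finset.sum_mul_sq_le_sq_mul_sq Finset.univ (fun i : Fin n => x i.succ)
    (fun i : Fin n => y i.succ)
  simp only [pow_two] at hcs
  have hY0 : 0 ≤ ∑ i : Fin n, y i.succ * y i.succ := Finset.sum_nonneg fun i _ => mul_self_nonneg _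
  have hX0 : 0 ≤ ∑ i : Fin n, x i.succ * x i.succ := Finset.sum_nonneg fun i _ => mul_self_nonneg _
  set X := ∑ i : Fin n, x i.succ * x i.succ
  set Y := ∑ i : Fin n, y i.succ * y i.succ
  set Z := ∑ i : Fin n, x i.succ * y i.succ
  have hX : X = x 0 * x 0 - 1 := by linarith
  have hY : Y = y 0 * y 0 - 1 := by linarith
  have hpos : 0 < x 0 * y 0 := mul_pos hx0 hy0
  have : Z < x 0 * y 0 := by
    apply lt_of_pow_lt_pow_left₀ 2 hpos.le
    rw [hX, hY] at hcs
    rw [hX] at hX0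
    rw [hY] at hY0
    nlinarith
  linarith

/-- The sign of the product with one point of the upper sheet decides on which sheet `v` lies. This
verifies the condition `0 < x 0` for every point of `ℍⁿ` constructed below. -/
theorem pos_of_form_neg {v y : Flat n} (hv : form (-1) n v v = -1)
    (hy : y ∈ quadric (-1) n) (h : form (-1) n v y < 0) : 0 < v 0 := by
  rcases lt_trichotomy (v 0) 0 with h0 | h0 | h0
  · have := form_neg_of_mem_hyperbolic (x := -v) (by simpa using hv) (by simpa using h0) hy
    simp only [map_neg, LinearMap.neg_apply] at this
    linarith
  · rw [form_apply, h0] at hv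
    have : 0 ≤ ∑ i : Fin n, v i.succ * v i.succ := Finset.sum_nonneg fun i _ => mul_self_nonneg _
    linarith
  · exact h0

/-- The vector `x + ⟨x, y⟩ y` is tangent at `y`, hence spacelike or zero, and its square is `⟨x, y⟩²
- 1`. -/
theorem form_le_neg_one {x y : Flat n} (hx : x ∈ quadric (-1) n)
    (hy : y ∈ quadric (-1) n) : form (-1) n x y ≤ -1 := by
  have hneg := form_neg_of_mem_hyperbolic hx.1 (hx.2 rfl) hy
  have h1 : form (-1) n (x + form (-1) n x y • y) y = 0 := by
    simp [hy.1]
  by_cases h0 : x + form (-1) n x y • y = 0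
  · have h2 : form (-1) n (x + form (-1) n x y • y) x = 0 := by rw [h0]; simp
    simp only [map_add, LinearMap.add_apply, map_smul, LinearMap.smul_apply, hx.1, smul_eq_mul,
      form_comm y x] at h2
    nlinarith
  · have h2 := form_self_pos (Or.inr rfl) hy.1 h1 h0
    simp only [map_add, LinearMap.add_apply, map_smul, LinearMap.smul_apply, hx.1, hy.1,
      smul_eq_mul, form_comm y x] at h2
    nlinarith

/-- The square is `2ε - 2⟨x, y⟩`, which is nonnegative in both signatures; if `⟨x, y⟩ = ε`, the
difference is tangent at `y`, where the form is positive definite. This is what permits the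
reflection in `x - y`. -/
theorem form_sub_self_pos (hε : ε = 1 ∨ ε = -1) {x y : Flat n} (hx : x ∈ quadric ε n)
    (hy : y ∈ quadric ε n) (hxy : x ≠ y) : 0 < form ε n (x - y) (x - y) := by
  have hne : x - y ≠ 0 := sub_ne_zero.2 hxy
  have hexp : form ε n (x - y) (x - y) = 2 * ε - 2 * form ε n x y := by
    simp only [map_sub, LinearMap.sub_apply, hx.1, hy.1, form_comm y x]; ring
  have heq : form ε n x y = ε → 0 < form ε n (x - y) (x - y) := fun h =>
    form_self_pos hε hy.1 (by simp only [map_sub, LinearMap.sub_apply, h, hy.1, sub_self]) hne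
  rcases hε with rfl | rfl
  · rw [form_apply]
    have hS : 0 ≤ ∑ i : Fin n, (x - y) i.succ * (x - y) i.succ :=
      Finset.sum_nonneg fun i _ => mul_self_nonneg _
    have h0 : 0 ≤ (x - y) 0 * (x - y) 0 := mul_self_nonneg _
    have hnn : 0 ≤ form 1 n (x - y) (x - y) := by rw [form_apply]; linarith
    rcases hnn.lt_or_eq with h | h
    · rwa [form_apply] at h
    · have := heq (by linarith)
      rwa [form_apply] at this
  · rcases (form_le_neg_one hx hy).lt_or_eq with h | h
    · rw [hexp]; linarith
    · exact heq h

theorem form_self_pos_of_one {w : Flat n} (hw : w ≠ 0) : 0 < form 1 n w w := by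
  have h0 : 0 ≤ w 0 * w 0 := mul_self_nonneg _
  have hS : ∀ i ∈ (Finset.univ : Finset (Fin n)), 0 ≤ w i.succ * w i.succ :=
    fun i _ => mul_self_nonneg _
  have h1 := Finset.sum_nonneg hS
  rw [form_apply]
  rcases (add_nonneg h0 h1).lt_or_eq with h | h
  · linarith
  · exfalso
    apply hw
    have h2 := (Finset.sum_eq_zero_iff_of_nonneg hS).1 (by linarith)
    funext i
    refine Fin.cases ?_ (fun j => ?_) i
    · simpa using (show w 0 * w 0 = 0 by linarith)
    · simpa using h2 j (Finset.mem_univ _)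

end Forms

/-! ### Forms that are positive on the orthogonal complement of a vector -/

section PosOff

variable {W : Type*} [NormedAddCommGroup W] [NormedSpace ℝ W]

/-- `B` is symmetric and positive definite on `ν^⊥`. -/
structure PosOff (B : LinearMap.BilinForm ℝ W) (ν : W) : Prop where
  symm : ∀ x y, B x y = B y x
  pos : ∀ w, B w ν = 0 → w ≠ 0 → 0 < B w w

/-- Positivity on the complement of the position vector is all that the linear algebra needs of the
metric, so that the Riemannian and Lorentzian cases can be treated together. -/
theorem posOff_form {ε : ℝ} (hε : ε = 1 ∨ ε = -1) {n : ℕ} {y : Flat n} (hy : y ∈ quadric ε n) :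
    PosOff (form ε n) y where
  symm := form_comm
  pos _ h h0 := form_self_pos hε hy.1 h h0

theorem posOff_formR {ε : ℝ} (hε : ε = 1 ∨ ε = -1) {n : ℕ} {y : FlatR n}
    (hy : y.1 ∈ quadric ε n) : PosOff (formR ε n) (nu y) where
  symm := formR_comm
  pos w h h0 := by
    rw [formR_apply]
    have h : form ε n w.1 y.1 = 0 := by simpa [formR_apply, nu] using h
    by_cases h1 : w.1 = 0
    · have : w.2 ≠ 0 := fun h2 => h0 (Prod.ext h1 h2)
      simpa [h1] using mul_self_pos.2 this
    · have := form_self_pos hε hy.1 h h1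
      nlinarith [mul_self_nonneg w.2]

variable {B : LinearMap.BilinForm ℝ W} {ν : W}

theorem PosOff.isRefl (h : PosOff B ν) : B.IsRefl := fun x y hxy => by rw [h.symm, hxy]

variable [FiniteDimensional ℝ W]

theorem isCompl_orthogonal_of_pos (hB : ∀ x y, B x y = B y x) {S : Submodule ℝ W}
    (hS : ∀ w ∈ S, w ≠ 0 → 0 < B w w) : IsCompl S (B.orthogonal S) := by
  have hr : B.IsRefl := fun x y hxy => by rw [hB, hxy]
  apply LinearMap.BilinForm.isCompl_orthogonal_of_restrict_nondegenerate hr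
  have key : ∀ w : S, (∀ z : S, B w z = 0) → w = 0 := by
    intro w hw
    by_contra h
    exact (hS w w.2 (fun h' => h (Subtype.ext h'))).ne' (hw w)
  exact ⟨fun w hw => key w hw, fun w hw => key w fun z => by rw [hB]; exact hw z⟩

/-- A vector in the radical of `T + ℝν` is orthogonal to `ν`, where the form is definite. No
condition on `T` is needed, which makes every normal space admissible for `orthProj`. -/
theorem PosOff.isCompl_sup_span (h : PosOff B ν) (T : Submodule ℝ W) :
    IsCompl (T ⊔ Submodule.span ℝ {ν}) (B.orthogonal (T ⊔ Submodule.span ℝ {ν})) := by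
  apply LinearMap.BilinForm.isCompl_orthogonal_of_restrict_nondegenerate h.isRefl
  have key : ∀ w : (T ⊔ Submodule.span ℝ {ν} : Submodule ℝ W),
      (∀ z : (T ⊔ Submodule.span ℝ {ν} : Submodule ℝ W), B w z = 0) → w = 0 := by
    intro w hw
    have hwν := hw ⟨ν, Submodule.mem_sup_right (Submodule.mem_span_singleton_self ν)⟩
    by_contra h0
    exact (h.pos w hwν (fun h' => h0 (Subtype.ext h'))).ne' (hw w)
  exact ⟨fun w hw => key w hw, fun w hw => key w fun z => by rw [h.symm]; exact hw z⟩

theorem PosOff.nondegenerate (h : PosOff B ν) : B.Nondegenerate := by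
  have key : ∀ w : W, (∀ z : W, B w z = 0) → w = 0 := by
    intro w hw
    by_contra h0
    exact (h.pos w (hw ν) h0).ne' (hw w)
  exact ⟨key, fun w hw => key w fun z => by rw [h.symm]; exact hw z⟩

theorem PosOff.orthogonal_orthogonal (h : PosOff B ν) (S : Submodule ℝ W) :
    B.orthogonal (B.orthogonal S) = S :=
  LinearMap.BilinForm.orthogonal_orthogonal h.nondegenerate h.isRefl S

theorem PosOff.finrank_orthogonal (h : PosOff B ν) (S : Submodule ℝ W) :
    finrank ℝ (B.orthogonal S) + finrank ℝ S = finrank ℝ W := by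
  have := LinearMap.BilinForm.finrank_orthogonal h.nondegenerate S
  have := S.finrank_le
  omega

theorem orthProj_eq_of_isCompl {S : Submodule ℝ W} (hS : IsCompl S (B.orthogonal S)) {v u : W}
    (hu : u ∈ S) (hvu : v - u ∈ B.orthogonal S) : orthProj B S v = u := by
  rw [orthProj, dif_pos hS]
  have : v = u + (v - u) := by abel
  rw [this, map_add, Submodule.projection_apply_of_mem_left hS hu,
    Submodule.projection_apply_of_mem_right hS hvu, add_zero]

theorem orthProj_mem_of_isCompl {S : Submodule ℝ W} (hS : IsCompl S (B.orthogonal S)) (v : W) :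
    orthProj B S v ∈ S ∧ v - orthProj B S v ∈ B.orthogonal S := by
  obtain ⟨u, hu, w, hw, rfl⟩ := Submodule.mem_sup.1
    (show v ∈ S ⊔ B.orthogonal S by rw [hS.sup_eq_top]; trivial)
  have := orthProj_eq_of_isCompl (v := u + w) hS hu (by simpa using hw)
  rw [this]
  exact ⟨hu, by simpa using hw⟩

/-- The orthogonal projection to `(T + ν)^⊥`. -/
theorem PosOff.orthProj_iff (h : PosOff B ν) {T : Submodule ℝ W} {v u : W} :
    orthProj B (B.orthogonal (T ⊔ Submodule.span ℝ {ν})) v = u ↔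
      u ∈ B.orthogonal (T ⊔ Submodule.span ℝ {ν}) ∧ v - u ∈ T ⊔ Submodule.span ℝ {ν} := by
  have hc : IsCompl (B.orthogonal (T ⊔ Submodule.span ℝ {ν}))
      (B.orthogonal (B.orthogonal (T ⊔ Submodule.span ℝ {ν}))) := by
    rw [h.orthogonal_orthogonal]; exact (h.isCompl_sup_span T).symm
  constructor
  · rintro rfl
    have := orthProj_mem_of_isCompl hc v
    rwa [h.orthogonal_orthogonal] at this
  · rintro ⟨h1, h2⟩
    exact orthProj_eq_of_isCompl hc h1 (by rwa [h.orthogonal_orthogonal])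

theorem mem_orthogonal_sup_span {T : Submodule ℝ W} {v : W} :
    v ∈ B.orthogonal (T ⊔ Submodule.span ℝ {ν}) ↔ (∀ w ∈ T, B w v = 0) ∧ B ν v = 0 := by
  constructor
  · intro h
    exact ⟨fun w hw => h w (Submodule.mem_sup_left hw),
      h ν (Submodule.mem_sup_right (Submodule.mem_span_singleton_self ν))⟩
  · rintro ⟨h1, h2⟩ w hw
    obtain ⟨t, ht, z, hz, rfl⟩ := Submodule.mem_sup.1 hw
    obtain ⟨c, rfl⟩ := Submodule.mem_span_singleton.1 hz
    show B (t + c • ν) v = 0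
    simp [h1 t ht, h2]

/-- If `T ⊂ L ∩ y^⊥` has codimension one in `L` and `y` is not orthogonal to `L`, then `T^⊥` is
contained in `L^⊥ + ℝ y`. -/
theorem exists_sub_smul_mem_orthogonal {T L : Submodule ℝ W}
    {y v e : W} (hTL : T ≤ L) (hTy : ∀ w ∈ T, B w y = 0) (hdim : finrank ℝ L ≤ finrank ℝ T + 1)
    (he : e ∈ L) (hey : B e y ≠ 0) (hv : ∀ w ∈ T, B w v = 0) :
    v - (B e v / B e y) • y ∈ B.orthogonal L := by
  have heT : e ∉ T := fun h => hey (hTy e h)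
  have hle : T ⊔ Submodule.span ℝ {e} ≤ L :=
    sup_le hTL (by rwa [Submodule.span_singleton_le_iff_mem])
  have hlt : T < T ⊔ Submodule.span ℝ {e} := by
    refine lt_of_le_of_ne le_sup_left fun h => heT ?_
    rw [h]
    exact Submodule.mem_sup_right (Submodule.mem_span_singleton_self e)
  have heq : T ⊔ Submodule.span ℝ {e} = L := by
    apply Submodule.eq_of_le_of_finrank_le hle
    have := Submodule.finrank_lt_finrank_of_lt hlt
    omega
  -- Orthogonality to `T` is inherited from `v` and `y`; the coefficient of `y` is the one that
  -- achieves orthogonality to `e`.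
  rw [← heq, mem_orthogonal_sup_span]
  constructor
  · intro w hw
    simp [hv w hw, hTy w hw]
  · simp only [map_sub, map_smul, smul_eq_mul]
    field_simp
    ring

/-- Orthonormal bases of a subspace on which a symmetric form is positive definite. -/
theorem exists_orthonormal_basis (hB : ∀ x y, B x y = B y x) {S : Submodule ℝ W}
    (hS : ∀ w ∈ S, w ≠ 0 → 0 < B w w) :
    ∃ a : Fin (finrank ℝ S) → W, (∀ i, a i ∈ S) ∧ (∀ i j, B (a i) (a j) = if i = j then 1 else 0) ∧
      ∀ w ∈ S, w = ∑ i, B w (a i) • a i := by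
  set B' : LinearMap.BilinForm ℝ S := B.restrict S with hB'
  have hsymm : LinearMap.IsSymm B' := ⟨fun x y => hB x y⟩
  obtain ⟨v, hv⟩ := LinearMap.BilinForm.exists_orthogonal_basis (B := B') hsymm
  have hvpos : ∀ i, 0 < B (v i) (v i) := fun i =>
    hS (v i) (v i).2 (fun h => v.ne_zero i (Subtype.ext h))
  have horth : ∀ i j, i ≠ j → B (v i) (v j) = 0 := fun i j hij => hv hij
  set a : Fin (finrank ℝ S) → W := fun i => (Real.sqrt (B (v i) (v i)))⁻¹ • (v i : W) with ha
  have hon : ∀ i j, B (a i) (a j) = if i = j then 1 else 0 := by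
    intro i j
    split_ifs with hij
    · subst hij
      have := Real.mul_self_sqrt (hvpos i).le
      have h0 : Real.sqrt (B (v i) (v i)) ≠ 0 := (Real.sqrt_pos.2 (hvpos i)).ne'
      simp only [ha, map_smul, LinearMap.smul_apply, smul_eq_mul]
      field_simp
      rw [pow_two, this]
    · simp [ha, horth i j hij]
  refine ⟨a, fun i => S.smul_mem _ (v i).2, hon, fun w hw => ?_⟩
  have hrep : w ∈ Submodule.span ℝ (Set.range a) := by
    have h1 : (⟨w, hw⟩ : S) = ∑ i, v.repr ⟨w, hw⟩ i • v i := (v.sum_repr _).symm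
    have h2 : w = ∑ i, v.repr ⟨w, hw⟩ i • (v i : W) := by
      exact (congrArg S.subtype h1).trans
        (by simp only [map_sum, map_smul, Submodule.subtype_apply])
    rw [h2]
    refine Submodule.sum_mem _ fun i _ => Submodule.smul_mem _ _ ?_
    have h3 : (v i : W) = Real.sqrt (B (v i) (v i)) • a i := by
      rw [ha, smul_smul, mul_inv_cancel₀ (Real.sqrt_pos.2 (hvpos i)).ne', one_smul]
    rw [h3]
    exact Submodule.smul_mem _ _ (Submodule.subset_span ⟨i, rfl⟩)
  obtain ⟨c, hc⟩ := (Submodule.mem_span_range_iff_exists_fun ℝ).1 hrep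
  have hci : ∀ i, B w (a i) = c i := fun i => by
    rw [← hc]
    simp [hon]
  simp only [hci, hc]

end PosOff

/-! ### Smooth families of subspaces -/

section ConstantRange

variable {E E₁ W : Type*} [NormedAddCommGroup E] [NormedSpace ℝ E]
  [NormedAddCommGroup E₁] [NormedSpace ℝ E₁] [FiniteDimensional ℝ E₁]
  [NormedAddCommGroup W] [NormedSpace ℝ W] [FiniteDimensional ℝ W]

/-- Take for `π` a left inverse at `x₀`; invertible operators form an open set. -/
theorem exists_eventually_isInvertible {v : E → E₁ →L[ℝ] W} {x₀ : E} (hv : ContinuousAt v x₀)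
    (hinj : Function.Injective (v x₀)) :
    ∃ π : W →L[ℝ] E₁, ∀ᶠ x in 𝓝 x₀, (π ∘L v x).IsInvertible := by
  obtain ⟨π, hπ⟩ := (v x₀).toLinearMap.exists_leftInverse_of_injective
    (LinearMap.ker_eq_bot.2 hinj)
  refine ⟨LinearMap.toContinuousLinearMap π, ?_⟩
  have h0 : LinearMap.toContinuousLinearMap π ∘L v x₀
      = (ContinuousLinearEquiv.refl ℝ E₁ : E₁ →L[ℝ] E₁) := by
    ext z
    exact LinearMap.congr_fun hπ z
  have hc : ContinuousAt (fun x => LinearMap.toContinuousLinearMap π ∘L v x) x₀ := by fun_prop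
  have hn := ContinuousLinearEquiv.nhds (ContinuousLinearEquiv.refl ℝ E₁)
  rw [← h0] at hn
  filter_upwards [hc hn] with x hx
  obtain ⟨e, he⟩ := hx
  exact ⟨e, he⟩

/-- A smooth family of injective linear maps has smooth left inverses. -/
theorem exists_smooth_leftInverse {v : E → E₁ →L[ℝ] W} {x₀ : E} {O : Set E} (hO : IsOpen O)
    (hx₀ : x₀ ∈ O) (hv : ContDiffOn ℝ ∞ v O) (hinj : Function.Injective (v x₀)) :
    ∃ (R : E → W →L[ℝ] E₁) (O' : Set E), IsOpen O' ∧ x₀ ∈ O' ∧ O' ⊆ O ∧ ContDiffOn ℝ ∞ R O' ∧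
      ∀ x ∈ O', ∀ z, R x (v x z) = z := by
  obtain ⟨π, hπ⟩ := exists_eventually_isInvertible
    (hv.continuousOn.continuousAt (hO.mem_nhds hx₀)) hinj
  obtain ⟨O', hO', hO'o, hx₀'⟩ := eventually_nhds_iff.1 (hπ.and (hO.mem_nhds hx₀))
  refine ⟨fun x => (π ∘L v x).inverse ∘L π, O', hO'o, hx₀', fun x hx => (hO' x hx).2, ?_, ?_⟩
  · intro x hx
    have h1 : ContDiffAt ℝ ∞ v x := hv.contDiffAt (hO.mem_nhds (hO' x hx).2)
    have h2 : ContDiffAt ℝ ∞ (fun x => π ∘L v x) x := contDiffAt_const.clm_comp h1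
    have h4 : ContDiffAt ℝ ∞ ContinuousLinearMap.inverse (π ∘L v x) :=
      (hO' x hx).1.contDiffAt_map_inverse
    have h3 : ContDiffAt ℝ ∞ (fun x => (π ∘L v x).inverse) x :=
      ContDiffAt.comp (g := ContinuousLinearMap.inverse) (f := fun x => π ∘L v x) x h4 h2
    exact (h3.clm_comp contDiffAt_const).contDiffWithinAt
  · intro x hx z
    have := (hO' x hx).1.inverse_comp_self
    exact DFunLike.congr_fun this z

/-- If the derivatives of a smooth frame stay in its span, the span is locally constant. -/
theorem eventually_range_eq {v : E → E₁ →L[ℝ] W} {x₀ : E} {O : Set E} (hO : IsOpen O)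
    (hx₀ : x₀ ∈ O) (hv : ContDiffOn ℝ ∞ v O) (hinj : Function.Injective (v x₀))
    (hpar : ∀ x ∈ O, ∀ X Z, fderiv ℝ v x X Z ∈ LinearMap.range (v x).toLinearMap) :
    ∀ᶠ x in 𝓝 x₀, LinearMap.range (v x).toLinearMap = LinearMap.range (v x₀).toLinearMap := by
  obtain ⟨π, hπ⟩ := exists_eventually_isInvertible
    (hv.continuousOn.continuousAt (hO.mem_nhds hx₀)) hinj
  obtain ⟨r, hr, hball⟩ := Metric.mem_nhds_iff.1 (hπ.and (hO.mem_nhds hx₀))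
  have hball' : ∀ x ∈ Metric.ball x₀ r, (π ∘L v x).IsInvertible ∧ x ∈ O := fun x hx => hball hx
  -- The frame is normalized so that `π ∘ w = id`. Then `π` annihilates the derivative of `w`, which
  -- takes values in the range of `v`, where `π` is injective; so `w` is constant.
  set w : E → E₁ →L[ℝ] W := fun x => v x ∘L (π ∘L v x).inverse with hw
  have hπw : ∀ x ∈ Metric.ball x₀ r, π ∘L w x = ContinuousLinearMap.id ℝ E₁ := fun x hx => by
    rw [hw, ← ContinuousLinearMap.comp_assoc]
    exact (hball' x hx).1.self_comp_inverse
  have hrange : ∀ x ∈ Metric.ball x₀ r,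
      LinearMap.range (v x).toLinearMap = LinearMap.range (w x).toLinearMap := by
    intro x hx
    apply le_antisymm
    · rintro _ ⟨z, rfl⟩
      refine ⟨(π ∘L v x) z, ?_⟩
      show v x ((π ∘L v x).inverse ((π ∘L v x) z)) = v x z
      congr 1
      exact DFunLike.congr_fun (hball' x hx).1.inverse_comp_self z
    · rintro _ ⟨z, rfl⟩
      exact ⟨_, rfl⟩
  have hdiff : ∀ x ∈ Metric.ball x₀ r, DifferentiableAt ℝ v x ∧
      DifferentiableAt ℝ (fun x => (π ∘L v x).inverse) x := by
    intro x hx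
    have h1 : ContDiffAt ℝ ∞ v x := hv.contDiffAt (hO.mem_nhds (hball' x hx).2)
    have h2 : ContDiffAt ℝ ∞ (fun x => π ∘L v x) x := contDiffAt_const.clm_comp h1
    have h4 : ContDiffAt ℝ ∞ ContinuousLinearMap.inverse (π ∘L v x) :=
      (hball' x hx).1.contDiffAt_map_inverse
    have h3 : ContDiffAt ℝ ∞ (fun x => (π ∘L v x).inverse) x :=
      ContDiffAt.comp (g := ContinuousLinearMap.inverse) (f := fun x => π ∘L v x) x h4 h2
    exact ⟨h1.differentiableAt (by simp), h3.differentiableAt (by simp)⟩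
  have hwdiff : DifferentiableOn ℝ w (Metric.ball x₀ r) := fun x hx =>
    ((hdiff x hx).1.clm_comp (hdiff x hx).2).differentiableWithinAt
  have hzero : ∀ x ∈ Metric.ball x₀ r, fderiv ℝ w x = 0 := by
    intro x hx
    have hx' : Metric.ball x₀ r ∈ 𝓝 x := Metric.isOpen_ball.mem_nhds hx
    have hwx := (hwdiff x hx).differentiableAt hx'
    ext X Z
    have h1 : fderiv ℝ w x X Z ∈ LinearMap.range (v x).toLinearMap := by
      rw [hw, fderiv_clm_comp (hdiff x hx).1 (hdiff x hx).2]
      simp only [add_apply, ContinuousLinearMap.comp_apply,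
        ContinuousLinearMap.compL_apply, ContinuousLinearMap.flip_apply]
      exact Submodule.add_mem _ ⟨_, rfl⟩ (hpar x (hball' x hx).2 _ _)
    obtain ⟨u, hu⟩ := h1
    have h2 : π (fderiv ℝ w x X Z) = 0 := by
      have h3 : fderiv ℝ (fun y => π ∘L w y) x = 0 := by
        have : (fun y => π ∘L w y) =ᶠ[𝓝 x] fun _ => ContinuousLinearMap.id ℝ E₁ := by
          filter_upwards [hx'] with y hy using hπw y hy
        rw [this.fderiv_eq]
        simp
      rw [fderiv_clm_comp (differentiableAt_const _) hwx] at h3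
      have := congrArg (fun L => L X Z) h3
      simpa using this
    have h3 : (π ∘L v x) u = 0 := by
      rw [← hu] at h2
      exact h2
    have h4 : u = 0 := by
      have := DFunLike.congr_fun (hball' x hx).1.inverse_comp_self u
      simpa [h3] using this.symm
    rw [← hu, h4]
    simp
  filter_upwards [Metric.ball_mem_nhds x₀ hr] with x hx
  rw [hrange x hx, hrange x₀ (Metric.mem_ball_self hr)]
  have := Metric.isOpen_ball.is_const_of_fderiv_eq_zero
    (convex_ball x₀ r).isPreconnected hwdiff hzero hx (Metric.mem_ball_self hr)
  rw [this]

end ConstantRange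

/-! ### Immersions that are umbilical along the level sets of a linear function -/

section Umbilical

theorem minSmoothness_two_le_infty : minSmoothness ℝ 2 ≤ (∞ : WithTop ℕ∞) := by
  rw [minSmoothness_of_isRCLikeNormedField]
  exact WithTop.coe_le_coe.2 (le_top : (2 : ℕ∞) ≤ ⊤)

variable {E W : Type*} [NormedAddCommGroup E] [NormedSpace ℝ E] [FiniteDimensional ℝ E]
  [NormedAddCommGroup W] [NormedSpace ℝ W] [FiniteDimensional ℝ W]

/-- Modulo tangent vectors, the second derivative of the immersion `F` is `⟨X, Y⟩ μ` for all `X` and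
all `Y` tangent to the level sets of `ℓ ∘ F`. The field `Z₀` is transversal to these level sets. -/
structure IsUmbilicalAlong (B : W →L[ℝ] W →L[ℝ] ℝ) (ℓ : W →L[ℝ] ℝ) (F μ : E → W) (O : Set E)
    (Z₀ : E) : Prop where
  isOpen : IsOpen O
  smooth : ContDiffOn ℝ ∞ F O
  smooth_mu : ContDiffOn ℝ ∞ μ O
  inj : ∀ x ∈ O, Function.Injective (fderiv ℝ F x)
  notMem : ∀ x ∈ O, μ x ∉ LinearMap.range (fderiv ℝ F x).toLinearMap
  sff : ∀ x ∈ O, ∀ X Y, ℓ (fderiv ℝ F x Y) = 0 →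
    ∃ Z, fderiv ℝ (fderiv ℝ F) x X Y
      = B (fderiv ℝ F x X) (fderiv ℝ F x Y) • μ x + fderiv ℝ F x Z
  pos : ∀ x ∈ O, ∀ Y, Y ≠ 0 → ℓ (fderiv ℝ F x Y) = 0 → 0 < B (fderiv ℝ F x Y) (fderiv ℝ F x Y)
  two : finrank ℝ E = 2 → ∀ x ∈ O, ∀ Y, ℓ (fderiv ℝ F x Y) = 0 →
    fderiv ℝ μ x Y ∈ LinearMap.range (fderiv ℝ F x).toLinearMap
  transversal : ∀ x ∈ O, ℓ (fderiv ℝ F x Z₀) ≠ 0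

namespace IsUmbilicalAlong

variable {B : W →L[ℝ] W →L[ℝ] ℝ} {ℓ : W →L[ℝ] ℝ} {F μ : E → W} {O : Set E} {Z₀ : E}

/-- The vector field in the direction of `Z₀` along which `ℓ ∘ F` has derivative one. -/
def unitField (ℓ : W →L[ℝ] ℝ) (F : E → W) (Z₀ : E) (x : E) : E :=
  (ℓ (fderiv ℝ F x Z₀))⁻¹ • Z₀

/-- The part of `μ` tangent to the level sets of `ℓ`. -/
def levelPart (ℓ : W →L[ℝ] ℝ) (F μ : E → W) (Z₀ : E) (x : E) : W :=
  μ x - ℓ (μ x) • fderiv ℝ F x (unitField ℓ F Z₀ x)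

/-- The vector field tangent to the level sets of `ℓ ∘ F` obtained from the constant field `Z`. -/
def levelField (ℓ : W →L[ℝ] ℝ) (F : E → W) (Z₀ Z : E) (x : E) : E :=
  Z - ℓ (fderiv ℝ F x Z) • unitField ℓ F Z₀ x

/-- The space spanned by the tangent space of the level set and the part of `μ` tangent to it. -/
def levelSpan (ℓ : W →L[ℝ] ℝ) (F μ : E → W) (x : E) : Submodule ℝ W :=
  (LinearMap.range (fderiv ℝ F x).toLinearMap ⊔ Submodule.span ℝ {μ x}) ⊓ LinearMap.ker ℓ.toLinearMap

variable (h : IsUmbilicalAlong B ℓ F μ O Z₀) {x : E} (hx : x ∈ O)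
include h hx

theorem contDiffAt : ContDiffAt ℝ ∞ F x := h.smooth.contDiffAt (h.isOpen.mem_nhds hx)

theorem contDiffAt_mu : ContDiffAt ℝ ∞ μ x := h.smooth_mu.contDiffAt (h.isOpen.mem_nhds hx)

theorem contDiffAt_fderiv : ContDiffAt ℝ ∞ (fderiv ℝ F) x :=
  (h.smooth.fderiv_of_isOpen h.isOpen (by simp)).contDiffAt (h.isOpen.mem_nhds hx)

theorem contDiffAt_unitField : ContDiffAt ℝ ∞ (unitField ℓ F Z₀) x := by
  have h1 := h.contDiffAt_fderiv hx
  have h2 : ContDiffAt ℝ ∞ (fun y => ℓ (fderiv ℝ F y Z₀)) x :=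
    contDiffAt_const.clm_apply (h1.clm_apply contDiffAt_const)
  exact (h2.inv (h.transversal x hx)).smul contDiffAt_const

theorem contDiffAt_levelPart : ContDiffAt ℝ ∞ (levelPart ℓ F μ Z₀) x :=
  (h.contDiffAt_mu hx).sub ((contDiffAt_const.clm_apply (h.contDiffAt_mu hx)).smul
    ((h.contDiffAt_fderiv hx).clm_apply (h.contDiffAt_unitField hx)))

theorem contDiffAt_levelField (Z : E) : ContDiffAt ℝ ∞ (levelField ℓ F Z₀ Z) x :=
  contDiffAt_const.sub ((contDiffAt_const.clm_apply
    ((h.contDiffAt_fderiv hx).clm_apply contDiffAt_const)).smul (h.contDiffAt_unitField hx))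

theorem apply_unitField : ℓ (fderiv ℝ F x (unitField ℓ F Z₀ x)) = 1 := by
  simp [unitField, h.transversal x hx]

theorem apply_levelPart : ℓ (levelPart ℓ F μ Z₀ x) = 0 := by
  simp [levelPart, h.apply_unitField hx]

theorem apply_levelField (Z : E) : ℓ (fderiv ℝ F x (levelField ℓ F Z₀ Z x)) = 0 := by
  simp [levelField, h.apply_unitField hx]

omit h hx in
theorem fderiv_mem_levelSpan {Y : E} (hY : ℓ (fderiv ℝ F x Y) = 0) :
    fderiv ℝ F x Y ∈ levelSpan ℓ F μ x :=
  ⟨Submodule.mem_sup_left ⟨Y, rfl⟩, hY⟩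

theorem levelPart_mem_levelSpan : levelPart ℓ F μ Z₀ x ∈ levelSpan ℓ F μ x :=
  ⟨Submodule.sub_mem _ (Submodule.mem_sup_right (Submodule.mem_span_singleton_self _))
    (Submodule.smul_mem _ _ (Submodule.mem_sup_left ⟨_, rfl⟩)), h.apply_levelPart hx⟩

theorem eventually_mem : ∀ᶠ y in 𝓝 x, y ∈ O := h.isOpen.mem_nhds hx

/-- Since `ℓ` vanishes identically on `dF(Y)`, it vanishes on the derivative. This removes the
transversal tangential component and replaces `μ` by its part in the kernel of `ℓ`. -/
theorem fderiv_fderiv_apply {Y : E → E} (hY : DifferentiableAt ℝ Y x)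
    (hYD : ∀ᶠ y in 𝓝 x, ℓ (fderiv ℝ F y (Y y)) = 0) (X : E) :
    ∃ Z, ℓ (fderiv ℝ F x Z) = 0 ∧ fderiv ℝ (fun y => fderiv ℝ F y (Y y)) x X
      = B (fderiv ℝ F x X) (fderiv ℝ F x (Y x)) • levelPart ℓ F μ Z₀ x + fderiv ℝ F x Z := by
  have hd := (h.contDiffAt_fderiv hx).differentiableAt (by simp)
  have hG : DifferentiableAt ℝ (fun y => fderiv ℝ F y (Y y)) x := hd.clm_apply hY
  have hl : ℓ (fderiv ℝ (fun y => fderiv ℝ F y (Y y)) x X) = 0 := by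
    have h1 : fderiv ℝ (fun y => ℓ (fderiv ℝ F y (Y y))) x = 0 := by
      rw [Filter.EventuallyEq.fderiv_eq (f := fun _ => (0 : ℝ)) hYD]
      simp
    have h2 := (ℓ.hasFDerivAt.comp x hG.hasFDerivAt).fderiv
    have h3 : fderiv ℝ (fun y => ℓ (fderiv ℝ F y (Y y))) x X
        = ℓ (fderiv ℝ (fun y => fderiv ℝ F y (Y y)) x X) := DFunLike.congr_fun h2 X
    rw [← h3, h1]
    rfl
  obtain ⟨Z, hZ⟩ := h.sff x hx X (Y x) hYD.self_of_nhds
  have heq : fderiv ℝ (fun y => fderiv ℝ F y (Y y)) x X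
      = B (fderiv ℝ F x X) (fderiv ℝ F x (Y x)) • μ x + fderiv ℝ F x (Z + fderiv ℝ Y x X) := by
    rw [fderiv_clm_apply hd hY]
    simp only [add_apply, ContinuousLinearMap.comp_apply, ContinuousLinearMap.flip_apply, hZ,
      map_add]
    abel
  set b := B (fderiv ℝ F x X) (fderiv ℝ F x (Y x))
  -- The last summand makes up for exchanging `b • μ` with `b • levelPart`.
  refine ⟨Z + fderiv ℝ Y x X + (b * ℓ (μ x)) • unitField ℓ F Z₀ x, ?_, ?_⟩
  · rw [heq, map_add, map_smul, smul_eq_mul] at hl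
    rw [map_add _ (Z + fderiv ℝ Y x X), map_add, map_smul, map_smul, h.apply_unitField hx,
      smul_eq_mul]
    linarith
  · rw [heq, map_add _ (Z + fderiv ℝ Y x X), map_smul, levelPart, smul_sub, smul_smul]
    abel

theorem fderiv_fderiv_mem {Y : E → E} (hY : DifferentiableAt ℝ Y x)
    (hYD : ∀ᶠ y in 𝓝 x, ℓ (fderiv ℝ F y (Y y)) = 0) (X : E) :
    fderiv ℝ (fun y => fderiv ℝ F y (Y y)) x X ∈ levelSpan ℓ F μ x := by
  obtain ⟨Z, hZ, heq⟩ := h.fderiv_fderiv_apply hx hY hYD X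
  rw [heq]
  exact Submodule.add_mem _ (Submodule.smul_mem _ _ (h.levelPart_mem_levelSpan hx))
    (fderiv_mem_levelSpan hZ)

/-- The second derivative of a vector field tangent to the level sets. -/
theorem snd_fderiv_levelField (Y X X' : E) :
    fderiv ℝ (fderiv ℝ (fun y => fderiv ℝ F y (levelField ℓ F Z₀ Y y))) x X X'
      - B (fderiv ℝ F x X') (fderiv ℝ F x (levelField ℓ F Z₀ Y x)) •
        fderiv ℝ (levelPart ℓ F μ Z₀) x X ∈ levelSpan ℓ F μ x := by
  set G : E → W := fun y => fderiv ℝ F y (levelField ℓ F Z₀ Y y) with hG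
  have hGs : ContDiffOn ℝ ∞ G O := fun y hy => ((h.contDiffAt_fderiv hy).clm_apply
    (h.contDiffAt_levelField hy Y)).contDiffWithinAt
  have hG' : ∀ y ∈ O, ContDiffAt ℝ ∞ (fderiv ℝ G) y := fun y hy =>
    (hGs.fderiv_of_isOpen h.isOpen (by simp)).contDiffAt (h.isOpen.mem_nhds hy)
  set c : E → ℝ := fun y => B (fderiv ℝ F y X') (G y) with hc
  have hcs : ∀ y ∈ O, ContDiffAt ℝ ∞ c y := fun y hy =>
    (contDiffAt_const.clm_apply ((h.contDiffAt_fderiv hy).clm_apply contDiffAt_const)).clm_apply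
      (hGs.contDiffAt (h.isOpen.mem_nhds hy))
  set σ : E → W := fun y => fderiv ℝ G y X' - c y • levelPart ℓ F μ Z₀ y with hσ
  have hσs : ∀ y ∈ O, ContDiffAt ℝ ∞ σ y := fun y hy =>
    ((hG' y hy).clm_apply contDiffAt_const).sub ((hcs y hy).smul (h.contDiffAt_levelPart hy))
  have hσmem : ∀ y ∈ O, ∃ Z, ℓ (fderiv ℝ F y Z) = 0 ∧ σ y = fderiv ℝ F y Z := by
    intro y hy
    obtain ⟨Z, hZ, heq⟩ := h.fderiv_fderiv_apply hy
      ((h.contDiffAt_levelField hy Y).differentiableAt (by simp))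
      (by filter_upwards [h.eventually_mem hy] with z hz using h.apply_levelField hz Y) X'
    refine ⟨Z, hZ, ?_⟩
    rw [hσ]
    simp only
    rw [hG, heq, hc]
    simp [hG]
  -- Pointwise, `σ` is the image of a vector tangent to the level set. A smooth left inverse of `dF`
  -- makes that vector a differentiable field, so that the first-order formula applies to `σ` again.
  obtain ⟨R, O', hO', hxO', hO'O, hRs, hR⟩ := exists_smooth_leftInverse h.isOpen hx
    (h.smooth.fderiv_of_isOpen h.isOpen (m := ∞) (by simp)) (h.inj x hx)
  have hRσ : ∀ y ∈ O', fderiv ℝ F y (R y (σ y)) = σ y ∧ ℓ (fderiv ℝ F y (R y (σ y))) = 0 := by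
    intro y hy
    obtain ⟨Z, hZ, heq⟩ := hσmem y (hO'O hy)
    rw [heq, hR y hy]
    exact ⟨rfl, hZ⟩
  have hσD : fderiv ℝ σ x X ∈ levelSpan ℓ F μ x := by
    have h1 : σ =ᶠ[𝓝 x] fun y => fderiv ℝ F y (R y (σ y)) := by
      filter_upwards [hO'.mem_nhds hxO'] with y hy using (hRσ y hy).1.symm
    rw [h1.fderiv_eq]
    refine h.fderiv_fderiv_mem hx ?_ ?_ X
    · exact ((hRs.contDiffAt (hO'.mem_nhds hxO')).clm_apply (hσs x hx)).differentiableAt (by simp)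
    · filter_upwards [hO'.mem_nhds hxO'] with y hy using (hRσ y hy).2
  have hsum : fderiv ℝ (fderiv ℝ G) x X X' = fderiv ℝ σ x X
      + (c x • fderiv ℝ (levelPart ℓ F μ Z₀) x X + fderiv ℝ c x X • levelPart ℓ F μ Z₀ x) := by
    have h1 : fderiv ℝ (fun y => fderiv ℝ G y X') x X = fderiv ℝ (fderiv ℝ G) x X X' := by
      rw [fderiv_clm_apply ((hG' x hx).differentiableAt (by simp)) (differentiableAt_const _)]
      simp
    have h2 : (fun y => fderiv ℝ G y X') = fun y => σ y + c y • levelPart ℓ F μ Z₀ y := by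
      funext y
      simp [hσ]
    rw [← h1, h2, fderiv_fun_add ((hσs x hx).differentiableAt (by simp))
      (((hcs x hx).differentiableAt (by simp)).fun_smul
        ((h.contDiffAt_levelPart hx).differentiableAt (by simp))),
      fderiv_fun_smul ((hcs x hx).differentiableAt (by simp))
        ((h.contDiffAt_levelPart hx).differentiableAt (by simp))]
    simp
  rw [hsum]
  have : fderiv ℝ σ x X
      + (c x • fderiv ℝ (levelPart ℓ F μ Z₀) x X + fderiv ℝ c x X • levelPart ℓ F μ Z₀ x)
      - c x • fderiv ℝ (levelPart ℓ F μ Z₀) x X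
      = fderiv ℝ σ x X + fderiv ℝ c x X • levelPart ℓ F μ Z₀ x := by abel
  rw [show B (fderiv ℝ F x X') (fderiv ℝ F x (levelField ℓ F Z₀ Y x)) = c x from rfl, this]
  exact Submodule.add_mem _ hσD (Submodule.smul_mem _ _ (h.levelPart_mem_levelSpan hx))

/-- This is the Codazzi step. For the field `G` obtained from `Y`, modulo `levelSpan`, `D²G(X, Y)`
is `⟨Y, Y⟩` times the derivative of `levelPart` along `X`, and `D²G(Y, X)` is `⟨X, Y⟩ = 0` times its
derivative along `Y`. The two agree, and `⟨Y, Y⟩ > 0`. -/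
theorem fderiv_levelPart_mem_of_orthogonal {X Y : E} (hY : ℓ (fderiv ℝ F x Y) = 0) (hY0 : Y ≠ 0)
    (hXY : B (fderiv ℝ F x X) (fderiv ℝ F x Y) = 0) :
    fderiv ℝ (levelPart ℓ F μ Z₀) x X ∈ levelSpan ℓ F μ x := by
  have hYx : levelField ℓ F Z₀ Y x = Y := by simp [levelField, hY]
  have h1 := h.snd_fderiv_levelField hx Y X Y
  have h2 := h.snd_fderiv_levelField hx Y Y X
  rw [hYx] at h1 h2
  rw [hXY, zero_smul, sub_zero] at h2
  have hsymm : IsSymmSndFDerivAt ℝ (fun y => fderiv ℝ F y (levelField ℓ F Z₀ Y y)) x := by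
    have hc : ContDiffAt ℝ ∞ (fun y => fderiv ℝ F y (levelField ℓ F Z₀ Y y)) x :=
      (h.contDiffAt_fderiv hx).clm_apply (h.contDiffAt_levelField hx Y)
    exact hc.isSymmSndFDerivAt minSmoothness_two_le_infty
  rw [hsymm.eq Y X] at h2
  have h3 := Submodule.sub_mem _ h2 h1
  rw [sub_sub_cancel] at h3
  exact (Submodule.smul_mem_iff _ (h.pos x hx Y hY0 hY).ne').1 h3

/-- On a one-dimensional level set no nonzero tangent vector is orthogonal to the direction of
differentiation, so the assumption `two` on the derivative of `μ` must take the place of the Codazzi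
step. -/
theorem fderiv_levelPart_mem_of_two (h2 : finrank ℝ E = 2) {Y : E}
    (hY : ℓ (fderiv ℝ F x Y) = 0) :
    fderiv ℝ (levelPart ℓ F μ Z₀) x Y ∈ levelSpan ℓ F μ x := by
  have hμ := (h.contDiffAt_mu hx).differentiableAt (by simp)
  have hd := (h.contDiffAt_fderiv hx).differentiableAt (by simp)
  have hu := (h.contDiffAt_unitField hx).differentiableAt (by simp)
  have hℓμ : DifferentiableAt ℝ (fun y => ℓ (μ y)) x := ℓ.differentiableAt.comp x hμ
  have hP := (h.contDiffAt_levelPart hx).differentiableAt (by simp)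
  refine ⟨?_, ?_⟩
  · have heq : fderiv ℝ (levelPart ℓ F μ Z₀) x Y = fderiv ℝ μ x Y
        - (ℓ (μ x) • fderiv ℝ (fun y => fderiv ℝ F y (unitField ℓ F Z₀ y)) x Y
          + fderiv ℝ (fun y => ℓ (μ y)) x Y • fderiv ℝ F x (unitField ℓ F Z₀ x)) := by
      have : levelPart ℓ F μ Z₀
          = fun y => μ y - ℓ (μ y) • fderiv ℝ F y (unitField ℓ F Z₀ y) := rfl
      rw [this, fderiv_fun_sub hμ (hℓμ.fun_smul (hd.clm_apply hu)),
        fderiv_fun_smul hℓμ (hd.clm_apply hu)]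
      simp
    have hsymm : IsSymmSndFDerivAt ℝ F x :=
      (h.contDiffAt hx).isSymmSndFDerivAt minSmoothness_two_le_infty
    obtain ⟨Z, hZ⟩ := h.sff x hx (unitField ℓ F Z₀ x) Y hY
    have h3 : fderiv ℝ (fun y => fderiv ℝ F y (unitField ℓ F Z₀ y)) x Y ∈
        LinearMap.range (fderiv ℝ F x).toLinearMap ⊔ Submodule.span ℝ {μ x} := by
      rw [fderiv_clm_apply hd hu]
      simp only [add_apply, ContinuousLinearMap.comp_apply, ContinuousLinearMap.flip_apply]
      -- Symmetry moves the level vector `Y` into the second slot, the only one in which `sff` gives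
      -- information.
      rw [hsymm.eq Y, hZ]
      refine Submodule.add_mem _ (Submodule.mem_sup_left ⟨_, rfl⟩) (Submodule.add_mem _
        (Submodule.smul_mem _ _ (Submodule.mem_sup_right (Submodule.mem_span_singleton_self _)))
        (Submodule.mem_sup_left ⟨_, rfl⟩))
    rw [heq]
    exact Submodule.sub_mem _ (Submodule.mem_sup_left (h.two h2 x hx Y hY))
      (Submodule.add_mem _ (Submodule.smul_mem _ _ h3)
        (Submodule.smul_mem _ _ (Submodule.mem_sup_left ⟨_, rfl⟩)))
  · have h1 : fderiv ℝ (fun y => ℓ (levelPart ℓ F μ Z₀ y)) x = 0 := by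
      rw [Filter.EventuallyEq.fderiv_eq (f := fun _ => (0 : ℝ))
        (by filter_upwards [h.eventually_mem hx] with y hy using h.apply_levelPart hy)]
      simp
    have h3 := (ℓ.hasFDerivAt.comp x hP.hasFDerivAt).fderiv
    have h4 : fderiv ℝ (fun y => ℓ (levelPart ℓ F μ Z₀ y)) x Y
        = ℓ (fderiv ℝ (levelPart ℓ F μ Z₀) x Y) := DFunLike.congr_fun h3 Y
    rw [h1] at h4
    exact h4.symm

theorem exists_level_vector (hdim : 2 ≤ finrank ℝ E) : ∃ Y, Y ≠ 0 ∧ ℓ (fderiv ℝ F x Y) = 0 := by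
  have hk := (ℓ ∘L fderiv ℝ F x).toLinearMap.finrank_range_add_finrank_ker
  have hr : finrank ℝ (LinearMap.range (ℓ ∘L fderiv ℝ F x).toLinearMap) ≤ 1 :=
    (Submodule.finrank_le _).trans (by simp)
  have hpos : 0 < finrank ℝ (LinearMap.ker (ℓ ∘L fderiv ℝ F x).toLinearMap) := by omega
  have := finrank_pos_iff_exists_ne_zero.1 hpos
  obtain ⟨Y, hY⟩ := this
  exact ⟨Y, fun h0 => hY (Subtype.ext h0), Y.2⟩

/-- In dimension at least three, being tangent to the level set and orthogonal to `X` are two linear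
conditions, which leave a nonzero `Y`. In dimension two, `X` is split into its component along the
level curve and an orthogonal one. -/
theorem fderiv_levelPart_mem (hdim : 2 ≤ finrank ℝ E) (X : E) :
    fderiv ℝ (levelPart ℓ F μ Z₀) x X ∈ levelSpan ℓ F μ x := by
  rcases hdim.eq_or_lt with h2 | h3
  · obtain ⟨Y, hY0, hY⟩ := h.exists_level_vector hx hdim
    have hpos := h.pos x hx Y hY0 hY
    set c := B (fderiv ℝ F x X) (fderiv ℝ F x Y) / B (fderiv ℝ F x Y) (fderiv ℝ F x Y)
    have h1 := h.fderiv_levelPart_mem_of_two hx h2.symm hY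
    have h4 := h.fderiv_levelPart_mem_of_orthogonal hx (X := X - c • Y) hY hY0 (by
      simp only [map_sub, map_smul, sub_apply, smul_apply, smul_eq_mul, c]
      field_simp
      ring)
    have : X = (X - c • Y) + c • Y := by abel
    rw [this, map_add, map_smul]
    exact Submodule.add_mem _ h4 (Submodule.smul_mem _ _ h1)
  · set Λ : E →L[ℝ] ℝ × ℝ := (ℓ ∘L fderiv ℝ F x).prod (B (fderiv ℝ F x X) ∘L fderiv ℝ F x)
    have hk := Λ.toLinearMap.finrank_range_add_finrank_ker
    have hr : finrank ℝ (LinearMap.range Λ.toLinearMap) ≤ 2 :=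
      (Submodule.finrank_le _).trans (by simp)
    have hpos : 0 < finrank ℝ (LinearMap.ker Λ.toLinearMap) := by omega
    obtain ⟨⟨Y, hYk⟩, hY0⟩ := finrank_pos_iff_exists_ne_zero.1 hpos
    have hYk : Λ Y = 0 := hYk
    exact h.fderiv_levelPart_mem_of_orthogonal hx (Y := Y) (congrArg Prod.fst hYk)
      (fun h0 => hY0 (Subtype.ext h0)) (congrArg Prod.snd hYk)

omit hx in
/-- The level sets of `ℓ ∘ F` have their tangent spaces in a fixed subspace. -/
theorem exists_subspace {x₀ : E} (hx₀ : x₀ ∈ O) (hdim : 2 ≤ finrank ℝ E) :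
    ∃ L : Submodule ℝ W, finrank ℝ L = finrank ℝ E ∧ (∀ w ∈ L, ℓ w = 0) ∧
      (ℓ (μ x₀) = 0 → μ x₀ ∈ L) ∧
      ∀ᶠ x in 𝓝 x₀, ∀ Y, ℓ (fderiv ℝ F x Y) = 0 → fderiv ℝ F x Y ∈ L := by
  -- `v` is `dF` with the image of the transversal unit field exchanged for `levelPart`. It is a
  -- frame of `levelSpan` indexed by `E` itself, whence the dimension of the fixed subspace.
  set v : E → E →L[ℝ] W := fun x => fderiv ℝ F x + (ℓ ∘L fderiv ℝ F x).smulRight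
    (levelPart ℓ F μ Z₀ x - fderiv ℝ F x (unitField ℓ F Z₀ x)) with hv
  have hvZ : ∀ x Z, v x Z = fderiv ℝ F x (levelField ℓ F Z₀ Z x)
      + ℓ (fderiv ℝ F x Z) • levelPart ℓ F μ Z₀ x := by
    intro x Z
    simp only [hv, add_apply, ContinuousLinearMap.smulRight_apply, ContinuousLinearMap.comp_apply,
      levelField, map_sub, map_smul, smul_sub]
    abel
  have hrange : ∀ x ∈ O, LinearMap.range (v x).toLinearMap = levelSpan ℓ F μ x := by
    intro x hx
    apply le_antisymm
    · rintro _ ⟨Z, rfl⟩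
      show v x Z ∈ _
      rw [hvZ]
      exact Submodule.add_mem _ (fderiv_mem_levelSpan (h.apply_levelField hx Z))
        (Submodule.smul_mem _ _ (h.levelPart_mem_levelSpan hx))
    · rintro w ⟨hw, hwℓ⟩
      obtain ⟨_, ⟨Z, rfl⟩, z, hz, rfl⟩ := Submodule.mem_sup.1 hw
      obtain ⟨c, rfl⟩ := Submodule.mem_span_singleton.1 hz
      have hwℓ : ℓ (fderiv ℝ F x Z + c • μ x) = 0 := hwℓ
      rw [map_add, map_smul, smul_eq_mul] at hwℓ
      -- As `ℓ(dF Z) = -c ℓ(μ)`, this multiple gives the preimage the value `c` under `ℓ ∘ dF`, the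
      -- coefficient of `levelPart`.
      refine ⟨Z + (c * ℓ (μ x) + c) • unitField ℓ F Z₀ x, ?_⟩
      show v x _ = fderiv ℝ F x Z + c • μ x
      rw [hvZ, levelField]
      simp only [map_add, map_smul, h.apply_unitField hx, smul_eq_mul, mul_one, map_sub,
        levelPart, smul_sub, smul_smul]
      have e1 : ℓ (fderiv ℝ F x Z) + (c * ℓ (μ x) + c) = c := by linarith
      rw [e1]
      module
  have hvs : ContDiffOn ℝ ∞ v O := fun y hy => by
    refine ContDiffAt.contDiffWithinAt ?_
    have h1 := h.contDiffAt_fderiv hy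
    exact h1.add ((contDiffAt_const.clm_comp h1).smulRight
      ((h.contDiffAt_levelPart hy).sub (h1.clm_apply (h.contDiffAt_unitField hy))))
  have hinj : Function.Injective (v x₀) := by
    rw [injective_iff_map_eq_zero]
    intro Z hZ
    rw [hvZ, levelPart] at hZ
    by_cases hc : ℓ (fderiv ℝ F x₀ Z) = 0
    · rw [hc, zero_smul, add_zero, levelField, hc, zero_smul, sub_zero] at hZ
      exact (injective_iff_map_eq_zero _).1 (h.inj x₀ hx₀) Z hZ
    -- Otherwise the vanishing of `v x₀ Z` would express `μ x₀` through tangent vectors.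
    · exfalso
      apply h.notMem x₀ hx₀
      have h1 : ℓ (fderiv ℝ F x₀ Z) • μ x₀ ∈ LinearMap.range (fderiv ℝ F x₀).toLinearMap := by
        refine ⟨(ℓ (fderiv ℝ F x₀ Z) * ℓ (μ x₀)) • unitField ℓ F Z₀ x₀ - levelField ℓ F Z₀ Z x₀, ?_⟩
        show fderiv ℝ F x₀ _ = _
        rw [map_sub, map_smul, sub_eq_iff_eq_add, ← sub_eq_zero, ← neg_eq_zero, ← hZ, smul_sub,
          smul_smul]
        abel
      exact (Submodule.smul_mem_iff _ hc).1 h1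
  have hpar : ∀ x ∈ O, ∀ X Z, fderiv ℝ v x X Z ∈ LinearMap.range (v x).toLinearMap := by
    intro x hx X Z
    rw [hrange x hx]
    have hvd := (hvs.contDiffAt (h.isOpen.mem_nhds hx)).differentiableAt (by simp)
    have hd := (h.contDiffAt_fderiv hx).differentiableAt (by simp)
    have hf := (h.contDiffAt_levelField hx Z).differentiableAt (by simp)
    have hP := (h.contDiffAt_levelPart hx).differentiableAt (by simp)
    have hcd : DifferentiableAt ℝ (fun y => ℓ (fderiv ℝ F y Z)) x :=
      ℓ.differentiableAt.comp x (hd.clm_apply (differentiableAt_const _))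
    have h1 : fderiv ℝ (fun y => v y Z) x X = fderiv ℝ v x X Z := by
      rw [fderiv_clm_apply hvd (differentiableAt_const _)]
      simp
    rw [← h1, funext (fun y => hvZ y Z), fderiv_fun_add (hd.clm_apply hf) (hcd.fun_smul hP),
      fderiv_fun_smul hcd hP]
    simp only [add_apply, smul_apply, ContinuousLinearMap.smulRight_apply]
    refine Submodule.add_mem _ ?_ (Submodule.add_mem _ (Submodule.smul_mem _ _
      (h.fderiv_levelPart_mem hx hdim X)) (Submodule.smul_mem _ _ (h.levelPart_mem_levelSpan hx)))
    exact h.fderiv_fderiv_mem hx hf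
      (by filter_upwards [h.eventually_mem hx] with z hz using h.apply_levelField hz Z) X
  refine ⟨levelSpan ℓ F μ x₀, ?_, fun w hw => hw.2, fun h0 =>
    ⟨Submodule.mem_sup_right (Submodule.mem_span_singleton_self _), h0⟩, ?_⟩
  · rw [← hrange x₀ hx₀]
    exact LinearMap.finrank_range_of_inj hinj
  · filter_upwards [eventually_range_eq h.isOpen hx₀ hvs hinj hpar, h.eventually_mem hx₀]
      with x hx hxO Y hY
    rw [← hrange x₀ hx₀, ← hx, hrange x hxO]
    exact fderiv_mem_levelSpan hY

end IsUmbilicalAlong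

end Umbilical

/-! ### Calculus with bilinear forms -/

section Calculus

variable {E W : Type*} [NormedAddCommGroup E] [NormedSpace ℝ E]
  [NormedAddCommGroup W] [NormedSpace ℝ W] [FiniteDimensional ℝ W]

theorem contDiffAt_bilin (B : LinearMap.BilinForm ℝ W) {k : WithTop ℕ∞} {u w : E → W} {x : E}
    (hu : ContDiffAt ℝ k u x) (hw : ContDiffAt ℝ k w x) :
    ContDiffAt ℝ k (fun y => B (u y) (w y)) x :=
  (contDiffAt_const (c := LinearMap.toContinuousBilinearMap B)).clm_apply hu |>.clm_apply hw

theorem hasFDerivAt_bilin (B : LinearMap.BilinForm ℝ W) {u w : E → W} {x : E} {u' w' : E →L[ℝ] W}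
    (hu : HasFDerivAt u u' x) (hw : HasFDerivAt w w' x) :
    HasFDerivAt (fun y => B (u y) (w y))
      ((LinearMap.toContinuousBilinearMap B).flip (w x) ∘L u'
        + (LinearMap.toContinuousBilinearMap B) (u x) ∘L w') x := by
  have h := (LinearMap.toContinuousBilinearMap B).isBoundedBilinearMap.hasFDerivAt (u x, w x)
  have h2 := h.comp x (hu.prodMk hw)
  refine h2.congr_fderiv ?_
  ext X
  simp [add_comm]

theorem fderiv_bilin_apply (B : LinearMap.BilinForm ℝ W) {u w : E → W} {x : E}
    (hu : DifferentiableAt ℝ u x) (hw : DifferentiableAt ℝ w x) (X : E) :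
    fderiv ℝ (fun y => B (u y) (w y)) x X = B (fderiv ℝ u x X) (w x) + B (u x) (fderiv ℝ w x X) := by
  rw [(hasFDerivAt_bilin B hu.hasFDerivAt hw.hasFDerivAt).fderiv]
  simp

theorem fderiv_bilin_const_apply (B : LinearMap.BilinForm ℝ W) {u : E → W} {x : E}
    (hu : DifferentiableAt ℝ u x) (X : E) (a : W) :
    fderiv ℝ (fun y => B (u y) a) x X = B (fderiv ℝ u x X) a := by
  rw [fderiv_bilin_apply B hu (differentiableAt_const a)]
  simp

theorem fderiv_clm_apply_const {V : Type*} [NormedAddCommGroup V] [NormedSpace ℝ V]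
    {v : E → V →L[ℝ] W} {x : E} (hv : DifferentiableAt ℝ v x) (X : E) (Z : V) :
    fderiv ℝ (fun y => v y Z) x X = fderiv ℝ v x X Z := by
  rw [fderiv_clm_apply hv (differentiableAt_const _)]
  simp

theorem fderiv_comp_clm_apply {V : Type*} [NormedAddCommGroup V] [NormedSpace ℝ V]
    (ℓ : W →L[ℝ] V) {u : E → W} {x : E} (hu : DifferentiableAt ℝ u x) (X : E) :
    fderiv ℝ (fun y => ℓ (u y)) x X = ℓ (fderiv ℝ u x X) :=
  DFunLike.congr_fun (ℓ.hasFDerivAt.comp x hu.hasFDerivAt).fderiv X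

theorem fderiv_fst_apply {V : Type*} [NormedAddCommGroup V] [NormedSpace ℝ V]
    {u : E → V × W} {x : E} (hu : DifferentiableAt ℝ u x) (X : E) :
    fderiv ℝ (fun y => (u y).1) x X = (fderiv ℝ u x X).1 := by
  rw [fderiv.fst hu]; rfl

theorem fderiv_snd_apply {V : Type*} [NormedAddCommGroup V] [NormedSpace ℝ V]
    {u : E → V × W} {x : E} (hu : DifferentiableAt ℝ u x) (X : E) :
    fderiv ℝ (fun y => (u y).2) x X = (fderiv ℝ u x X).2 := by
  rw [fderiv.snd hu]; rfl

theorem fderiv_eq_zero_of_eventually_const {u : E → W} {x : E} {c : W}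
    (h : ∀ᶠ y in 𝓝 x, u y = c) : fderiv ℝ u x = 0 := by
  rw [Filter.EventuallyEq.fderiv_eq (f := fun _ => c) h]
  simp

variable {B : LinearMap.BilinForm ℝ W}

/-- The position vector is normal to a map into a quadric. -/
theorem bilin_fderiv_self (hB : ∀ x y, B x y = B y x) {g : E → W} {x : E} {c : ℝ}
    (hg : DifferentiableAt ℝ g x) (h : ∀ᶠ y in 𝓝 x, B (g y) (g y) = c) (X : E) :
    B (fderiv ℝ g x X) (g x) = 0 := by
  have h1 := fderiv_bilin_apply B hg hg X
  rw [fderiv_eq_zero_of_eventually_const h, hB (g x)] at h1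
  simp only [zero_apply] at h1
  linarith

/-- The second fundamental form of a quadric. -/
theorem bilin_snd_fderiv_self (hB : ∀ x y, B x y = B y x) {g : E → W} {x : E} {c : ℝ}
    (hg : ContDiffAt ℝ ∞ g x) (h : ∀ᶠ y in 𝓝 x, B (g y) (g y) = c) (X Y : E) :
    B (fderiv ℝ (fderiv ℝ g) x X Y) (g x) = - B (fderiv ℝ g x X) (fderiv ℝ g x Y) := by
  have hd : ∀ᶠ y in 𝓝 x, DifferentiableAt ℝ g y := by
    have : ContDiffAt ℝ 1 g x := hg.of_le (by simp)
    filter_upwards [this.eventually fun h => by simpa using WithTop.coe_injective h] with y hy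
    exact hy.differentiableAt (by simp)
  have hd2 : DifferentiableAt ℝ (fderiv ℝ g) x :=
    (hg.fderiv_right (m := ∞) (by simp)).differentiableAt (by simp)
  have h1 : ∀ᶠ y in 𝓝 x, B (fderiv ℝ g y Y) (g y) = 0 := by
    filter_upwards [hd, h.eventually_nhds] with y hy hy'
    exact bilin_fderiv_self hB hy hy' Y
  have h2 := fderiv_bilin_apply B (hd2.clm_apply (differentiableAt_const Y)) hd.self_of_nhds X
  rw [fderiv_eq_zero_of_eventually_const h1, fderiv_clm_apply_const hd2] at h2
  simp only [zero_apply] at h2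
  rw [hB (fderiv ℝ g x X)]
  linarith

end Calculus

/-! ### Maps from a manifold in local coordinates -/

section Transfer

variable {m n : ℕ} {M : Type*} [TopologicalSpace M] [ChartedSpace (EuclideanSpace ℝ (Fin m)) M]

theorem push_eq_mfderiv {f : M → FlatR n} {p : M} (hf : MDifferentiableAt (𝓡 m) 𝓘(ℝ, FlatR n) f p)
    (X : EuclideanSpace ℝ (Fin m)) :
    push m f p X = mfderiv (𝓡 m) 𝓘(ℝ, FlatR n) f p X := by
  obtain ⟨D, hD⟩ : ∃ D : EuclideanSpace ℝ (Fin m) →L[ℝ] FlatR n,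
      D = mfderiv (𝓡 m) 𝓘(ℝ, FlatR n) f p := ⟨_, rfl⟩
  have h1 : HasFDerivWithinAt (inChart m f p) D (range (𝓡 m)) (pt m p) := by
    rw [hD]; exact hf.hasMFDerivAt.2
  rw [ModelWithCorners.range_eq_univ, hasFDerivWithinAt_univ] at h1
  exact (DFunLike.congr_fun h1.fderiv X).trans (DFunLike.congr_fun hD X)

theorem inChart_eq {W : Type*} (u : M → W) (p : M) :
    inChart m u p = u ∘ (chartAt (EuclideanSpace ℝ (Fin m)) p).symm := by
  rfl

theorem pt_eq (p : M) : pt m p = chartAt (EuclideanSpace ℝ (Fin m)) p p := by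
  rfl

variable {E : Type*} [NormedAddCommGroup E] [NormedSpace ℝ E]

theorem contDiffOn_comp_param {W : Type*} [NormedAddCommGroup W] [NormedSpace ℝ W]
    {ψ : OpenPartialHomeomorph E M} (hψ : ContMDiffOn 𝓘(ℝ, E) (𝓡 m) ∞ ψ ψ.source)
    {u : M → W} (hu : ContMDiff (𝓡 m) 𝓘(ℝ, W) ∞ u) : ContDiffOn ℝ ∞ (u ∘ ψ) ψ.source :=
  contMDiffOn_iff_contDiffOn.1 (hu.comp_contMDiffOn hψ)

/-- The derivative of a map in terms of a local parametrization. -/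
theorem exists_equiv_push {f : M → FlatR n} (hf : ContMDiff (𝓡 m) 𝓘(ℝ, FlatR n) ∞ f)
    [IsManifold (𝓡 m) ∞ M]
    {ψ : OpenPartialHomeomorph E M} (hψ : ContMDiffOn 𝓘(ℝ, E) (𝓡 m) ∞ ψ ψ.source)
    (hψ' : ContMDiffOn (𝓡 m) 𝓘(ℝ, E) ∞ ψ.symm ψ.target) {z : E} (hz : z ∈ ψ.source) :
    ∃ θ : E ≃L[ℝ] EuclideanSpace ℝ (Fin m), ∀ X, fderiv ℝ (f ∘ ψ) z X = push m f (ψ z) (θ X) := by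
  have hd : ψ.MDifferentiable 𝓘(ℝ, E) (𝓡 m) :=
    ⟨hψ.mdifferentiableOn (by simp), hψ'.mdifferentiableOn (by simp)⟩
  refine ⟨hd.mfderiv hz, fun X => ?_⟩
  have hfd : MDifferentiableAt (𝓡 m) 𝓘(ℝ, FlatR n) f (ψ z) := (hf _).mdifferentiableAt (by simp)
  rw [push_eq_mfderiv hfd, ← mfderiv_eq_fderiv, mfderiv_comp z hfd (hd.mdifferentiableAt hz)]
  rfl

variable [IsManifold (𝓡 m) ∞ M]

theorem contMDiffOn_chart_symm (p : M) :
    ContMDiffOn 𝓘(ℝ, EuclideanSpace ℝ (Fin m)) (𝓡 m) ∞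
      (chartAt (EuclideanSpace ℝ (Fin m)) p).symm
      (chartAt (EuclideanSpace ℝ (Fin m)) p).symm.source :=
  _root_.contMDiffOn_chart_symm (I := 𝓡 m) (x := p)

theorem contMDiffOn_chart (p : M) :
    ContMDiffOn (𝓡 m) 𝓘(ℝ, EuclideanSpace ℝ (Fin m)) ∞
      (chartAt (EuclideanSpace ℝ (Fin m)) p).symm.symm
      (chartAt (EuclideanSpace ℝ (Fin m)) p).symm.target :=
  _root_.contMDiffOn_chart (I := 𝓡 m) (x := p)

end Transfer

/-! ### The height function -/

section Height

variable {ε : ℝ} {m n : ℕ} {M : Type*} [TopologicalSpace M]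
  [ChartedSpace (EuclideanSpace ℝ (Fin m)) M] [IsManifold (𝓡 m) ∞ M] {f : M → FlatR n}

theorem push_injective (hf : QxR.IsImmersion m ε f) (p : M) : Function.Injective (push m f p) := by
  have hfd : MDifferentiableAt (𝓡 m) 𝓘(ℝ, FlatR n) f p := (hf.1 _).mdifferentiableAt (by simp)
  intro X Y h
  rw [push_eq_mfderiv hfd, push_eq_mfderiv hfd] at h
  exact (hf.2 p).2 h

theorem form_push_self (hf : QxR.IsImmersion m ε f) (p : M) (X : EuclideanSpace ℝ (Fin m)) :
    form ε n (push m f p X).1 (f p).1 = 0 := by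
  have hs := contDiffOn_comp_param (contMDiffOn_chart_symm p) hf.1
  have hpt : pt m p ∈ (chartAt (EuclideanSpace ℝ (Fin m)) p).symm.source := by
    rw [pt_eq]; exact mem_chart_target _ p
  have hd : DifferentiableAt ℝ (inChart m f p) (pt m p) := (hs.contDiffAt
    ((chartAt (EuclideanSpace ℝ (Fin m)) p).symm.open_source.mem_nhds hpt)).differentiableAt
      (by simp)
  have hfp : inChart m f p (pt m p) = f p := by
    rw [inChart, pt, Function.comp_apply, extChartAt_to_inv]
  have := bilin_fderiv_self (B := form ε n) form_comm (g := fun x => (inChart m f p x).1)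
    (c := ε) hd.fst (Eventually.of_forall fun x => (hf.2 _).1.1) X
  rwa [fderiv_fst_apply hd, hfp] at this

theorem formR_push_pos (hε : ε = 1 ∨ ε = -1) (hf : QxR.IsImmersion m ε f) (p : M)
    {w : FlatR n} (hw : w ∈ tangentSpan (inChart m f p) (pt m p)) (h0 : w ≠ 0) :
    0 < formR ε n w w := by
  obtain ⟨X, rfl⟩ := hw
  have := form_push_self hf p X
  refine (posOff_formR hε (hf.2 p).1).pos _ ?_ h0
  rw [formR_apply]
  simp only [nu, mul_zero, add_zero]
  exact this

theorem isCompl_tangentSpan (hε : ε = 1 ∨ ε = -1) (hf : QxR.IsImmersion m ε f) (p : M) :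
    IsCompl (tangentSpan (inChart m f p) (pt m p))
      ((formR ε n).orthogonal (tangentSpan (inChart m f p) (pt m p))) :=
  isCompl_orthogonal_of_pos formR_comm fun _ hw h0 => formR_push_pos hε hf p hw h0

/-- The difference of `∂/∂t` and `f_*T` is normal, and the product with `∂/∂t` reads off the height.
Thus `{T}^⊥` is the kernel of the differential of the height function. -/
theorem formR_push_pushT (hε : ε = 1 ∨ ε = -1) (hf : QxR.IsImmersion m ε f) (p : M)
    (Y : EuclideanSpace ℝ (Fin m)) :
    formR ε n (push m f p Y) (pushT m ε f p) = (push m f p Y).2 := by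
  have h := (orthProj_mem_of_isCompl (isCompl_tangentSpan hε hf p) (dt n)).2
    (push m f p Y) ⟨Y, rfl⟩
  have h : formR ε n (push m f p Y) (dt n - pushT m ε f p) = 0 := h
  rw [map_sub, sub_eq_zero] at h
  rw [← h]
  simp [formR_apply, dt]

/-- If the height were stationary, the tangent vector `f_*T` would have zero square, although the
tangent space is Riemannian and `f_*T ≠ 0`. -/
theorem exists_push_snd_ne_zero (hε : ε = 1 ∨ ε = -1) (hf : QxR.IsImmersion m ε f) {p : M}
    (hT : pushT m ε f p ≠ 0) : ∃ X, (push m f p X).2 ≠ 0 := by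
  by_contra! hcon
  obtain ⟨Y, hY⟩ := (orthProj_mem_of_isCompl (isCompl_tangentSpan hε hf p) (dt n)).1
  have hY : push m f p Y = pushT m ε f p := hY
  have h1 := formR_push_pushT hε hf p Y
  rw [hcon, hY] at h1
  exact (formR_push_pos hε hf p ⟨Y, hY⟩ hT).ne' h1

end Height

/-! ### Immersions whose level sets have tangent spaces orthogonal to a fixed subspace -/

section Axial

/-- `F` is an immersion into `ℚ_ε^n × ℝ` whose height function has no critical points and whose
level sets have tangent spaces orthogonal to `A`. -/
structure IsAxial {E : Type*} [NormedAddCommGroup E] [NormedSpace ℝ E] (ε : ℝ) (n : ℕ)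
    (A : Submodule ℝ (Flat n)) (F : E → FlatR n) (O : Set E) : Prop where
  isOpen : IsOpen O
  smooth : ContDiffOn ℝ ∞ F O
  mem : ∀ x ∈ O, (F x).1 ∈ quadric ε n
  inj : ∀ x ∈ O, Function.Injective (fderiv ℝ F x)
  transversal : ∀ x ∈ O, ∃ X, (fderiv ℝ F x X).2 ≠ 0
  axis : ∀ x ∈ O, ∀ Y, (fderiv ℝ F x Y).2 = 0 → (fderiv ℝ F x Y).1 ∈ (form ε n).orthogonal A
  finrank : finrank ℝ A + finrank ℝ E = n + 1

/-- Locally, the level sets of the height function have tangent spaces orthogonal to a fixed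
subspace `A` of dimension `n - m + 1` with the property `C`. -/
def IsLocallyAxial (m : ℕ) {M : Type*} [TopologicalSpace M]
    [ChartedSpace (EuclideanSpace ℝ (Fin m)) M] {n : ℕ} (ε : ℝ) (f : M → FlatR n)
    (C : Submodule ℝ (Flat n) → Prop) : Prop :=
  ∀ p : M, ∃ (U : Set M) (A : Submodule ℝ (Flat n)), IsOpen U ∧ p ∈ U ∧
    finrank ℝ A + m = n + 1 ∧ C A ∧
    ∀ q ∈ U, ∀ Y, (push m f q Y).2 = 0 → (push m f q Y).1 ∈ (form ε n).orthogonal A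

variable {ε : ℝ} {m n : ℕ} {M : Type*} [TopologicalSpace M]
  [ChartedSpace (EuclideanSpace ℝ (Fin m)) M] [IsManifold (𝓡 m) ∞ M] {f : M → FlatR n}

theorem isAxial_param (hε : ε = 1 ∨ ε = -1) (hf : QxR.IsImmersion m ε f)
    (hT : ∀ p, pushT m ε f p ≠ 0) {A : Submodule ℝ (Flat n)} (hA : finrank ℝ A + m = n + 1)
    {U : Set M} (hU : IsOpen U)
    (hax : ∀ q ∈ U, ∀ Y, (push m f q Y).2 = 0 → (push m f q Y).1 ∈ (form ε n).orthogonal A)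
    {E : Type*} [NormedAddCommGroup E] [NormedSpace ℝ E] {ψ : OpenPartialHomeomorph E M}
    (hψ : ContMDiffOn 𝓘(ℝ, E) (𝓡 m) ∞ ψ ψ.source)
    (hψ' : ContMDiffOn (𝓡 m) 𝓘(ℝ, E) ∞ ψ.symm ψ.target) (hE : finrank ℝ E = m) :
    IsAxial ε n A (f ∘ ψ) (ψ.source ∩ ψ ⁻¹' U) where
  isOpen := ψ.isOpen_inter_preimage hU
  smooth := (contDiffOn_comp_param hψ hf.1).mono inter_subset_left
  mem _ _ := (hf.2 _).1
  inj x hx := by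
    obtain ⟨θ, hθ⟩ := exists_equiv_push hf.1 hψ hψ' hx.1
    intro X Y h
    rw [hθ, hθ] at h
    exact θ.injective (push_injective hf _ h)
  transversal x hx := by
    obtain ⟨θ, hθ⟩ := exists_equiv_push hf.1 hψ hψ' hx.1
    obtain ⟨X, hX⟩ := exists_push_snd_ne_zero hε hf (hT (ψ x))
    exact ⟨θ.symm X, by rwa [hθ, θ.apply_symm_apply]⟩
  axis x hx Y hY := by
    obtain ⟨θ, hθ⟩ := exists_equiv_push hf.1 hψ hψ' hx.1
    rw [hθ] at hY ⊢
    exact hax _ hx.2 _ hY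
  finrank := by rw [hE]; exact hA

end Axial

/-! ### First properties of axial immersions -/

namespace IsAxial

variable {E : Type*} [NormedAddCommGroup E] [NormedSpace ℝ E] {ε : ℝ} {n : ℕ}
  {A : Submodule ℝ (Flat n)} {F : E → FlatR n} {O : Set E} (h : IsAxial ε n A F O)
  {x : E} (hx : x ∈ O)
include h hx

theorem contDiffAt : ContDiffAt ℝ ∞ F x := h.smooth.contDiffAt (h.isOpen.mem_nhds hx)

theorem differentiableAt : DifferentiableAt ℝ F x := (h.contDiffAt hx).differentiableAt (by simp)

theorem contDiffAt_fderiv : ContDiffAt ℝ ∞ (fderiv ℝ F) x :=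
  (h.smooth.fderiv_of_isOpen h.isOpen (by simp)).contDiffAt (h.isOpen.mem_nhds hx)

theorem eventually_mem : ∀ᶠ y in 𝓝 x, y ∈ O := h.isOpen.mem_nhds hx

theorem form_fderiv_self (X : E) : form ε n (fderiv ℝ F x X).1 (F x).1 = 0 := by
  have := bilin_fderiv_self (B := form ε n) form_comm (g := fun x => (F x).1)
    (c := ε) (h.differentiableAt hx).fst
    (by filter_upwards [h.eventually_mem hx] with y hy using (h.mem y hy).1) X
  rwa [fderiv_fst_apply (h.differentiableAt hx)] at this

/-- The position vector is not orthogonal to the complement of the axis. -/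
theorem exists_form_pos [FiniteDimensional ℝ E] (hε : ε = 1 ∨ ε = -1) (hdim : 2 ≤ Module.finrank ℝ E) :
    ∃ e ∈ (form ε n).orthogonal A, 0 < form ε n (F x).1 e := by
  suffices ∃ e ∈ (form ε n).orthogonal A, form ε n (F x).1 e ≠ 0 by
    obtain ⟨e, he, hne⟩ := this
    rcases hne.lt_or_gt with hlt | hgt
    · exact ⟨-e, Submodule.neg_mem _ he, by simpa using hlt⟩
    · exact ⟨e, he, hgt⟩
  by_contra! hcon
  obtain ⟨Z₀, hZ₀⟩ := h.transversal x hx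
  have hk := ((LinearMap.snd ℝ (Flat n) ℝ) ∘ₗ (fderiv ℝ F x).toLinearMap).finrank_range_add_finrank_ker
  have hr : Module.finrank ℝ (LinearMap.range
      ((LinearMap.snd ℝ (Flat n) ℝ) ∘ₗ (fderiv ℝ F x).toLinearMap)) ≤ 1 :=
    (Submodule.finrank_le _).trans (by simp)
  obtain ⟨⟨Y, hY⟩, hY0⟩ := finrank_pos_iff_exists_ne_zero.1 (show 0 < Module.finrank ℝ (LinearMap.ker
    ((LinearMap.snd ℝ (Flat n) ℝ) ∘ₗ (fderiv ℝ F x).toLinearMap)) by omega)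
  have hY : (fderiv ℝ F x Y).2 = 0 := hY
  have hY0 : Y ≠ 0 := fun h0 => hY0 (Subtype.ext h0)
  have hd := (h.contDiffAt_fderiv hx).differentiableAt (by simp)
  -- The level vector `Y` is extended to a field tangent to the level sets by subtracting the right
  -- multiple of the transversal vector `Z₀`.
  set Yf : E → E := fun y => Y - ((fderiv ℝ F y Z₀).2⁻¹ * (fderiv ℝ F y Y).2) • Z₀ with hYf
  have hYfd : DifferentiableAt ℝ Yf x := by
    have h1 : ∀ Z, DifferentiableAt ℝ (fun y => (fderiv ℝ F y Z).2) x := fun Z =>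
      (hd.clm_apply (differentiableAt_const Z)).snd
    exact (differentiableAt_const _).fun_sub ((((h1 Z₀).fun_inv hZ₀).fun_mul (h1 Y)).smul_const _)
  have hYfx : Yf x = Y := by simp [hYf, hY]
  set G : E → Flat n := fun y => (fderiv ℝ F y (Yf y)).1 with hG
  have hGd : DifferentiableAt ℝ G x := (hd.clm_apply hYfd).fst
  have hlev : ∀ᶠ y in 𝓝 x, y ∈ O ∧ (fderiv ℝ F y (Yf y)).2 = 0 := by
    have hc : ContinuousAt (fun y => (fderiv ℝ F y Z₀).2) x :=
      (hd.clm_apply (differentiableAt_const _)).snd.continuousAt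
    filter_upwards [h.eventually_mem hx, hc.eventually_ne hZ₀] with y hy hne
    refine ⟨hy, ?_⟩
    simp only [hYf, map_sub, map_smul, Prod.snd_sub, Prod.smul_snd, smul_eq_mul]
    field_simp
    ring
  have hGL : fderiv ℝ G x Y ∈ (form ε n).orthogonal A := by
    intro a ha
    have h1 : ∀ᶠ y in 𝓝 x, form ε n (G y) a = 0 := by
      filter_upwards [hlev] with y hy
      rw [form_comm]
      exact h.axis y hy.1 _ hy.2 a ha
    have h2 := fderiv_bilin_const_apply (form ε n) hGd Y a
    rw [fderiv_eq_zero_of_eventually_const h1] at h2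
    show form ε n a _ = 0
    rw [form_comm, ← h2]
    rfl
  have h3 : ∀ᶠ y in 𝓝 x, form ε n (G y) (F y).1 = 0 := by
    filter_upwards [hlev] with y hy using h.form_fderiv_self hy.1 _
  -- Differentiate `⟨G, F⟩ = 0` along `Y`. The derivative of `G` is still in `A^⊥`, so under the
  -- contrary assumption only the square of the nonzero leaf vector `dF(Y)` remains.
  have h4 := fderiv_bilin_apply (form ε n) hGd (h.differentiableAt hx).fst Y
  rw [fderiv_eq_zero_of_eventually_const h3, fderiv_fst_apply (h.differentiableAt hx),
    form_comm (fderiv ℝ G x Y), hcon _ hGL] at h4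
  simp only [zero_apply, zero_add, hG, hYfx] at h4
  refine (form_self_pos hε (h.mem x hx).1 (h.form_fderiv_self hx Y) fun h0 => hY0 ?_).ne h4
  exact (injective_iff_map_eq_zero _).1 (h.inj x hx) Y (Prod.ext h0 hY)

end IsAxial

/-! ### Rotational submanifolds are axial -/

section Rotational

variable {ε : ℝ} {m n : ℕ}

theorem mem_iff_fst_mem_comap {A : Submodule ℝ (FlatR n)} (hA : dt n ∈ A) (x : FlatR n) :
    x ∈ A ↔ x.1 ∈ A.comap (LinearMap.inl ℝ (Flat n) ℝ) := by
  have hx : x = (x.1, 0) + x.2 • dt n := by simp [dt]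
  rw [Submodule.mem_comap, LinearMap.inl_apply]
  constructor
  · intro h
    have : (x.1, (0 : ℝ)) = x - x.2 • dt n := by
      rw [eq_sub_iff_add_eq]
      exact hx.symm
    rw [this]
    exact A.sub_mem h (A.smul_mem _ hA)
  · intro h
    rw [hx]
    exact A.add_mem h (A.smul_mem _ hA)

theorem finrank_prod_top (A : Submodule ℝ (Flat n)) :
    finrank ℝ (A.prod (⊤ : Submodule ℝ ℝ)) = finrank ℝ A + 1 := by
  have e : (A.prod (⊤ : Submodule ℝ ℝ)) ≃ₗ[ℝ] (A × ℝ) :=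
    { toFun := fun x => (⟨x.1.1, x.2.1⟩, x.1.2)
      invFun := fun y => ⟨(y.1.1, y.2), y.1.2, trivial⟩
      map_add' := fun _ _ => rfl
      map_smul' := fun _ _ => rfl
      left_inv := fun _ => rfl
      right_inv := fun _ => rfl }
  rw [e.finrank_eq, Module.finrank_prod]
  simp

theorem finrank_comap_inl {A : Submodule ℝ (FlatR n)} (hA : dt n ∈ A) :
    finrank ℝ A = finrank ℝ (A.comap (LinearMap.inl ℝ (Flat n) ℝ)) + 1 := by
  have : A = (A.comap (LinearMap.inl ℝ (Flat n) ℝ)).prod ⊤ := by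
    ext x
    rw [mem_iff_fst_mem_comap hA, Submodule.mem_prod]
    simp
  conv_lhs => rw [this]
  exact finrank_prod_top _

/-- A map of rank two cannot take values in a curve. -/
theorem not_surjective_of_mapsTo_curve {E : Type*} [NormedAddCommGroup E] [NormedSpace ℝ E]
    [CompleteSpace E] {Φ : E → ℝ × ℝ} {x : E} {O : Set E} (hO : O ∈ 𝓝 x)
    (hΦ : ContDiffAt ℝ 1 Φ x) {I : Set ℝ} (hI : I.OrdConnected) {β : ℝ → ℝ × ℝ}
    (hβ : ContDiffOn ℝ 1 β I) (hmaps : MapsTo Φ O (β '' I)) :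
    ¬ Function.Surjective (fderiv ℝ Φ x) := by
  intro hs
  -- A submersion is open, so the curve would contain a neighbourhood in the plane, of Hausdorff
  -- dimension two, whereas a `C¹` image of an interval has dimension at most one.
  have h1 := (hΦ.hasStrictFDerivAt (by simp)).map_nhds_eq_of_surj (LinearMap.range_eq_top.2 hs)
  have h2 : Φ '' O ∈ 𝓝 (Φ x) := by
    rw [← h1]
    exact image_mem_map hO
  have h3 : β '' I ∈ 𝓝 (Φ x) := mem_of_superset h2 hmaps.image_subset
  have h4 := Real.dimH_of_mem_nhds h3
  have h5 := hβ.dimH_image_le hI.convex Subset.rfl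
  have h6 : dimH I ≤ 1 := by
    rw [← Real.dimH_univ]
    exact dimH_mono (subset_univ _)
  rw [h4] at h5
  have h7 := h5.trans h6
  simp only [Module.finrank_prod, Module.finrank_self] at h7
  norm_num at h7

variable {M : Type*} [TopologicalSpace M] [ChartedSpace (EuclideanSpace ℝ (Fin m)) M]
  [IsManifold (𝓡 m) ∞ M] {f : M → FlatR n}

/-- Products with vectors of the axis are invariant under the group. The height is one of them,
since `∂/∂t` is in the axis. So height and `⟨·, a⟩` together take values in the curve traced by the
profile, and cannot be independent at any point. -/
theorem IsRotationalWith.isLocallyAxial (hε : ε = 1 ∨ ε = -1) (hf : QxR.IsImmersion m ε f)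
    (hT : ∀ p, pushT m ε f p ≠ 0) {C : Submodule ℝ (FlatR n) → Prop}
    {C' : Submodule ℝ (Flat n) → Prop}
    (hC : ∀ A, C A → C' (A.comap (LinearMap.inl ℝ (Flat n) ℝ)))
    (h : IsRotationalWith m ε f C) : IsLocallyAxial m ε f C' := by
  intro p
  obtain ⟨U, A, P, I, α, hU, hpU, ⟨hdt, -, hdim, -, -, hI, hα, -, -⟩, hCA, horb⟩ := h p
  refine ⟨U, A.comap (LinearMap.inl ℝ (Flat n) ℝ), hU, hpU, ?_, hC A hCA, ?_⟩
  · have := finrank_comap_inl hdt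
    omega
  intro q hq Y hY a ha
  show form ε n a _ = 0
  by_contra hne
  have ha : ((a, 0) : FlatR n) ∈ A := ha
  set ψ := (chartAt (EuclideanSpace ℝ (Fin m)) q).symm with hψ
  set F : EuclideanSpace ℝ (Fin m) → FlatR n := f ∘ ψ with hF
  have hx : pt m q ∈ ψ.source := by rw [pt_eq]; exact mem_chart_target _ q
  have hψx : ψ (pt m q) = q := by
    rw [pt_eq, hψ, OpenPartialHomeomorph.left_inv _ (mem_chart_source _ q)]
  have hFs : ContDiffAt ℝ ∞ F (pt m q) :=
    (contDiffOn_comp_param (contMDiffOn_chart_symm q) hf.1).contDiffAt (ψ.open_source.mem_nhds hx)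
  have hFd := hFs.differentiableAt (by simp)
  have hpush : ∀ X, fderiv ℝ F (pt m q) X = push m f q X := fun X => by
    rw [push, inChart_eq]
  set Φ : EuclideanSpace ℝ (Fin m) → ℝ × ℝ := fun z => ((F z).2, form ε n a (F z).1) with hΦ
  have hΦ2 : ContDiffAt ℝ ∞ (fun z => form ε n a (F z).1) (pt m q) :=
    contDiffAt_bilin _ contDiffAt_const hFs.fst
  have hΦs : ContDiffAt ℝ ∞ Φ (pt m q) := hFs.snd.prodMk hΦ2
  have hΦ' : ∀ X, fderiv ℝ Φ (pt m q) X = ((push m f q X).2, form ε n a (push m f q X).1) := by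
    intro X
    rw [← hpush, hΦ, DifferentiableAt.fderiv_prodMk hFd.snd (hΦ2.differentiableAt (by simp))]
    refine Prod.ext (fderiv_snd_apply hFd X) ?_
    show fderiv ℝ (fun z => form ε n a (F z).1) (pt m q) X = _
    rw [fderiv_bilin_apply _ (differentiableAt_const a) hFd.fst, fderiv_fst_apply hFd]
    simp
  obtain ⟨X, hX⟩ := exists_push_snd_ne_zero hε hf (hT q)
  -- `X` changes the height, and the level vector `Y` changes only the product with `a`; the matrix
  -- is triangular.
  have hsurj : Function.Surjective (fderiv ℝ Φ (pt m q)) := by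
    rintro ⟨s, t⟩
    refine ⟨(s / (push m f q X).2) • X + ((t - s / (push m f q X).2 * form ε n a (push m f q X).1)
      / form ε n a (push m f q Y).1) • Y, ?_⟩
    rw [map_add, map_smul, map_smul, hΦ', hΦ', hY]
    ext
    · simp [hX]
    · simp [hne]
  have hO : ψ.source ∩ ψ ⁻¹' U ∈ 𝓝 (pt m q) :=
    (ψ.isOpen_inter_preimage hU).mem_nhds ⟨hx, by rwa [mem_preimage, hψx]⟩
  have hβ : ContDiffOn ℝ 1 (fun s => ((α s).2, form ε n a (α s).1)) I := by
    have h1 : ContDiffOn ℝ 1 α I := hα.of_le (by simp)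
    refine h1.snd.prodMk ?_
    exact ((LinearMap.toContinuousBilinearMap (form ε n)) a).contDiff.comp_contDiffOn h1.fst
  refine not_surjective_of_mapsTo_curve hO (hΦs.of_le (by simp)) hI hβ ?_ hsurj
  intro z hz
  obtain ⟨L, ⟨hLiso, hLfix⟩, s, hs, hy⟩ := horb ⟨ψ z, hz.2, rfl⟩
  have key : ∀ b ∈ A, formR ε n b (F z) = formR ε n b (α s) := by
    intro b hb
    have h1 : F z = L (α s) := hy
    rw [h1, ← hLiso b (α s), hLfix b hb]
  refine ⟨s, hs, ?_⟩
  have h1 := key _ hdt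
  have h2 := key _ ha
  simp only [formR_apply, dt, map_zero, LinearMap.zero_apply, one_mul, zero_add, zero_mul,
    add_zero] at h1 h2
  exact Prod.ext h1.symm h2.symm

end Rotational

/-! ### Adapted parametrizations -/

section Adapted

variable {ε : ℝ} {n r : ℕ}

/-- The parametrization `G : V × I → ℚ_ε^n × ℝ` has the second parameter as its height, and, for
fixed `x`, the functionals `⟨G(x, s), ·⟩` on `A^⊥` are proportional. -/
structure IsAdapted (ε : ℝ) (A : Submodule ℝ (Flat n)) (V : Set (EuclideanSpace ℝ (Fin r)))
    (I : Set ℝ) (e : Flat n) (G : EuclideanSpace ℝ (Fin r) × ℝ → FlatR n) : Prop where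
  isOpen_left : IsOpen V
  convex_left : Convex ℝ V
  isOpen_right : IsOpen I
  ordConnected_right : I.OrdConnected
  mem_orthogonal : e ∈ (form ε n).orthogonal A
  axial : IsAxial ε n A G (V ×ˢ I)
  height : ∀ x ∈ V, ∀ s ∈ I, (G (x, s)).2 = s
  pos : ∀ x ∈ V, ∀ s ∈ I, 0 < form ε n (G (x, s)).1 e
  proportional : ∀ x ∈ V, ∀ s ∈ I, ∀ s' ∈ I, ∀ v ∈ (form ε n).orthogonal A,
    form ε n (G (x, s)).1 v * form ε n (G (x, s')).1 e
      = form ε n (G (x, s')).1 v * form ε n (G (x, s)).1 e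

variable {E : Type*} [NormedAddCommGroup E] [NormedSpace ℝ E] [FiniteDimensional ℝ E]

/-- A smooth map with invertible derivative at a point is a diffeomorphism from a neighbourhood of
the point to a product. -/
theorem exists_product_inverse {Φ : E → EuclideanSpace ℝ (Fin r) × ℝ} {O : Set E} (hO : IsOpen O)
    (hΦ : ContDiffOn ℝ ∞ Φ O) {x₀ : E} (hx₀ : x₀ ∈ O) (hE : finrank ℝ E = r + 1)
    (hinj : Function.Injective (fderiv ℝ Φ x₀)) :
    ∃ (ψ : OpenPartialHomeomorph (EuclideanSpace ℝ (Fin r) × ℝ) E)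
      (V : Set (EuclideanSpace ℝ (Fin r))) (I : Set ℝ),
      IsOpen V ∧ Convex ℝ V ∧ IsOpen I ∧ I.OrdConnected ∧ ψ.source = V ×ˢ I ∧
      Φ x₀ ∈ V ×ˢ I ∧ ψ (Φ x₀) = x₀ ∧ ψ.target ⊆ O ∧
      ContDiffOn ℝ ∞ ψ ψ.source ∧ ContDiffOn ℝ ∞ ψ.symm ψ.target ∧
      ∀ z ∈ ψ.source, Φ (ψ z) = z := by
  have hΦat : ∀ x ∈ O, ContDiffAt ℝ ∞ Φ x := fun x hx => hΦ.contDiffAt (hO.mem_nhds hx)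
  have hbij : Function.Bijective (fderiv ℝ Φ x₀).toLinearMap :=
    ⟨hinj, (LinearMap.injective_iff_surjective_of_finrank_eq_finrank
      (by simp [hE])).1 hinj⟩
  set L : E ≃L[ℝ] EuclideanSpace ℝ (Fin r) × ℝ :=
    (LinearEquiv.ofBijective _ hbij).toContinuousLinearEquiv with hL
  have hLcoe : (L : E →L[ℝ] EuclideanSpace ℝ (Fin r) × ℝ) = fderiv ℝ Φ x₀ := by
    ext1 x; rfl
  have hΦ₀ := hΦat x₀ hx₀
  have hfd : HasFDerivAt Φ (L : E →L[ℝ] EuclideanSpace ℝ (Fin r) × ℝ) x₀ := by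
    rw [hLcoe]; exact (hΦ₀.differentiableAt (by simp)).hasFDerivAt
  have hcont : ContinuousAt (fderiv ℝ Φ) x₀ :=
    ((hΦ.fderiv_of_isOpen hO (m := ∞) (by simp)).continuousOn).continuousAt (hO.mem_nhds hx₀)
  -- Invertibility of the derivative is needed near `x₀`, not only at `x₀`, for the inverse to be
  -- smooth on its whole domain.
  have hinv : ∀ᶠ x in 𝓝 x₀, x ∈ O ∧ ∃ L' : E ≃L[ℝ] EuclideanSpace ℝ (Fin r) × ℝ,
      (L' : E →L[ℝ] EuclideanSpace ℝ (Fin r) × ℝ) = fderiv ℝ Φ x := by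
    have hn := ContinuousLinearEquiv.nhds L
    rw [hLcoe] at hn
    filter_upwards [hO.mem_nhds hx₀, hcont hn] with x hx hx'
    exact ⟨hx, hx'⟩
  obtain ⟨O₁, hO₁, hO₁o, hx₁⟩ := eventually_nhds_iff.1 hinv
  set e₀ := hΦ₀.toOpenPartialHomeomorph Φ hfd (by simp) with he₀
  have he₀c : ∀ x, e₀ x = Φ x := fun x => rfl
  have hxe₀ : x₀ ∈ e₀.source := hΦ₀.mem_toOpenPartialHomeomorph_source hfd (by simp)
  set e₁ := e₀.restrOpen O₁ hO₁o with he₁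
  have hxe₁ : x₀ ∈ e₁.source := by
    rw [he₁, OpenPartialHomeomorph.restrOpen_source]; exact ⟨hxe₀, hx₁⟩
  have he₁c : ∀ x, e₁ x = Φ x := fun x => rfl
  have he₁s : e₁.source ⊆ O₁ := by
    rw [he₁, OpenPartialHomeomorph.restrOpen_source]; exact inter_subset_right
  have ht : e₁.target ∈ 𝓝 (Φ x₀) := e₁.open_target.mem_nhds (e₁.map_source hxe₁)
  -- A ball of the product metric is a product of balls, which gives the convex factors.
  obtain ⟨δ, hδ, hball⟩ := Metric.mem_nhds_iff.1 ht
  set V := Metric.ball (Φ x₀).1 δ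
  set I := Metric.ball (Φ x₀).2 δ with hI
  have hVI : V ×ˢ I = Metric.ball (Φ x₀) δ := ball_prod_same _ _ _
  have hVIo : IsOpen (V ×ˢ I) := by rw [hVI]; exact Metric.isOpen_ball
  set ψ := e₁.symm.restrOpen (V ×ˢ I) hVIo with hψ
  have hψs : ψ.source = V ×ˢ I := by
    rw [hψ, OpenPartialHomeomorph.restrOpen_source]
    apply inter_eq_right.2
    rw [hVI]
    exact hball
  have hψe : ∀ z ∈ ψ.source, ψ z = e₁.symm z ∧ z ∈ e₁.target := fun z hz => by
    refine ⟨rfl, ?_⟩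
    rw [hψs, hVI] at hz
    exact hball hz
  have hψt : ψ.target ⊆ e₁.source := by
    intro y hy
    have h1 := ψ.map_target hy
    have h2 := (hψe _ h1)
    rw [← ψ.right_inv hy, h2.1]
    exact e₁.map_target h2.2
  refine ⟨ψ, V, I, Metric.isOpen_ball, convex_ball _ _, Metric.isOpen_ball,
    (convex_ball _ _).ordConnected, hψs, ?_, ?_, fun y hy => (hO₁ y (he₁s (hψt hy))).1, ?_, ?_, ?_⟩
  · rw [hVI]; exact Metric.mem_ball_self hδ
  · show e₁.symm (Φ x₀) = x₀
    rw [← he₁c, e₁.left_inv hxe₁]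
  · intro z hz
    obtain ⟨hz1, hz2⟩ := hψe z hz
    obtain ⟨hxO, L', hL'⟩ := hO₁ _ (he₁s (e₁.map_target hz2))
    have : ContDiffAt ℝ ∞ e₁.symm z := by
      refine e₁.contDiffAt_symm (f₀' := L') hz2 ?_ (hΦat _ hxO)
      rw [hL']
      exact ((hΦat _ hxO).differentiableAt (by simp)).hasFDerivAt
    exact this.contDiffWithinAt
  · intro y hy
    exact (hΦat y (hO₁ y (he₁s (hψt hy))).1).contDiffWithinAt
  · intro z hz
    obtain ⟨hz1, hz2⟩ := hψe z hz
    rw [hz1, ← he₁c, e₁.right_inv hz2]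

/-- The coordinates are the height and the ratios `⟨F, τᵢ⟩ / ⟨F, e⟩`, where the `τᵢ` span the
tangent space of the leaf through `x₀` and, with `e`, span `A^⊥`. Fixing the ratios fixes the
functional `⟨F, ·⟩` on `A^⊥` up to a factor. -/
theorem IsAxial.exists_param (hε : ε = 1 ∨ ε = -1) {A : Submodule ℝ (Flat n)} {F : E → FlatR n}
    {O : Set E} (h : IsAxial ε n A F O) {x₀ : E} (hx₀ : x₀ ∈ O) (hE : Module.finrank ℝ E = r + 1)
    (hr : 1 ≤ r) :
    ∃ (ψ : OpenPartialHomeomorph (EuclideanSpace ℝ (Fin r) × ℝ) E)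
      (V : Set (EuclideanSpace ℝ (Fin r))) (I : Set ℝ) (z₀ : EuclideanSpace ℝ (Fin r) × ℝ)
      (e : Flat n),
      IsOpen V ∧ Convex ℝ V ∧ IsOpen I ∧ I.OrdConnected ∧ ψ.source = V ×ˢ I ∧
      z₀ ∈ V ×ˢ I ∧ ψ z₀ = x₀ ∧ ψ.target ⊆ O ∧
      ContDiffOn ℝ ∞ ψ ψ.source ∧ ContDiffOn ℝ ∞ ψ.symm ψ.target ∧
      e ∈ (form ε n).orthogonal A ∧
      (∀ x ∈ V, ∀ s ∈ I, (F (ψ (x, s))).2 = s) ∧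
      (∀ x ∈ V, ∀ s ∈ I, 0 < form ε n (F (ψ (x, s))).1 e) ∧
      ∀ x ∈ V, ∀ s ∈ I, ∀ s' ∈ I, ∀ v ∈ (form ε n).orthogonal A,
        form ε n (F (ψ (x, s))).1 v * form ε n (F (ψ (x, s'))).1 e
          = form ε n (F (ψ (x, s'))).1 v * form ε n (F (ψ (x, s))).1 e := by
  obtain ⟨e, he, hepos⟩ := h.exists_form_pos hx₀ hε (by omega)
  obtain ⟨Z₀, hZ₀⟩ := h.transversal x₀ hx₀
  set D := LinearMap.ker ((LinearMap.snd ℝ (Flat n) ℝ) ∘ₗ (fderiv ℝ F x₀).toLinearMap) with hD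
  have hDr : Module.finrank ℝ D = r := by
    have hk := ((LinearMap.snd ℝ (Flat n) ℝ) ∘ₗ
      (fderiv ℝ F x₀).toLinearMap).finrank_range_add_finrank_ker
    have hs : Function.Surjective ((LinearMap.snd ℝ (Flat n) ℝ) ∘ₗ (fderiv ℝ F x₀).toLinearMap) := by
      apply LinearMap.surjective
      intro h0
      exact hZ₀ (LinearMap.congr_fun h0 Z₀)
    rw [LinearMap.range_eq_top.2 hs, finrank_top, Module.finrank_self, ← hD] at hk
    omega
  have hDmem : ∀ Z, Z ∈ D ↔ (fderiv ℝ F x₀ Z).2 = 0 := fun Z => Iff.rfl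
  let b : Basis (Fin r) ℝ D := Module.finBasisOfFinrankEq ℝ D hDr
  set τ : D →ₗ[ℝ] Flat n :=
    (LinearMap.fst ℝ (Flat n) ℝ) ∘ₗ (fderiv ℝ F x₀).toLinearMap ∘ₗ D.subtype with hτ
  have hτa : ∀ Z : D, τ Z = (fderiv ℝ F x₀ Z).1 := fun Z => rfl
  have hτinj : Function.Injective τ := by
    rw [injective_iff_map_eq_zero]
    intro Z hZ
    apply Subtype.ext
    exact (injective_iff_map_eq_zero _).1 (h.inj x₀ hx₀) Z (Prod.ext hZ Z.2)
  have hτself : ∀ Z, form ε n (τ Z) (F x₀).1 = 0 := fun Z => h.form_fderiv_self hx₀ Z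
  have hτL : ∀ Z, τ Z ∈ (form ε n).orthogonal A := fun Z => h.axis x₀ hx₀ Z Z.2
  have hbext : ∀ u, (∀ i, form ε n u (τ (b i)) = 0) → ∀ Z, form ε n u (τ Z) = 0 := by
    intro u hu Z
    have : (form ε n u) ∘ₗ τ = 0 := b.ext fun i => by simpa using hu i
    exact LinearMap.congr_fun this Z
  set q : E → ℝ := fun z => form ε n (F z).1 e with hq
  set O₁ := O ∩ {z | 0 < q z} with hO₁
  have hqs : ContDiffOn ℝ ∞ q O := fun z hz =>
    (contDiffAt_bilin _ (h.contDiffAt hz).fst contDiffAt_const).contDiffWithinAt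
  have hO₁o : IsOpen O₁ := hqs.continuousOn.isOpen_inter_preimage h.isOpen isOpen_Ioi
  have hx₁ : x₀ ∈ O₁ := ⟨hx₀, hepos⟩
  set Φ : E → EuclideanSpace ℝ (Fin r) × ℝ := fun z =>
    (WithLp.toLp 2 fun i => form ε n (F z).1 (τ (b i)) / q z, (F z).2) with hΦ
  have hΦi : ∀ i z, z ∈ O₁ → ContDiffAt ℝ ∞ (fun z => form ε n (F z).1 (τ (b i)) / q z) z := by
    intro i z hz
    exact (contDiffAt_bilin _ (h.contDiffAt hz.1).fst contDiffAt_const).div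
      (hqs.contDiffAt (h.isOpen.mem_nhds hz.1)) hz.2.ne'
  have hΦ1 : ∀ z ∈ O₁, ContDiffAt ℝ ∞ (fun z => (WithLp.toLp 2 fun i =>
      form ε n (F z).1 (τ (b i)) / q z : EuclideanSpace ℝ (Fin r))) z := by
    intro z hz
    rw [contDiffAt_piLp]
    exact fun i => hΦi i z hz
  have hΦs : ContDiffOn ℝ ∞ Φ O₁ := fun z hz =>
    ((hΦ1 z hz).prodMk (h.contDiffAt hz.1).snd).contDiffWithinAt
  have hinj : Function.Injective (fderiv ℝ Φ x₀) := by
    rw [injective_iff_map_eq_zero]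
    intro Z hZ
    have hFd := h.differentiableAt hx₀
    rw [hΦ, DifferentiableAt.fderiv_prodMk ((hΦ1 x₀ hx₁).differentiableAt (by simp)) hFd.snd] at hZ
    have hZ2 : (fderiv ℝ F x₀ Z).2 = 0 := by
      rw [← fderiv_snd_apply hFd]
      exact congrArg Prod.snd hZ
    have hZ1 := congrArg Prod.fst hZ
    have hZi : ∀ i, fderiv ℝ (fun z => form ε n (F z).1 (τ (b i)) / q z) x₀ Z = 0 := by
      intro i
      have h1 := fderiv_comp_clm_apply (EuclideanSpace.proj i : EuclideanSpace ℝ (Fin r) →L[ℝ] ℝ)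
        ((hΦ1 x₀ hx₁).differentiableAt (by simp)) Z
      rw [show fderiv ℝ (fun z => (WithLp.toLp 2 fun i =>
        form ε n (F z).1 (τ (b i)) / q z : EuclideanSpace ℝ (Fin r))) x₀ Z = 0 from hZ1] at h1
      simpa using h1
    -- The ratios vanish at `x₀`, because the leaf is orthogonal to the position there. So the
    -- derivative of `q` drops out of the product rule.
    have hform : ∀ i, form ε n (fderiv ℝ F x₀ Z).1 (τ (b i)) = 0 := by
      intro i
      have h1 : (fun z => form ε n (F z).1 (τ (b i))) =ᶠ[𝓝 x₀]
          fun z => (form ε n (F z).1 (τ (b i)) / q z) * q z := by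
        filter_upwards [hO₁o.mem_nhds hx₁] with z hz
        rw [div_mul_cancel₀ _ (show 0 < q z from hz.2).ne']
      have h2 := fderiv_bilin_const_apply (form ε n) hFd.fst Z (τ (b i))
      rw [h1.fderiv_eq, fderiv_fun_mul ((hΦi i x₀ hx₁).differentiableAt (by simp))
        ((hqs.contDiffAt (h.isOpen.mem_nhds hx₀)).differentiableAt (by simp)),
        fderiv_fst_apply hFd] at h2
      simp only [add_apply, smul_apply, hZi, smul_eq_mul, mul_zero, add_zero] at h2
      rw [form_comm (F x₀).1, hτself] at h2
      simpa using h2.symm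
    have hself := hbext _ hform ⟨Z, hZ2⟩
    have h0 : (fderiv ℝ F x₀ Z).1 = 0 := by
      by_contra hne
      exact (form_self_pos hε (h.mem x₀ hx₀).1 (h.form_fderiv_self hx₀ Z) hne).ne' hself
    exact (injective_iff_map_eq_zero _).1 (h.inj x₀ hx₀) Z (Prod.ext h0 hZ2)
  obtain ⟨ψ, V, I, hV, hVc, hI, hIc, hsrc, hmem, hψx, htgt, hψs, hψs', hΦψ⟩ :=
    exists_product_inverse hO₁o hΦs hx₁ hE hinj
  have hin : ∀ x ∈ V, ∀ s ∈ I, ψ (x, s) ∈ O₁ ∧ Φ (ψ (x, s)) = (x, s) := by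
    intro x hx s hs
    have : (x, s) ∈ ψ.source := by rw [hsrc]; exact ⟨hx, hs⟩
    exact ⟨htgt (ψ.map_source this), hΦψ _ this⟩
  refine ⟨ψ, V, I, Φ x₀, e, hV, hVc, hI, hIc, hsrc, hmem, hψx, htgt.trans inter_subset_left,
    hψs, hψs', he, fun x hx s hs => congrArg Prod.snd (hin x hx s hs).2,
    fun x hx s hs => (hin x hx s hs).1.2, ?_⟩
  intro x hx s hs s' hs' v hv
  have hxi : ∀ s ∈ I, ∀ i, form ε n (F (ψ (x, s))).1 (τ (b i)) = x i * q (ψ (x, s)) := by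
    intro s hs i
    obtain ⟨h1, h2⟩ := hin x hx s hs
    have h3 : form ε n (F (ψ (x, s))).1 (τ (b i)) / q (ψ (x, s)) = x i := by
      have := congrArg (fun z : EuclideanSpace ℝ (Fin r) × ℝ => z.1 i) h2
      exact this
    rw [← h3, div_mul_cancel₀ _ h1.2.ne']
  set w₁ := (F (ψ (x, s))).1
  set w₂ := (F (ψ (x, s'))).1
  have hu : ∀ Z, form ε n (form ε n w₂ e • w₁ - form ε n w₁ e • w₂) (τ Z) = 0 := by
    apply hbext
    intro i
    simp only [map_sub, map_smul, LinearMap.sub_apply, LinearMap.smul_apply, smul_eq_mul, w₁, w₂,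
      hxi s hs i, hxi s' hs' i]
    ring
  have hfr : Module.finrank ℝ ((form ε n).orthogonal A) ≤ Module.finrank ℝ (LinearMap.range τ) + 1 := by
    have h1 := (posOff_form hε (h.mem x₀ hx₀)).finrank_orthogonal A
    have h2 := h.finrank
    rw [LinearMap.finrank_range_of_inj hτinj, hDr]
    simp only [Module.finrank_fin_fun] at h1
    omega
  have hmem2 := exists_sub_smul_mem_orthogonal (B := form ε n) (T := LinearMap.range τ)
    (L := (form ε n).orthogonal A) (y := (F x₀).1) (e := e)
    (v := form ε n w₂ e • w₁ - form ε n w₁ e • w₂)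
    (by rintro _ ⟨Z, rfl⟩; exact hτL Z) (by rintro _ ⟨Z, rfl⟩; exact hτself Z) hfr he
    (by rw [form_comm]; exact hepos.ne') (by rintro _ ⟨Z, rfl⟩; rw [form_comm]; exact hu Z)
  -- The combination is orthogonal to all `τ Z` by equality of the ratios, and to `e` by its form;
  -- hence to all of `A^⊥`.
  have hzero : form ε n e (form ε n w₂ e • w₁ - form ε n w₁ e • w₂) = 0 := by
    rw [map_sub, map_smul, map_smul, form_comm e w₁, form_comm e w₂, smul_eq_mul, smul_eq_mul]
    ring
  rw [hzero, zero_div, zero_smul, sub_zero] at hmem2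
  have h3 : form ε n v (form ε n w₂ e • w₁ - form ε n w₁ e • w₂) = 0 := hmem2 v hv
  rw [map_sub, map_smul, map_smul, form_comm v w₁, form_comm v w₂, smul_eq_mul, smul_eq_mul] at h3
  linarith

variable {m : ℕ} {M : Type*} [TopologicalSpace M] [ChartedSpace (EuclideanSpace ℝ (Fin m)) M]
  [IsManifold (𝓡 m) ∞ M] {f : M → FlatR n}

theorem exists_adapted_param (hε : ε = 1 ∨ ε = -1) (hm : 2 ≤ m) (hf : QxR.IsImmersion m ε f)
    (hT : ∀ p, pushT m ε f p ≠ 0) {A : Submodule ℝ (Flat n)} (hA : finrank ℝ A + m = n + 1)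
    {U : Set M} (hU : IsOpen U) {p : M} (hp : p ∈ U)
    (hax : ∀ q ∈ U, ∀ Y, (push m f q Y).2 = 0 → (push m f q Y).1 ∈ (form ε n).orthogonal A) :
    ∃ (ψ : OpenPartialHomeomorph (EuclideanSpace ℝ (Fin (m - 1)) × ℝ) M)
      (V : Set (EuclideanSpace ℝ (Fin (m - 1)))) (I : Set ℝ)
      (x₀ : EuclideanSpace ℝ (Fin (m - 1))) (s₀ : ℝ) (e : Flat n),
      ψ.source = V ×ˢ I ∧ x₀ ∈ V ∧ s₀ ∈ I ∧ ψ (x₀, s₀) = p ∧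
      ContMDiffOn 𝓘(ℝ, EuclideanSpace ℝ (Fin (m - 1)) × ℝ) (𝓡 m) ∞ ψ ψ.source ∧
      ContMDiffOn (𝓡 m) 𝓘(ℝ, EuclideanSpace ℝ (Fin (m - 1)) × ℝ) ∞ ψ.symm ψ.target ∧
      IsAdapted ε A V I e (f ∘ ψ) := by
  set χ := (chartAt (EuclideanSpace ℝ (Fin m)) p).symm with hχ
  have hax' := isAxial_param hε hf hT hA hU hax (contMDiffOn_chart_symm p) (contMDiffOn_chart p)
    (by simp)
  have hpt : pt m p ∈ χ.source ∩ χ ⁻¹' U := by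
    refine ⟨by rw [pt_eq]; exact mem_chart_target _ p, ?_⟩
    rw [mem_preimage, pt_eq, hχ, OpenPartialHomeomorph.left_inv _ (mem_chart_source _ p)]
    exact hp
  obtain ⟨ψ₀, V, I, ⟨x₀, s₀⟩, e, hV, hVc, hI, hIc, hsrc, hmem, hψx, htgt, hψs, hψs', he, h1, h2, h3⟩ :=
    hax'.exists_param hε hpt (r := m - 1) (by simp; omega) (by omega)
  set ψ := ψ₀.trans χ with hψ
  have hψsrc : ψ.source = V ×ˢ I := by
    rw [hψ, OpenPartialHomeomorph.trans_source, hsrc]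
    apply inter_eq_left.2
    intro z hz
    exact (htgt (ψ₀.map_source (by rwa [hsrc]))).1
  have hs1 : ContMDiffOn 𝓘(ℝ, EuclideanSpace ℝ (Fin (m - 1)) × ℝ) (𝓡 m) ∞ ψ ψ.source := by
    refine (contMDiffOn_chart_symm p).comp (t := χ.source)
      ((contMDiffOn_iff_contDiffOn.2 hψs).mono ?_) ?_
    · rw [hψsrc, hsrc]
    · intro z hz
      rw [hψsrc, ← hsrc] at hz
      exact (htgt (ψ₀.map_source hz)).1
  have hs2 : ContMDiffOn (𝓡 m) 𝓘(ℝ, EuclideanSpace ℝ (Fin (m - 1)) × ℝ) ∞ ψ.symm ψ.target := by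
    refine (contMDiffOn_iff_contDiffOn.2 hψs').comp (t := ψ₀.target)
      ((contMDiffOn_chart p).mono ?_) ?_
    · rw [hψ, OpenPartialHomeomorph.trans_target]
      exact inter_subset_left
    · rw [hψ, OpenPartialHomeomorph.trans_target]
      exact fun z hz => hz.2
  have hmaps : V ×ˢ I ⊆ ψ ⁻¹' U := by
    intro z hz
    exact (htgt (ψ₀.map_source (by rwa [hsrc]))).2
  have hax2 := isAxial_param hε hf hT hA hU hax hs1 hs2 (by simp; omega)
  refine ⟨ψ, V, I, x₀, s₀, e, hψsrc, hmem.1, hmem.2, ?_, hs1, hs2,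
    ⟨hV, hVc, hI, hIc, he, ?_, h1, h2, h3⟩⟩
  · show χ (ψ₀ (x₀, s₀)) = p
    rw [hψx, pt_eq, hχ, OpenPartialHomeomorph.left_inv _ (mem_chart_source _ p)]
  · rwa [hψsrc, inter_eq_left.2 hmaps] at hax2

end Adapted

/-! ### Restriction of maps on a product to its slices -/

section Slices

variable {E : Type*} [NormedAddCommGroup E] [NormedSpace ℝ E] {W : Type*} [NormedAddCommGroup W]
  [NormedSpace ℝ W]

theorem hasFDerivAt_slice {G : E × ℝ → W} {x : E} {s : ℝ} (hG : DifferentiableAt ℝ G (x, s)) :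
    HasFDerivAt (fun y => G (y, s)) (fderiv ℝ G (x, s) ∘L ContinuousLinearMap.inl ℝ E ℝ) x :=
  hG.hasFDerivAt.comp x ((hasFDerivAt_id x).prodMk (hasFDerivAt_const s x))

theorem fderiv_slice_apply {G : E × ℝ → W} {x : E} {s : ℝ} (hG : DifferentiableAt ℝ G (x, s))
    (X : E) : fderiv ℝ (fun y => G (y, s)) x X = fderiv ℝ G (x, s) (X, 0) := by
  rw [(hasFDerivAt_slice hG).fderiv]
  rfl

theorem hasDerivAt_slice {G : E × ℝ → W} {x : E} {s : ℝ} (hG : DifferentiableAt ℝ G (x, s)) :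
    HasDerivAt (fun t => G (x, t)) (fderiv ℝ G (x, s) (0, 1)) s := by
  have h := hG.hasFDerivAt.comp s ((hasFDerivAt_const x s).prodMk (hasFDerivAt_id s))
  exact h.hasDerivAt

theorem eq_of_fderiv_eq_zero_on_convex {u : E → W} {V : Set E} (hV : IsOpen V) (hVc : Convex ℝ V)
    (hu : ∀ x ∈ V, DifferentiableAt ℝ u x) (h0 : ∀ x ∈ V, ∀ X, fderiv ℝ u x X = 0) {x y : E}
    (hx : x ∈ V) (hy : y ∈ V) : u x = u y :=
  hV.is_const_of_fderiv_eq_zero hVc.isPreconnected (fun z hz => (hu z hz).differentiableWithinAt)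
    (fun z hz => by ext X; exact h0 z hz X) hx hy

end Slices

/-! ### Geometry of adapted parametrizations -/

namespace IsAdapted

variable {ε : ℝ} {n r : ℕ} {A : Submodule ℝ (Flat n)} {V : Set (EuclideanSpace ℝ (Fin r))}
  {I : Set ℝ} {e : Flat n} {G : EuclideanSpace ℝ (Fin r) × ℝ → FlatR n}
  (h : IsAdapted ε A V I e G)
include h

theorem differentiableAt {x : EuclideanSpace ℝ (Fin r)} (hx : x ∈ V) {s : ℝ} (hs : s ∈ I) :
    DifferentiableAt ℝ G (x, s) := h.axial.differentiableAt ⟨hx, hs⟩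

theorem fderiv_snd {x : EuclideanSpace ℝ (Fin r)} (hx : x ∈ V) {s : ℝ} (hs : s ∈ I)
    (X : EuclideanSpace ℝ (Fin r)) (t : ℝ) : (fderiv ℝ G (x, s) (X, t)).2 = t := by
  rw [← fderiv_snd_apply (h.differentiableAt hx hs)]
  have : (fun y => (G y).2) =ᶠ[𝓝 (x, s)] Prod.snd := by
    filter_upwards [(h.isOpen_left.prod h.isOpen_right).mem_nhds (⟨hx, hs⟩ : (x, s) ∈ V ×ˢ I)]
      with z hz using h.height z.1 hz.1 z.2 hz.2
  rw [this.fderiv_eq, _root_.fderiv_snd]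
  rfl

/-- The derivative along the leaves of the `ℚ_ε^n`-component. -/
def leafDeriv (G : EuclideanSpace ℝ (Fin r) × ℝ → FlatR n) (x : EuclideanSpace ℝ (Fin r)) (s : ℝ) :
    EuclideanSpace ℝ (Fin r) →ₗ[ℝ] Flat n :=
  LinearMap.fst ℝ (Flat n) ℝ ∘ₗ (fderiv ℝ G (x, s)).toLinearMap ∘ₗ LinearMap.inl ℝ _ ℝ

omit h in
theorem leafDeriv_apply (x : EuclideanSpace ℝ (Fin r)) (s : ℝ) (X : EuclideanSpace ℝ (Fin r)) :
    leafDeriv G x s X = (fderiv ℝ G (x, s) (X, 0)).1 := rfl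

theorem fderiv_leaf {x : EuclideanSpace ℝ (Fin r)} (hx : x ∈ V) {s : ℝ} (hs : s ∈ I)
    (X : EuclideanSpace ℝ (Fin r)) :
    fderiv ℝ (fun y => (G (y, s)).1) x X = leafDeriv G x s X := by
  have h1 := (hasFDerivAt_slice (h.differentiableAt hx hs)).differentiableAt
  rw [fderiv_fst_apply h1, fderiv_slice_apply (h.differentiableAt hx hs), leafDeriv_apply]

theorem differentiableAt_leaf {x : EuclideanSpace ℝ (Fin r)} (hx : x ∈ V) {s : ℝ} (hs : s ∈ I) :
    DifferentiableAt ℝ (fun y => (G (y, s)).1) x :=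
  (hasFDerivAt_slice (h.differentiableAt hx hs)).differentiableAt.fst

theorem contDiffOn_leaf {s : ℝ} (hs : s ∈ I) : ContDiffOn ℝ ∞ (fun y => (G (y, s)).1) V := by
  intro x hx
  have h1 := h.axial.contDiffAt (x := (x, s)) ⟨hx, hs⟩
  exact (h1.comp x (contDiffAt_id.prodMk contDiffAt_const)).fst.contDiffWithinAt

theorem leafDeriv_mem {x : EuclideanSpace ℝ (Fin r)} (hx : x ∈ V) {s : ℝ} (hs : s ∈ I)
    (X : EuclideanSpace ℝ (Fin r)) : leafDeriv G x s X ∈ (form ε n).orthogonal A :=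
  h.axial.axis (x, s) ⟨hx, hs⟩ (X, 0) (h.fderiv_snd hx hs X 0)

theorem leafDeriv_injective {x : EuclideanSpace ℝ (Fin r)} (hx : x ∈ V) {s : ℝ} (hs : s ∈ I) :
    Function.Injective (leafDeriv G x s) := by
  rw [injective_iff_map_eq_zero]
  intro X hX
  have h1 := (injective_iff_map_eq_zero _).1 (h.axial.inj (x, s) ⟨hx, hs⟩) (X, 0)
    (Prod.ext hX (h.fderiv_snd hx hs X 0))
  exact congrArg Prod.fst h1

theorem form_leafDeriv_self {x : EuclideanSpace ℝ (Fin r)} (hx : x ∈ V) {s : ℝ} (hs : s ∈ I)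
    (X : EuclideanSpace ℝ (Fin r)) : form ε n (leafDeriv G x s X) (G (x, s)).1 = 0 :=
  h.axial.form_fderiv_self (x := (x, s)) ⟨hx, hs⟩ (X, 0)

/-- The tangent spaces of the leaves do not depend on the height. -/
theorem form_leafDeriv {x : EuclideanSpace ℝ (Fin r)} (hx : x ∈ V) {s s' : ℝ} (hs : s ∈ I)
    (hs' : s' ∈ I) (X : EuclideanSpace ℝ (Fin r)) :
    form ε n (leafDeriv G x s X) (G (x, s')).1 = 0 := by
  have h1 := h.proportional x hx s hs s' hs' _ (h.leafDeriv_mem hx hs X)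
  rw [form_comm (G (x, s)).1, h.form_leafDeriv_self hx hs, zero_mul] at h1
  rw [form_comm]
  exact (mul_eq_zero.1 h1.symm).resolve_right (h.pos x hx s hs).ne'

/-- Leaves are tangent to `A^⊥`, so the product with `a` has zero derivative on the convex set `V`.
-/
theorem form_axis_eq {a : Flat n} (ha : a ∈ A) {x y : EuclideanSpace ℝ (Fin r)} (hx : x ∈ V)
    (hy : y ∈ V) {s : ℝ} (hs : s ∈ I) : form ε n (G (x, s)).1 a = form ε n (G (y, s)).1 a := by
  refine eq_of_fderiv_eq_zero_on_convex (u := fun x => form ε n (G (x, s)).1 a) h.isOpen_left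
    h.convex_left (fun z hz => ?_) (fun z hz X => ?_) hx hy
  · exact (contDiffAt_bilin _ ((h.contDiffOn_leaf hs).contDiffAt (h.isOpen_left.mem_nhds hz))
      contDiffAt_const).differentiableAt (by simp)
  · rw [fderiv_bilin_const_apply _ (h.differentiableAt_leaf hz hs), h.fderiv_leaf hz hs, form_comm]
    exact h.leafDeriv_mem hz hs X a ha

/-- By proportionality, the difference is orthogonal to `A^⊥`. Thus the curve with `x` fixed stays
in the span of `A` and one of its points. -/
theorem sub_smul_mem (hε : ε = 1 ∨ ε = -1) {x : EuclideanSpace ℝ (Fin r)} (hx : x ∈ V) {s s' : ℝ}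
    (hs : s ∈ I) (hs' : s' ∈ I) :
    (G (x, s)).1 - (form ε n (G (x, s)).1 e / form ε n (G (x, s')).1 e) • (G (x, s')).1 ∈ A := by
  rw [← (posOff_form hε (h.axial.mem (x, s) ⟨hx, hs⟩)).orthogonal_orthogonal A]
  intro v hv
  show form ε n v _ = 0
  have h1 := h.proportional x hx s hs s' hs' v hv
  rw [map_sub, map_smul, smul_eq_mul, form_comm v, form_comm v, sub_eq_zero, div_mul_eq_mul_div,
    eq_div_iff (h.pos x hx s' hs').ne', h1]
  ring

theorem notMem_axis {x : EuclideanSpace ℝ (Fin r)} (hx : x ∈ V) {s : ℝ} (hs : s ∈ I) :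
    (G (x, s)).1 ∉ A := fun hmem =>
  (h.pos x hx s hs).ne' (h.mem_orthogonal _ hmem)

end IsAdapted

/-! ### Axial immersions are rotational -/

section Orbit

variable {ε : ℝ} {n : ℕ}

/-- When the points differ, `L` is the reflection in the hyperplane orthogonal to `u = y - z`. It is
defined because `u` is spacelike, it fixes the axis because `u` is orthogonal to `A` and horizontal,
and it sends `z` to `y` because both have the same square. -/
theorem exists_fixesAxis (hε : ε = 1 ∨ ε = -1) {A : Submodule ℝ (Flat n)} {y z : FlatR n}
    (hy : y.1 ∈ quadric ε n) (hz : z.1 ∈ quadric ε n) (hyz : y.2 = z.2)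
    (hA : ∀ a ∈ A, form ε n y.1 a = form ε n z.1 a) :
    ∃ L, FixesAxis ε (A.prod ⊤) L ∧ y = L z := by
  by_cases heq : y.1 = z.1
  · exact ⟨LinearEquiv.refl ℝ _, ⟨fun _ _ => rfl, fun _ _ => rfl⟩, Prod.ext heq hyz⟩
  set u : FlatR n := (y.1 - z.1, 0) with hu
  have huy : y = z + u := Prod.ext (by simp [hu]) (by simp [hu, hyz])
  have hpos : 0 < formR ε n u u := by
    simpa [formR_apply, hu] using form_sub_self_pos hε hy hz heq
  set φ : Module.Dual ℝ (FlatR n) := (2 / formR ε n u u) • formR ε n u with hφ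
  have hφa : ∀ x, φ x = 2 / formR ε n u u * formR ε n u x := fun x => rfl
  have hφu : φ u = 2 := by
    rw [hφa, div_mul_cancel₀ _ hpos.ne']
  refine ⟨Module.reflection hφu, ⟨fun x x' => ?_, fun x hx => ?_⟩, ?_⟩
  · simp only [Module.reflection_apply, map_sub, map_smul, LinearMap.sub_apply, LinearMap.smul_apply,
      smul_eq_mul, hφa, formR_comm x u]
    field_simp
    ring
  · rw [Module.reflection_apply]
    have : formR ε n u x = 0 := by
      rw [formR_apply]
      simp [hu, hA x.1 hx.1]
    rw [hφa, this]
    simp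
  · rw [Module.reflection_apply, hφa]
    have h1 : formR ε n u u = 2 * ε - 2 * form ε n y.1 z.1 := by
      simp only [formR_apply, hu, map_sub, LinearMap.sub_apply, hy.1, hz.1, form_comm z.1 y.1,
        mul_zero, add_zero]
      ring
    have h2 : 2 / formR ε n u u * formR ε n u z = -1 := by
      have h3 : formR ε n u z = - (formR ε n u u) / 2 := by
        rw [h1]
        simp only [formR_apply, hu, map_sub, LinearMap.sub_apply, hz.1, zero_mul, add_zero]
        ring
      rw [h3]
      field_simp
    rw [h2, neg_one_smul, sub_neg_eq_add]
    exact huy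

variable {m : ℕ} {M : Type*} [TopologicalSpace M] [ChartedSpace (EuclideanSpace ℝ (Fin m)) M]
  [IsManifold (𝓡 m) ∞ M] {f : M → FlatR n}

/-- The profile is a curve with `x` fixed in adapted coordinates, and `P` is the sum of `A × ℝ` and
the position vector at the base point. Each point of the leaf at height `s` is the image of the
profile point at the same height under a reflection that fixes the axis. -/
theorem IsLocallyAxial.isRotationalWith (hε : ε = 1 ∨ ε = -1) (hm : 2 ≤ m)
    (hf : QxR.IsImmersion m ε f) (hT : ∀ p, pushT m ε f p ≠ 0)
    {C : Submodule ℝ (FlatR n) → Prop} {C' : Submodule ℝ (Flat n) → Prop}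
    (hC : ∀ A, C' A → C (A.prod ⊤)) (h : IsLocallyAxial m ε f C') : IsRotationalWith m ε f C := by
  intro p
  obtain ⟨U, A, hU, hp, hA, hCA, hax⟩ := h p
  obtain ⟨ψ, V, I, x₀, s₀, e, hsrc, hx₀, hs₀, hψp, hψs, hψs', had⟩ :=
    exists_adapted_param hε hm hf hT hA hU hp hax
  set G := f ∘ ψ with hG
  set y₀ : FlatR n := ((G (x₀, s₀)).1, 0) with hy₀
  have hy₀A : y₀ ∉ A.prod (⊤ : Submodule ℝ ℝ) := fun hmem => had.notMem_axis hx₀ hs₀ hmem.1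
  have hPmem : ∀ x, x ∈ A.prod (⊤ : Submodule ℝ ℝ) ⊔ Submodule.span ℝ {y₀} ↔
      ∃ c : ℝ, x - c • y₀ ∈ A.prod (⊤ : Submodule ℝ ℝ) := by
    intro x
    constructor
    · intro hx
      obtain ⟨a, ha, z, hz, rfl⟩ := Submodule.mem_sup.1 hx
      obtain ⟨c, rfl⟩ := Submodule.mem_span_singleton.1 hz
      exact ⟨c, by simpa using ha⟩
    · rintro ⟨c, hc⟩
      have : x = (x - c • y₀) + c • y₀ := by abel
      rw [this]
      exact Submodule.add_mem_sup hc (Submodule.smul_mem _ _ (Submodule.mem_span_singleton_self _))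
  have hep : 0 < form ε n (G (x₀, s₀)).1 e := had.pos x₀ hx₀ s₀ hs₀
  have hAe : ∀ x ∈ A.prod (⊤ : Submodule ℝ ℝ), form ε n x.1 e = 0 :=
    fun x hx => had.mem_orthogonal x.1 hx.1
  refine ⟨ψ.target, A.prod ⊤, A.prod ⊤ ⊔ Submodule.span ℝ {y₀}, I, fun s => G (x₀, s),
    ψ.open_target, ?_, ⟨?_, le_sup_left, ?_, ?_, had.isOpen_right, had.ordConnected_right, ?_, ?_,
      ?_⟩, hC A hCA, ?_⟩
  · rw [← hψp]
    exact ψ.map_source (by rw [hsrc]; exact ⟨hx₀, hs₀⟩)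
  · exact ⟨by simp [dt], trivial⟩
  · rw [finrank_prod_top]; omega
  · rw [Submodule.finrank_sup_span_singleton hy₀A, finrank_prod_top]
    omega
  · intro s hs
    have h1 := had.axial.contDiffAt (x := (x₀, s)) ⟨hx₀, hs⟩
    exact (h1.comp s (contDiffAt_const.prodMk contDiffAt_id)).contDiffWithinAt
  · intro s hs
    refine ⟨?_, had.axial.mem (x₀, s) ⟨hx₀, hs⟩, ?_⟩
    · rw [hPmem]
      exact ⟨_, had.sub_smul_mem hε hx₀ hs hs₀, trivial⟩
    · rw [(hasDerivAt_slice (had.differentiableAt hx₀ hs)).deriv]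
      intro h0
      have := had.fderiv_snd hx₀ hs 0 1
      rw [h0] at this
      simp at this
  -- As `e ∈ A^⊥` has positive product with the positions, `⟨·, e⟩` cuts out `A × ℝ` in `P` and is
  -- positive on the profile.
  · refine ⟨(form ε n).flip e ∘ₗ LinearMap.fst ℝ (Flat n) ℝ, ?_, ?_⟩
    · intro x hx
      show form ε n x.1 e = 0 ↔ _
      refine ⟨fun h0 => ?_, fun hx => hAe x hx⟩
      obtain ⟨c, hc⟩ := (hPmem x).1 hx
      have h1 := hAe _ hc
      simp only [hy₀, Prod.fst_sub, Prod.smul_fst, map_sub, map_smul, LinearMap.sub_apply,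
        LinearMap.smul_apply, h0, smul_eq_mul, zero_sub, neg_eq_zero] at h1
      rw [(mul_eq_zero.1 h1).resolve_right hep.ne', zero_smul, sub_zero] at hc
      exact hc
    · exact fun s hs => had.pos x₀ hx₀ s hs
  · rintro _ ⟨q, hq, rfl⟩
    have hz := ψ.map_target hq
    rw [hsrc] at hz
    obtain ⟨hx, hs⟩ := hz
    set x := (ψ.symm q).1
    set s := (ψ.symm q).2
    have hfq : f q = G (x, s) := by
      show f q = f (ψ (ψ.symm q))
      rw [ψ.right_inv hq]
    obtain ⟨L, hL, hLeq⟩ := exists_fixesAxis hε (A := A) (had.axial.mem (x, s) ⟨hx, hs⟩)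
      (had.axial.mem (x₀, s) ⟨hx₀, hs⟩) (by rw [had.height x hx s hs, had.height x₀ hx₀ s hs])
      (fun a ha => had.form_axis_eq ha hx hx₀ hs)
    exact ⟨L, hL, s, hs, hfq.trans hLeq⟩

end Orbit

/-! ### Reparametrization of one-dimensional leaves -/

section Reparam

theorem diag_eq_smul (t : ℝ) : diag 1 t = t • diag 1 1 := by
  ext i
  simp [diag]

theorem eq_diag (x : EuclideanSpace ℝ (Fin 1)) : x = diag 1 (x 0) := by
  ext i
  rw [Subsingleton.elim i 0]
  rfl

theorem contDiff_diag : ContDiff ℝ ∞ (diag 1) := by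
  rw [show diag 1 = fun t => t • diag 1 1 from funext diag_eq_smul]
  fun_prop

theorem contDiff_eval_zero : ContDiff ℝ ∞ (fun x : EuclideanSpace ℝ (Fin 1) => x 0) :=
  (EuclideanSpace.proj (0 : Fin 1) : EuclideanSpace ℝ (Fin 1) →L[ℝ] ℝ).contDiff

/-- Smooth primitives of smooth functions on an open interval. -/
theorem exists_smooth_primitive {J : Set ℝ} (hJ : IsOpen J) (hJc : J.OrdConnected) {σ : ℝ → ℝ}
    (hσ : ContDiffOn ℝ ∞ σ J) {t₀ : ℝ} (ht₀ : t₀ ∈ J) :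
    ∃ S : ℝ → ℝ, ContDiffOn ℝ ∞ S J ∧ ∀ t ∈ J, HasDerivAt S (σ t) t := by
  have hd : ∀ t ∈ J, HasDerivAt (fun t => ∫ u in t₀..t, σ u) (σ t) t := by
    intro t ht
    apply intervalIntegral.integral_hasDerivAt_right
    · exact (hσ.continuousOn.mono (hJc.uIcc_subset ht₀ ht)).intervalIntegrable
    · exact hσ.continuousOn.stronglyMeasurableAtFilter hJ t ht
    · exact hσ.continuousOn.continuousAt (hJ.mem_nhds ht)
  refine ⟨_, ?_, hd⟩
  rw [contDiffOn_infty_iff_deriv_of_isOpen hJ]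
  exact ⟨fun t ht => (hd t ht).differentiableAt.differentiableWithinAt,
    hσ.congr fun t ht => (hd t ht).deriv⟩

/-- A primitive `S` of `σ` is the new leaf coordinate, and `ψ` is a local inverse of `(x, s) ↦
(S(x), s)`. It serves to give a one-dimensional leaf constant speed without touching the height. -/
theorem exists_speed_reparam {V : Set (EuclideanSpace ℝ (Fin 1))} (hV : IsOpen V)
    (hVc : Convex ℝ V) {I : Set ℝ} (hI : IsOpen I) {σ : EuclideanSpace ℝ (Fin 1) → ℝ}
    (hσ : ContDiffOn ℝ ∞ σ V) (hpos : ∀ x ∈ V, 0 < σ x) {x₀ : EuclideanSpace ℝ (Fin 1)}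
    (hx₀ : x₀ ∈ V) {s₀ : ℝ} (hs₀ : s₀ ∈ I) :
    ∃ (ψ : OpenPartialHomeomorph (EuclideanSpace ℝ (Fin 1) × ℝ) (EuclideanSpace ℝ (Fin 1) × ℝ))
      (V' : Set (EuclideanSpace ℝ (Fin 1))) (I' : Set ℝ) (x₀' : EuclideanSpace ℝ (Fin 1))
      (ρ : EuclideanSpace ℝ (Fin 1) → EuclideanSpace ℝ (Fin 1)),
      IsOpen V' ∧ Convex ℝ V' ∧ IsOpen I' ∧ I'.OrdConnected ∧ ψ.source = V' ×ˢ I' ∧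
      x₀' ∈ V' ∧ s₀ ∈ I' ∧ ψ (x₀', s₀) = (x₀, s₀) ∧ ψ.target ⊆ V ×ˢ I ∧
      ContDiffOn ℝ ∞ ψ ψ.source ∧ ContDiffOn ℝ ∞ ψ.symm ψ.target ∧
      (∀ x ∈ V', ∀ s ∈ I', ψ (x, s) = (ρ x, s)) ∧
      ∀ x ∈ V', DifferentiableAt ℝ ρ x ∧ fderiv ℝ ρ x (diag 1 1) = (σ (ρ x))⁻¹ • diag 1 1 := by
  set J : Set ℝ := {t | diag 1 t ∈ V} with hJ
  have hJo : IsOpen J := hV.preimage contDiff_diag.continuous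
  have hJc : Convex ℝ J := by
    intro t ht u hu a b ha hb hab
    have := hVc ht hu ha hb hab
    rw [hJ, mem_ofPred_eq, diag_eq_smul]
    rw [diag_eq_smul t, diag_eq_smul u, smul_smul, smul_smul, ← add_smul] at this
    exact this
  have hmemJ : ∀ x ∈ V, x 0 ∈ J := fun x hx => by
    rw [hJ, mem_ofPred_eq, ← eq_diag]; exact hx
  obtain ⟨S, hSs, hS⟩ := exists_smooth_primitive hJo hJc.ordConnected (σ := fun t => σ (diag 1 t))
    (hσ.comp contDiff_diag.contDiffOn fun t ht => ht) (hmemJ x₀ hx₀)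
  have hSinj : InjOn S J := by
    refine (strictMonoOn_of_deriv_pos hJc
      (fun t ht => (hS t ht).continuousAt.continuousWithinAt) fun t ht => ?_).injOn
    rw [hJo.interior_eq] at ht
    rw [(hS t ht).deriv]
    exact hpos _ ht
  set Φ : EuclideanSpace ℝ (Fin 1) × ℝ → EuclideanSpace ℝ (Fin 1) × ℝ := fun z =>
    (diag 1 (S (z.1 0)), z.2) with hΦ
  have hO : IsOpen (V ×ˢ I) := hV.prod hI
  have hS1 : ∀ z ∈ V ×ˢ I, ContDiffAt ℝ ∞
      (fun z : EuclideanSpace ℝ (Fin 1) × ℝ => S (z.1 0)) z := fun z hz => by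
    have h1 : ContDiffAt ℝ ∞ S (z.1 0) := hSs.contDiffAt (hJo.mem_nhds (hmemJ _ hz.1))
    exact ContDiffAt.comp (g := S) (f := fun z : EuclideanSpace ℝ (Fin 1) × ℝ => z.1 0) z h1
      (contDiff_eval_zero.contDiffAt.comp z contDiffAt_fst)
  have hΦs : ContDiffOn ℝ ∞ Φ (V ×ˢ I) := fun z hz =>
    ((contDiff_diag.contDiffAt.comp z (hS1 z hz)).prodMk contDiffAt_snd).contDiffWithinAt
  have hinj : Function.Injective (fderiv ℝ Φ (x₀, s₀)) := by
    rw [injective_iff_map_eq_zero]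
    rintro ⟨X, t⟩ hX
    have hΦd : DifferentiableAt ℝ Φ (x₀, s₀) :=
      (hΦs.contDiffAt (hO.mem_nhds ⟨hx₀, hs₀⟩)).differentiableAt (by simp)
    have h2 : t = 0 := by
      have h3 := fderiv_snd_apply hΦd (X, t)
      rw [hX] at h3
      have h4 : fderiv ℝ (fun z : EuclideanSpace ℝ (Fin 1) × ℝ => (Φ z).2) (x₀, s₀) = 
          ContinuousLinearMap.snd ℝ _ ℝ := fderiv_snd
      rw [h4] at h3
      exact h3
    have h5 : σ x₀ * X 0 = 0 := by
      have h6 : HasFDerivAt (fun z : EuclideanSpace ℝ (Fin 1) × ℝ => S (z.1 0))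
          (σ x₀ • ((EuclideanSpace.proj (0 : Fin 1) : EuclideanSpace ℝ (Fin 1) →L[ℝ] ℝ) ∘L
            ContinuousLinearMap.fst ℝ _ ℝ)) (x₀, s₀) := by
        have h7 := hS _ (hmemJ x₀ hx₀)
        rw [← eq_diag] at h7
        exact HasDerivAt.comp_hasFDerivAt (f := fun z : EuclideanSpace ℝ (Fin 1) × ℝ => z.1 0)
          (x₀, s₀) h7 ((EuclideanSpace.proj (0 : Fin 1) :
            EuclideanSpace ℝ (Fin 1) →L[ℝ] ℝ).hasFDerivAt.comp (x₀, s₀) hasFDerivAt_fst)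
      have h8 := fderiv_comp_clm_apply ((EuclideanSpace.proj (0 : Fin 1) :
        EuclideanSpace ℝ (Fin 1) →L[ℝ] ℝ) ∘L ContinuousLinearMap.fst ℝ _ ℝ) hΦd (X, t)
      rw [hX, map_zero] at h8
      have h9 : (fun z => ((EuclideanSpace.proj (0 : Fin 1) :
        EuclideanSpace ℝ (Fin 1) →L[ℝ] ℝ) ∘L ContinuousLinearMap.fst ℝ _ ℝ) (Φ z))
          = fun z => S (z.1 0) := rfl
      rw [h9, h6.fderiv] at h8
      exact h8
    have h10 : X 0 = 0 := (mul_eq_zero.1 h5).resolve_left (hpos x₀ hx₀).ne'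
    have h11 : X = 0 := by rw [eq_diag X, h10, diag_eq_smul, zero_smul]
    rw [h11, h2]
    rfl
  obtain ⟨ψ, V', I', hV', hVc', hI', hIc', hsrc, hmem, hψx, htgt, hψs, hψs', hΦψ⟩ :=
    exists_product_inverse hO hΦs (x₀ := (x₀, s₀)) ⟨hx₀, hs₀⟩ (by simp) hinj
  have hs₀' : s₀ ∈ I' := hmem.2
  have hin : ∀ x ∈ V', ∀ s ∈ I', ψ (x, s) ∈ V ×ˢ I ∧ S ((ψ (x, s)).1 0) = x 0 ∧ (ψ (x, s)).2 = s := by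
    intro x hx s hs
    have hz : (x, s) ∈ ψ.source := by rw [hsrc]; exact ⟨hx, hs⟩
    have h1 := hΦψ _ hz
    exact ⟨htgt (ψ.map_source hz), congrArg (fun z : EuclideanSpace ℝ (Fin 1) × ℝ => z.1 0) h1,
      congrArg Prod.snd h1⟩
  refine ⟨ψ, V', I', diag 1 (S (x₀ 0)), fun x => (ψ (x, s₀)).1, hV', hVc', hI', hIc', hsrc,
    hmem.1, hs₀', hψx, htgt, hψs, hψs', ?_, ?_⟩
  · intro x hx s hs
    obtain ⟨h1, h2, h3⟩ := hin x hx s hs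
    obtain ⟨h1', h2', -⟩ := hin x hx s₀ hs₀'
    refine Prod.ext ?_ h3
    -- Injectivity of `S` shows that the leaf component of `ψ` does not depend on `s`.
    rw [eq_diag (ψ (x, s)).1, hSinj (hmemJ _ h1.1) (hmemJ _ h1'.1) (h2.trans h2'.symm), ← eq_diag]
  · intro x hx
    have hz : (x, s₀) ∈ ψ.source := by rw [hsrc]; exact ⟨hx, hs₀'⟩
    have hψd : DifferentiableAt ℝ ψ (x, s₀) :=
      (hψs.contDiffAt (ψ.open_source.mem_nhds hz)).differentiableAt (by simp)
    have hρd : DifferentiableAt ℝ (fun x => (ψ (x, s₀)).1) x :=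
      (hasFDerivAt_slice hψd).differentiableAt.fst
    refine ⟨hρd, ?_⟩
    set v := fderiv ℝ (fun x => (ψ (x, s₀)).1) x (diag 1 1) with hv
    obtain ⟨h1, -, -⟩ := hin x hx s₀ hs₀'
    have h2 := hS _ (hmemJ _ h1.1)
    rw [← eq_diag] at h2
    have h3 : HasFDerivAt (fun x => S ((ψ (x, s₀)).1 0)) (σ (ψ (x, s₀)).1 •
        ((EuclideanSpace.proj (0 : Fin 1) : EuclideanSpace ℝ (Fin 1) →L[ℝ] ℝ) ∘L
          fderiv ℝ (fun x => (ψ (x, s₀)).1) x)) x :=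
      HasDerivAt.comp_hasFDerivAt (f := fun x => (ψ (x, s₀)).1 0) x h2
        ((EuclideanSpace.proj (0 : Fin 1) : EuclideanSpace ℝ (Fin 1) →L[ℝ] ℝ).hasFDerivAt.comp x
          hρd.hasFDerivAt)
    have h4 : (fun x => S ((ψ (x, s₀)).1 0)) =ᶠ[𝓝 x]
        (EuclideanSpace.proj (0 : Fin 1) : EuclideanSpace ℝ (Fin 1) →L[ℝ] ℝ) := by
      filter_upwards [hV'.mem_nhds hx] with y hy using (hin y hy s₀ hs₀').2.1
    have h5 := h3.fderiv
    rw [h4.fderiv_eq, ContinuousLinearMap.fderiv] at h5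
    have h6 : (1 : ℝ) = σ (ψ (x, s₀)).1 * v 0 := DFunLike.congr_fun h5 (diag 1 1)
    rw [eq_diag v, diag_eq_smul, eq_inv_of_mul_eq_one_right h6.symm]

end Reparam

/-! ### Normalization of the speed of one-dimensional leaves -/

section Unit

variable {ε : ℝ} {n m : ℕ} {M : Type*} [TopologicalSpace M]
  [ChartedSpace (EuclideanSpace ℝ (Fin m)) M] [IsManifold (𝓡 m) ∞ M] {f : M → FlatR n}

/-- Adapted parametrizations in which a one-dimensional leaf has prescribed constant speed. -/
theorem exists_adapted_param_speed (hε : ε = 1 ∨ ε = -1) (hm : 2 ≤ m) (hf : QxR.IsImmersion m ε f)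
    (hT : ∀ p, pushT m ε f p ≠ 0) {A : Submodule ℝ (Flat n)} (hA : finrank ℝ A + m = n + 1)
    {U : Set M} (hU : IsOpen U) {p : M} (hp : p ∈ U)
    (hax : ∀ q ∈ U, ∀ Y, (push m f q Y).2 = 0 → (push m f q Y).1 ∈ (form ε n).orthogonal A)
    {c : ℝ} (hc : 0 < c) :
    ∃ (ψ : OpenPartialHomeomorph (EuclideanSpace ℝ (Fin (m - 1)) × ℝ) M)
      (V : Set (EuclideanSpace ℝ (Fin (m - 1)))) (I : Set ℝ)
      (x₀ : EuclideanSpace ℝ (Fin (m - 1))) (s₀ : ℝ) (e : Flat n),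
      ψ.source = V ×ˢ I ∧ x₀ ∈ V ∧ s₀ ∈ I ∧ ψ (x₀, s₀) = p ∧
      ContMDiffOn 𝓘(ℝ, EuclideanSpace ℝ (Fin (m - 1)) × ℝ) (𝓡 m) ∞ ψ ψ.source ∧
      ContMDiffOn (𝓡 m) 𝓘(ℝ, EuclideanSpace ℝ (Fin (m - 1)) × ℝ) ∞ ψ.symm ψ.target ∧
      IsAdapted ε A V I e (f ∘ ψ) ∧
      (m - 1 = 1 → ∀ x ∈ V, form ε n (IsAdapted.leafDeriv (f ∘ ψ) x s₀ (diag (m - 1) 1))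
        (IsAdapted.leafDeriv (f ∘ ψ) x s₀ (diag (m - 1) 1)) = c) := by
  obtain ⟨ψ, V, I, x₀, s₀, e, hsrc, hx₀, hs₀, hψp, hψs, hψs', had⟩ :=
    exists_adapted_param hε hm hf hT hA hU hp hax
  by_cases hm1 : m - 1 = 1
  swap
  · exact ⟨ψ, V, I, x₀, s₀, e, hsrc, hx₀, hs₀, hψp, hψs, hψs', had, fun h => (hm1 h).elim⟩
  have hdim : finrank ℝ (EuclideanSpace ℝ (Fin (m - 1)) × ℝ) = m := by simp; omega
  -- After generalizing, the index can be replaced by the literal `1` in all types.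
  generalize m - 1 = r at *
  subst hm1
  set G := f ∘ ψ with hG
  set Q : EuclideanSpace ℝ (Fin 1) → ℝ := fun x => form ε n (IsAdapted.leafDeriv G x s₀ (diag 1 1))
        (IsAdapted.leafDeriv G x s₀ (diag 1 1)) with hQ
  have hQpos : ∀ x ∈ V, 0 < Q x := by
    intro x hx
    refine form_self_pos hε (had.axial.mem (x, s₀) ⟨hx, hs₀⟩).1 (had.form_leafDeriv_self hx hs₀ _) ?_
    intro h0
    have h1 := (injective_iff_map_eq_zero _).1 (had.leafDeriv_injective hx hs₀) _ h0
    have h2 := congrArg (fun x : EuclideanSpace ℝ (Fin 1) => x 0) h1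
    simp [diag] at h2
  have hQs : ContDiffOn ℝ ∞ Q V := by
    intro x hx
    have h1 := had.axial.contDiffAt_fderiv (x := (x, s₀)) ⟨hx, hs₀⟩
    have h2 : ContDiffAt ℝ ∞ (fun x => fderiv ℝ G (x, s₀)) x :=
      ContDiffAt.comp (g := fderiv ℝ G) (f := fun x => (x, s₀)) x h1
        (contDiffAt_id.prodMk contDiffAt_const)
    have h3 : ContDiffAt ℝ ∞ (fun x => IsAdapted.leafDeriv G x s₀ (diag 1 1)) x :=
      (h2.clm_apply contDiffAt_const).fst
    exact (contDiffAt_bilin _ h3 h3).contDiffWithinAt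
  -- The old squared speed is `Q`; reparametrizing by the factor `√(Q / c)` leaves the squared speed
  -- `c`.
  obtain ⟨χ, V', I', x₀', ρ, hV', hVc', hI', hIc', hχsrc, hx₀', hs₀', hχx, hχt, hχs, hχs', hχρ, hρ⟩ :=
    exists_speed_reparam had.isOpen_left had.convex_left had.isOpen_right
      (σ := fun x => Real.sqrt (Q x / c)) (fun x hx => (ContDiffWithinAt.sqrt
        ((hQs x hx).div_const c) (div_pos (hQpos x hx) hc).ne'))
      (fun x hx => Real.sqrt_pos.2 (div_pos (hQpos x hx) hc)) hx₀ hs₀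
  have hχmem : ∀ x ∈ V', ∀ s ∈ I', ρ x ∈ V ∧ s ∈ I := by
    intro x hx s hs
    have h1 := hχt (χ.map_source (by rw [hχsrc]; exact ⟨hx, hs⟩ : (x, s) ∈ χ.source))
    rw [hχρ x hx s hs] at h1
    exact h1
  have hχψ : ∀ z ∈ χ.source, χ z ∈ ψ.source := fun z hz => by
    rw [hsrc]; exact hχt (χ.map_source hz)
  set Ψ := χ.trans ψ with hΨ
  have hΨsrc : Ψ.source = V' ×ˢ I' := by
    rw [hΨ, OpenPartialHomeomorph.trans_source, hχsrc]
    apply inter_eq_left.2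
    exact fun z hz => hχψ z (by rwa [hχsrc])
  have hΨa : ∀ x ∈ V', ∀ s ∈ I', (f ∘ Ψ) (x, s) = G (ρ x, s) := by
    intro x hx s hs
    show f (ψ (χ (x, s))) = f (ψ (ρ x, s))
    rw [hχρ x hx s hs]
  have hΨs : ContMDiffOn 𝓘(ℝ, EuclideanSpace ℝ (Fin 1) × ℝ) (𝓡 m) ∞ Ψ Ψ.source := by
    refine hψs.comp ((contMDiffOn_iff_contDiffOn.2 hχs).mono ?_) ?_
    · rw [hΨsrc, hχsrc]
    · intro z hz
      rw [hΨsrc, ← hχsrc] at hz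
      exact hχψ z hz
  have hΨs' : ContMDiffOn (𝓡 m) 𝓘(ℝ, EuclideanSpace ℝ (Fin 1) × ℝ) ∞ Ψ.symm Ψ.target := by
    refine (contMDiffOn_iff_contDiffOn.2 hχs').comp (hψs'.mono ?_) ?_
    · rw [hΨ, OpenPartialHomeomorph.trans_target]
      exact inter_subset_left
    · rw [hΨ, OpenPartialHomeomorph.trans_target]
      exact fun z hz => hz.2
  have had' : IsAdapted ε A V' I' e (f ∘ Ψ) := by
    refine ⟨hV', hVc', hI', hIc', had.mem_orthogonal, ?_, ?_, ?_, ?_⟩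
    · have h1 := isAxial_param hε hf hT hA (ψ.open_target) (fun q hq Y hY => ?_) hΨs hΨs' hdim
      · rw [hΨsrc] at h1
        rwa [inter_eq_left.2] at h1
        exact fun z hz => ψ.map_source (hχψ z (by rwa [hχsrc]))
      · obtain ⟨θ, hθ⟩ := exists_equiv_push hf.1 hψs hψs' (ψ.map_target hq)
        rw [ψ.right_inv hq] at hθ
        have h2 := hθ (θ.symm Y)
        rw [θ.apply_symm_apply] at h2
        rw [← h2] at hY ⊢
        exact had.axial.axis _ (by rw [← hsrc]; exact ψ.map_target hq) _ hY
    · intro x hx s hs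
      rw [hΨa x hx s hs]
      exact had.height _ (hχmem x hx s hs).1 _ (hχmem x hx s hs).2
    · intro x hx s hs
      rw [hΨa x hx s hs]
      exact had.pos _ (hχmem x hx s hs).1 _ (hχmem x hx s hs).2
    · intro x hx s hs s' hs'
      rw [hΨa x hx s hs, hΨa x hx s' hs']
      exact had.proportional _ (hχmem x hx s hs).1 _ (hχmem x hx s hs).2 _ (hχmem x hx s' hs').2
  refine ⟨Ψ, V', I', x₀', s₀, e, hΨsrc, hx₀', hs₀', ?_, hΨs, hΨs', had', fun _ x hx => ?_⟩
  · show ψ (χ (x₀', s₀)) = p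
    rw [hχx, hψp]
  · obtain ⟨hρd, hρ1⟩ := hρ x hx
    have hρV := (hχmem x hx s₀ hs₀').1
    have h1 : IsAdapted.leafDeriv (f ∘ Ψ) x s₀ (diag 1 1)
        = (Real.sqrt (Q (ρ x) / c))⁻¹ • IsAdapted.leafDeriv G (ρ x) s₀ (diag 1 1) := by
      rw [← had'.fderiv_leaf hx hs₀']
      have h2 : (fun y => ((f ∘ Ψ) (y, s₀)).1) =ᶠ[𝓝 x] fun y => (G (ρ y, s₀)).1 := by
        filter_upwards [hV'.mem_nhds hx] with y hy
        rw [hΨa y hy s₀ hs₀']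
      have h3 := ((had.differentiableAt_leaf hρV hs₀).hasFDerivAt.comp x hρd.hasFDerivAt).fderiv
      have h4 : fderiv ℝ (fun y => (G (ρ y, s₀)).1) x (diag 1 1)
          = fderiv ℝ (fun y => (G (y, s₀)).1) (ρ x) (fderiv ℝ ρ x (diag 1 1)) :=
        DFunLike.congr_fun h3 (diag 1 1)
      rw [h2.fderiv_eq, h4, hρ1, map_smul, had.fderiv_leaf hρV hs₀]
    rw [h1]
    simp only [map_smul, LinearMap.smul_apply, smul_eq_mul]
    have h5 : form ε n (IsAdapted.leafDeriv G (ρ x) s₀ (diag 1 1))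
        (IsAdapted.leafDeriv G (ρ x) s₀ (diag 1 1)) = Q (ρ x) := rfl
    have h6 := hQpos _ hρV
    have h7 := Real.mul_self_sqrt (div_pos h6 hc).le
    rw [h5, ← mul_assoc, ← mul_inv, h7]
    field_simp

end Unit

/-! ### Immersions into the quadric with constant products with a subspace -/

/-- `g : V^r → ℚ_ε^n` is an immersion such that `⟨g, a⟩` is constant for all `a` in a subspace `A` of
dimension `n - r`, which does not contain the position vectors. -/
structure IsRoundOn {r : ℕ} (ε : ℝ) (n : ℕ) (A : Submodule ℝ (Flat n))
    (V : Set (EuclideanSpace ℝ (Fin r))) (g : EuclideanSpace ℝ (Fin r) → Flat n) : Prop where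
  isOpen : IsOpen V
  immersion : IsImmersionOn ε n V g
  const : ∀ x ∈ V, ∀ y ∈ V, ∀ a ∈ A, form ε n (g x) a = form ε n (g y) a
  notMem : ∀ x ∈ V, g x ∉ A
  finrank : finrank ℝ A + r = n

/-- The tangential projection `a - ε⟨a, y⟩ y` at the point `y` of the quadric. -/
def tangentPart (ε : ℝ) (n : ℕ) (y : Flat n) : Flat n →ₗ[ℝ] Flat n :=
  LinearMap.id - (ε • (form ε n).flip y).smulRight y

theorem tangentPart_apply {ε : ℝ} {n : ℕ} (y a : Flat n) :
    tangentPart ε n y a = a - (ε * form ε n a y) • y := rfl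

theorem form_tangentPart_self {ε : ℝ} {n : ℕ} (hε : ε = 1 ∨ ε = -1) {y : Flat n}
    (hy : form ε n y y = ε) (a : Flat n) : form ε n (tangentPart ε n y a) y = 0 := by
  rw [tangentPart_apply]
  simp only [map_sub, map_smul, LinearMap.sub_apply, LinearMap.smul_apply, smul_eq_mul, hy]
  linear_combination -form ε n a y * sq_eq_one_of_sign hε

theorem form_tangentPart {ε : ℝ} {n : ℕ} (hε : ε = 1 ∨ ε = -1) {y : Flat n}
    (hy : form ε n y y = ε) (a b : Flat n) :
    form ε n (tangentPart ε n y a) (tangentPart ε n y b)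
      = form ε n a b - ε * form ε n a y * form ε n b y := by
  rw [tangentPart_apply y b, map_sub, map_smul, form_tangentPart_self hε hy, tangentPart_apply]
  simp only [map_sub, map_smul, LinearMap.sub_apply, LinearMap.smul_apply, smul_eq_mul,
    form_comm y b]
  ring

namespace IsImmersionOn

variable {ε : ℝ} {n r : ℕ} {V : Set (EuclideanSpace ℝ (Fin r))}
  {g : EuclideanSpace ℝ (Fin r) → Flat n} (h : IsImmersionOn ε n V g) (hV : IsOpen V)
include h hV

theorem contDiffAt {x : EuclideanSpace ℝ (Fin r)} (hx : x ∈ V) : ContDiffAt ℝ ∞ g x :=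
  h.1.contDiffAt (hV.mem_nhds hx)

theorem differentiableAt {x : EuclideanSpace ℝ (Fin r)} (hx : x ∈ V) : DifferentiableAt ℝ g x :=
  (h.contDiffAt hV hx).differentiableAt (by simp)

theorem contDiffAt_fderiv {x : EuclideanSpace ℝ (Fin r)} (hx : x ∈ V) :
    ContDiffAt ℝ ∞ (fderiv ℝ g) x := (h.contDiffAt hV hx).fderiv_right (by simp)

theorem eventually_form_self {x : EuclideanSpace ℝ (Fin r)} (hx : x ∈ V) :
    ∀ᶠ y in 𝓝 x, form ε n (g y) (g y) = ε := by
  filter_upwards [hV.mem_nhds hx] with y hy using (h.2 y hy).1.1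

theorem form_fderiv_self {x : EuclideanSpace ℝ (Fin r)} (hx : x ∈ V)
    (X : EuclideanSpace ℝ (Fin r)) : form ε n (fderiv ℝ g x X) (g x) = 0 :=
  bilin_fderiv_self form_comm (h.differentiableAt hV hx) (h.eventually_form_self hV hx) X

end IsImmersionOn

theorem mem_normalSpace_iff {ε : ℝ} {n r : ℕ} {g : EuclideanSpace ℝ (Fin r) → Flat n}
    {x : EuclideanSpace ℝ (Fin r)} {v : Flat n} :
    v ∈ normalSpace (form ε n) (g x) g x ↔
      (∀ X, form ε n (fderiv ℝ g x X) v = 0) ∧ form ε n (g x) v = 0 := by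
  rw [normalSpace, mem_orthogonal_sup_span]
  refine and_congr_left fun _ => ⟨fun h1 X => h1 _ ⟨X, rfl⟩, ?_⟩
  rintro h1 _ ⟨X, rfl⟩
  exact h1 X

theorem hasDerivAt_comp_diag {W : Type*} [NormedAddCommGroup W] [NormedSpace ℝ W]
    {u : EuclideanSpace ℝ (Fin 1) → W} {t : ℝ} (hu : DifferentiableAt ℝ u (diag 1 t)) :
    HasDerivAt (fun t => u (diag 1 t)) (fderiv ℝ u (diag 1 t) (diag 1 1)) t := by
  have h1 : HasDerivAt (diag 1) (diag 1 1) t := by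
    rw [show diag 1 = fun t => t • diag 1 1 from funext diag_eq_smul]
    simpa using (hasDerivAt_id t).smul_const (diag 1 1)
  exact hu.hasFDerivAt.comp_hasDerivAt t h1

/-- The acceleration of a unit-speed curve is the value of its second fundamental form. -/
theorem IsImmersionOn.covDeriv_deriv {ε : ℝ} {n : ℕ} (hε : ε = 1 ∨ ε = -1)
    {V : Set (EuclideanSpace ℝ (Fin 1))} {g : EuclideanSpace ℝ (Fin 1) → Flat n}
    (h : IsImmersionOn ε n V g) (hV : IsOpen V)
    (hunit : ∀ x ∈ V, form ε n (fderiv ℝ g x (diag 1 1)) (fderiv ℝ g x (diag 1 1)) = 1)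
    {t : ℝ} (ht : diag 1 t ∈ V) {N : Flat n}
    (hN : N ∈ normalSpace (form ε n) (g (diag 1 t)) g (diag 1 t))
    (hm : fderiv ℝ (fderiv ℝ g) (diag 1 t) (diag 1 1) (diag 1 1) - N
      ∈ tangentSpan g (diag 1 t) ⊔ Submodule.span ℝ {g (diag 1 t)}) :
    covDeriv ε n (fun t => g (diag 1 t)) (deriv fun t => g (diag 1 t)) t = N := by
  have hJ : IsOpen {t | diag 1 t ∈ V} := hV.preimage contDiff_diag.continuous
  set γ : ℝ → Flat n := fun t => g (diag 1 t) with hγ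
  set d := diag 1 1 with hd
  have h2 := (h.contDiffAt_fderiv hV ht).differentiableAt (by simp)
  have hγ'' : deriv (deriv γ) t = fderiv ℝ (fderiv ℝ g) (diag 1 t) d d := by
    have h1 : deriv γ =ᶠ[𝓝 t] fun t => fderiv ℝ g (diag 1 t) d := by
      filter_upwards [hJ.mem_nhds ht] with u hu using
        (hasDerivAt_comp_diag (h.differentiableAt hV hu)).deriv
    rw [h1.deriv_eq, (hasDerivAt_comp_diag (u := fun x => fderiv ℝ g x d)
      (h2.clm_apply (differentiableAt_const d))).deriv, fderiv_clm_apply_const h2]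
  obtain ⟨hN1, hN2⟩ := mem_normalSpace_iff.1 hN
  -- Unit speed removes the tangential part of the second derivative; the part along the position is
  -- what `covDeriv` subtracts.
  have hself : form ε n (fderiv ℝ (fderiv ℝ g) (diag 1 t) d d) (fderiv ℝ g (diag 1 t) d) = 0 := by
    have h3 := bilin_fderiv_self (B := form ε n) form_comm (g := fun x => fderiv ℝ g x d)
      (h2.clm_apply (differentiableAt_const d)) (c := 1)
      (by filter_upwards [hV.mem_nhds ht] with y hy using hunit y hy) d
    rwa [fderiv_clm_apply_const h2] at h3
  rw [covDeriv, hγ'']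
  set D2 := fderiv ℝ (fderiv ℝ g) (diag 1 t) d d
  obtain ⟨_, ⟨X, rfl⟩, z, hz, heq⟩ := Submodule.mem_sup.1 hm
  obtain ⟨c, rfl⟩ := Submodule.mem_span_singleton.1 hz
  have hX : X = X 0 • d := by
    conv_lhs => rw [eq_diag X, diag_eq_smul]
  have heq : D2 = N + X 0 • fderiv ℝ g (diag 1 t) d + c • g (diag 1 t) := by
    have h1 : (fderiv ℝ g (diag 1 t)).toLinearMap X = X 0 • fderiv ℝ g (diag 1 t) d := by
      conv_lhs => rw [hX]
      exact map_smul _ _ _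
    rw [h1] at heq
    rw [add_assoc, heq]
    abel
  have hX0 : X 0 = 0 := by
    rw [heq] at hself
    simp only [map_add, map_smul, LinearMap.add_apply, LinearMap.smul_apply, smul_eq_mul,
      hunit _ ht, form_comm N, hN1, form_comm (g (diag 1 t)), h.form_fderiv_self hV ht] at hself
    linarith
  have hc : form ε n D2 (γ t) = ε * c := by
    rw [heq, hX0]
    simp only [map_add, map_smul, LinearMap.add_apply, LinearMap.smul_apply, smul_eq_mul,
      form_comm N, hγ, hN2, (h.2 _ ht).1.1]
    simp [mul_comm]
  rw [hc, ← mul_assoc, sq_eq_one_of_sign hε, one_mul]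
  conv_lhs => rw [heq, hX0]
  simp [hγ]

namespace IsRoundOn

variable {ε : ℝ} {n r : ℕ} {A : Submodule ℝ (Flat n)} {V : Set (EuclideanSpace ℝ (Fin r))}
  {g : EuclideanSpace ℝ (Fin r) → Flat n} (h : IsRoundOn ε n A V g)
include h

theorem contDiffAt {x : EuclideanSpace ℝ (Fin r)} (hx : x ∈ V) : ContDiffAt ℝ ∞ g x :=
  h.immersion.contDiffAt h.isOpen hx

theorem differentiableAt {x : EuclideanSpace ℝ (Fin r)} (hx : x ∈ V) : DifferentiableAt ℝ g x :=
  h.immersion.differentiableAt h.isOpen hx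

theorem contDiffAt_fderiv {x : EuclideanSpace ℝ (Fin r)} (hx : x ∈ V) :
    ContDiffAt ℝ ∞ (fderiv ℝ g) x := h.immersion.contDiffAt_fderiv h.isOpen hx

theorem form_self {x : EuclideanSpace ℝ (Fin r)} (hx : x ∈ V) : form ε n (g x) (g x) = ε :=
  (h.immersion.2 x hx).1.1

theorem eventually_form_self {x : EuclideanSpace ℝ (Fin r)} (hx : x ∈ V) :
    ∀ᶠ y in 𝓝 x, form ε n (g y) (g y) = ε := h.immersion.eventually_form_self h.isOpen hx

theorem form_fderiv_self {x : EuclideanSpace ℝ (Fin r)} (hx : x ∈ V)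
    (X : EuclideanSpace ℝ (Fin r)) : form ε n (fderiv ℝ g x X) (g x) = 0 :=
  h.immersion.form_fderiv_self h.isOpen hx X

theorem form_fderiv_axis {x : EuclideanSpace ℝ (Fin r)} (hx : x ∈ V)
    (X : EuclideanSpace ℝ (Fin r)) {a : Flat n} (ha : a ∈ A) :
    form ε n (fderiv ℝ g x X) a = 0 := by
  rw [← fderiv_bilin_const_apply _ (h.differentiableAt hx), fderiv_eq_zero_of_eventually_const
    (c := form ε n (g x) a)]
  · rfl
  · filter_upwards [h.isOpen.mem_nhds hx] with y hy using h.const y hy x hx a ha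

theorem form_snd_fderiv_axis {x : EuclideanSpace ℝ (Fin r)} (hx : x ∈ V)
    (X Y : EuclideanSpace ℝ (Fin r)) {a : Flat n} (ha : a ∈ A) :
    form ε n (fderiv ℝ (fderiv ℝ g) x X Y) a = 0 := by
  have hd := (h.contDiffAt_fderiv hx).differentiableAt (by simp)
  rw [← fderiv_clm_apply_const hd, ← fderiv_bilin_const_apply _
    (hd.clm_apply (differentiableAt_const Y)), fderiv_eq_zero_of_eventually_const (c := 0)]
  · rfl
  · filter_upwards [h.isOpen.mem_nhds hx] with y hy using h.form_fderiv_axis hy Y ha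

/-- Vectors orthogonal to the tangent space are in `A + ℝ g`. -/
theorem exists_sub_smul_mem (hε : ε = 1 ∨ ε = -1) {x : EuclideanSpace ℝ (Fin r)} (hx : x ∈ V)
    {v : Flat n} (hv : ∀ X, form ε n (fderiv ℝ g x X) v = 0) : ∃ c : ℝ, v - c • g x ∈ A := by
  have hp := posOff_form hε (h.immersion.2 x hx).1
  -- Otherwise `g x` would be in `(A^⊥)^⊥ = A`.
  obtain ⟨e, he, hne⟩ : ∃ e ∈ (form ε n).orthogonal A, form ε n e (g x) ≠ 0 := by
    by_contra! hcon
    apply h.notMem x hx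
    rw [← hp.orthogonal_orthogonal A]
    exact hcon
  have h1 := exists_sub_smul_mem_orthogonal (B := form ε n) (T := tangentSpan g x)
    (L := (form ε n).orthogonal A) (y := g x) (e := e) (v := v)
    (by
      rintro _ ⟨X, rfl⟩ a ha
      show form ε n a _ = 0
      rw [form_comm]; exact h.form_fderiv_axis hx X ha)
    (by rintro _ ⟨X, rfl⟩; exact h.form_fderiv_self hx X)
    (by
      have h2 := hp.finrank_orthogonal A
      have h3 := h.finrank
      rw [tangentSpan, LinearMap.finrank_range_of_inj (h.immersion.2 x hx).2]
      simp only [Module.finrank_fin_fun, finrank_euclideanSpace, Fintype.card_fin] at h2 ⊢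
      omega) he hne (by rintro _ ⟨X, rfl⟩; exact hv X)
  rw [hp.orthogonal_orthogonal A] at h1
  exact ⟨_, h1⟩

/-- The constant frames of the axis that are orthonormal after projection to the quadric. -/
theorem exists_frame (hε : ε = 1 ∨ ε = -1) {x₀ : EuclideanSpace ℝ (Fin r)} (hx₀ : x₀ ∈ V) :
    ∃ a : Fin (Module.finrank ℝ A) → Flat n, (∀ i, a i ∈ A) ∧
      (∀ x ∈ V, ∀ i j, form ε n (tangentPart ε n (g x) (a i)) (tangentPart ε n (g x) (a j))
        = if i = j then 1 else 0) ∧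
      ∀ x ∈ V, ∀ b ∈ A, b = ∑ i, form ε n b (tangentPart ε n (g x) (a i)) • a i := by
  have hy := h.form_self hx₀
  -- The metric pulled back by the tangential projection at `x₀` is positive definite on `A`, since
  -- the kernel `ℝ g(x₀)` of the projection meets `A` trivially, even where the flat metric itself
  -- is degenerate on `A`.
  set B' : LinearMap.BilinForm ℝ (Flat n) :=
    (form ε n).compl₁₂ (tangentPart ε n (g x₀)) (tangentPart ε n (g x₀)) with hB'
  have hB'a : ∀ b c, B' b c = form ε n (tangentPart ε n (g x₀) b) (tangentPart ε n (g x₀) c) :=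
    fun b c => rfl
  obtain ⟨a, haA, hon, hexp⟩ := exists_orthonormal_basis (B := B') (S := A)
    (fun b c => by rw [hB'a, hB'a, form_comm]) (fun w hw hw0 => by
      rw [hB'a]
      refine form_self_pos hε hy (form_tangentPart_self hε hy w) fun h0 => ?_
      rw [tangentPart_apply, sub_eq_zero] at h0
      by_cases hc : ε * form ε n w (g x₀) = 0
      · rw [hc, zero_smul] at h0
        exact hw0 h0
      · rw [h0] at hw
        exact h.notMem x₀ hx₀ ((Submodule.smul_mem_iff _ hc).1 hw))
  -- The pulled back products involve only `⟨b, c⟩` and the constants `⟨g, b⟩`, `⟨g, c⟩`; so a basis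
  -- that is orthonormal at `x₀` remains so.
  have hconst : ∀ x ∈ V, ∀ b ∈ A, ∀ c ∈ A,
      form ε n (tangentPart ε n (g x) b) (tangentPart ε n (g x) c) = B' b c := by
    intro x hx b hb c hc
    rw [hB'a, form_tangentPart hε (h.form_self hx), form_tangentPart hε hy, form_comm b (g x),
      form_comm c (g x), h.const x hx x₀ hx₀ b hb, h.const x hx x₀ hx₀ c hc, form_comm (g x₀) b,
      form_comm (g x₀) c]
  refine ⟨a, haA, fun x hx i j => ?_, fun x hx b hb => ?_⟩
  · rw [hconst x hx _ (haA i) _ (haA j), hon]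
  · have h1 : ∀ i, form ε n b (tangentPart ε n (g x) (a i)) = B' b (a i) := by
      intro i
      rw [← hconst x hx b hb _ (haA i), tangentPart_apply (g x) b, map_sub, map_smul,
        LinearMap.sub_apply, LinearMap.smul_apply, form_comm (g x),
        form_tangentPart_self hε (h.form_self hx), smul_zero, sub_zero]
    simp only [h1]
    exact hexp b hb

/-- Frames as in `exists_frame`. -/
structure _root_.QxR.IsAxisFrame (ε : ℝ) (n : ℕ) (A : Submodule ℝ (Flat n))
    (V : Set (EuclideanSpace ℝ (Fin r))) (g : EuclideanSpace ℝ (Fin r) → Flat n) {k : ℕ}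
    (a : Fin k → Flat n) : Prop where
  mem : ∀ i, a i ∈ A
  orthonormal : ∀ x ∈ V, ∀ i j,
    form ε n (tangentPart ε n (g x) (a i)) (tangentPart ε n (g x) (a j)) = if i = j then 1 else 0
  expand : ∀ x ∈ V, ∀ b ∈ A, b = ∑ i, form ε n b (tangentPart ε n (g x) (a i)) • a i

variable {k : ℕ} {a : Fin k → Flat n} (ha : IsAxisFrame ε n A V g a)
include ha

omit h ha in
/-- The normal fields `a - ε⟨a, g⟩ g`. -/
def _root_.QxR.frameField (ε : ℝ) (n : ℕ) (g : EuclideanSpace ℝ (Fin r) → Flat n) (a : Fin k → Flat n)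
    (i : Fin k) (x : EuclideanSpace ℝ (Fin r)) : Flat n :=
  tangentPart ε n (g x) (a i)

theorem frameField_eventuallyEq {x : EuclideanSpace ℝ (Fin r)} (hx : x ∈ V) (i : Fin k) :
    frameField ε n g a i =ᶠ[𝓝 x] fun y => a i - (ε * form ε n (g x) (a i)) • g y := by
  filter_upwards [h.isOpen.mem_nhds hx] with y hy
  rw [frameField, tangentPart_apply, form_comm, h.const y hy x hx _ (ha.mem i)]

/-- As `⟨a, g⟩` is constant, only the factor `g` varies. The derivative is tangent, hence the field
is parallel, and its shape operator is a constant multiple of the identity. -/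
theorem fderiv_frameField {x : EuclideanSpace ℝ (Fin r)} (hx : x ∈ V) (i : Fin k)
    (X : EuclideanSpace ℝ (Fin r)) : fderiv ℝ (frameField ε n g a i) x X
      = -(ε * form ε n (g x) (a i)) • fderiv ℝ g x X := by
  rw [(h.frameField_eventuallyEq ha hx i).fderiv_eq, fderiv_const_sub,
    fderiv_fun_const_smul (h.differentiableAt hx)]
  simp

theorem contDiffOn_frameField (i : Fin k) : ContDiffOn ℝ ∞ (frameField ε n g a i) V := by
  intro x hx
  refine ContDiffAt.contDiffWithinAt (ContDiffAt.congr_of_eventuallyEq ?_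
    (h.frameField_eventuallyEq ha hx i))
  exact contDiffAt_const.sub ((h.contDiffAt hx).const_smul _)

omit ha in
theorem form_frameField_self (hε : ε = 1 ∨ ε = -1) {x : EuclideanSpace ℝ (Fin r)} (hx : x ∈ V)
    (i : Fin k) : form ε n (frameField ε n g a i x) (g x) = 0 :=
  form_tangentPart_self hε (h.form_self hx) _

theorem frameField_mem_normalSpace (hε : ε = 1 ∨ ε = -1) {x : EuclideanSpace ℝ (Fin r)}
    (hx : x ∈ V) (i : Fin k) : frameField ε n g a i x ∈ normalSpace (form ε n) (g x) g x := by
  rw [mem_normalSpace_iff]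
  refine ⟨fun X => ?_, by rw [form_comm]; exact h.form_frameField_self hε hx i⟩
  rw [frameField, tangentPart_apply, map_sub, map_smul, h.form_fderiv_self hx,
    h.form_fderiv_axis hx X (ha.mem i), smul_zero, sub_zero]

theorem isParallelFrameOn (hε : ε = 1 ∨ ε = -1) :
    IsParallelFrameOn ε n V g (frameField ε n g a) := by
  refine ⟨h.contDiffOn_frameField ha, fun x hx => ⟨h.frameField_mem_normalSpace ha hε hx,
    ha.orthonormal x hx, fun i X => ?_⟩⟩
  rw [normalDeriv, normalSpace, (posOff_form hε (h.immersion.2 x hx).1).orthProj_iff]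
  refine ⟨Submodule.zero_mem _, ?_⟩
  rw [sub_zero, h.fderiv_frameField ha hx]
  exact Submodule.smul_mem _ _ (Submodule.mem_sup_left ⟨X, rfl⟩)

/-- The tangential projection annihilates `g`, so `v` may be replaced by its representative in `A`,
where the frame expansion holds. Applied to the position of the immersion, this is the formula of a
partial tube. -/
theorem expand (hε : ε = 1 ∨ ε = -1) {x : EuclideanSpace ℝ (Fin r)} (hx : x ∈ V) {v : Flat n}
    {c : ℝ} (hv : v - c • g x ∈ A) :
    v = (ε * form ε n v (g x)) • g x
      + ∑ i, form ε n v (frameField ε n g a i x) • frameField ε n g a i x := by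
  have h1 : ∀ i, form ε n (v - c • g x) (frameField ε n g a i x)
      = form ε n v (frameField ε n g a i x) := by
    intro i
    rw [map_sub, map_smul, LinearMap.sub_apply, LinearMap.smul_apply, form_comm (g x),
      h.form_frameField_self hε hx, smul_zero, sub_zero]
  have h2 : tangentPart ε n (g x) (v - c • g x) = tangentPart ε n (g x) v := by
    rw [map_sub, map_smul, sub_eq_self, tangentPart_apply (g x) (g x), h.form_self hx,
      sq_eq_one_of_sign hε, one_smul, sub_self, smul_zero]
  have h3 := congrArg (tangentPart ε n (g x)) (ha.expand x hx _ hv)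
  rw [h2, map_sum, tangentPart_apply, sub_eq_iff_eq_add'] at h3
  rw [h3]
  conv_rhs => rw [← h3]
  congr 1
  refine Finset.sum_congr rfl fun i _ => ?_
  rw [map_smul]
  congr 1
  exact h1 i

omit h ha in
/-- The mean curvature vector. -/
def _root_.QxR.frameMean (ε : ℝ) (n : ℕ) (g : EuclideanSpace ℝ (Fin r) → Flat n) (a : Fin k → Flat n)
    (x : EuclideanSpace ℝ (Fin r)) : Flat n :=
  ∑ i, (ε * form ε n (g x) (a i)) • frameField ε n g a i x

theorem frameMean_mem_normalSpace (hε : ε = 1 ∨ ε = -1) {x : EuclideanSpace ℝ (Fin r)}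
    (hx : x ∈ V) : frameMean ε n g a x ∈ normalSpace (form ε n) (g x) g x :=
  Submodule.sum_mem _ fun i _ => Submodule.smul_mem _ _ (h.frameField_mem_normalSpace ha hε hx i)

theorem frameMean_eventuallyEq {x : EuclideanSpace ℝ (Fin r)} (hx : x ∈ V) :
    frameMean ε n g a =ᶠ[𝓝 x]
      fun y => ∑ i, (ε * form ε n (g x) (a i)) • frameField ε n g a i y := by
  filter_upwards [h.isOpen.mem_nhds hx] with y hy
  rw [frameMean]
  refine Finset.sum_congr rfl fun i _ => ?_
  rw [h.const y hy x hx _ (ha.mem i)]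

theorem contDiffOn_frameMean : ContDiffOn ℝ ∞ (frameMean ε n g a) V := by
  intro x hx
  refine ContDiffAt.contDiffWithinAt (ContDiffAt.congr_of_eventuallyEq ?_
    (h.frameMean_eventuallyEq ha hx))
  exact ContDiffAt.sum fun i _ =>
    ((h.contDiffOn_frameField ha i).contDiffAt (h.isOpen.mem_nhds hx)).const_smul _

/-- The factor is minus the squared length of the vector (`form_frameMean_self`), so for unit-speed
curves this is the equation of a geodesic circle. -/
theorem fderiv_frameMean (hε : ε = 1 ∨ ε = -1) {x : EuclideanSpace ℝ (Fin r)} (hx : x ∈ V)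
    (X : EuclideanSpace ℝ (Fin r)) : fderiv ℝ (frameMean ε n g a) x X
      = -(∑ i, form ε n (g x) (a i) ^ 2) • fderiv ℝ g x X := by
  have hd : ∀ i, DifferentiableAt ℝ (frameField ε n g a i) x := fun i =>
    ((h.contDiffOn_frameField ha i).contDiffAt (h.isOpen.mem_nhds hx)).differentiableAt (by simp)
  rw [(h.frameMean_eventuallyEq ha hx).fderiv_eq, fderiv_fun_sum
    (fun i _ => (hd i).fun_const_smul _), _root_.sum_apply, ← Finset.sum_neg_distrib,
    Finset.sum_smul]
  refine Finset.sum_congr rfl fun i _ => ?_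
  rw [fderiv_fun_const_smul (hd i), smul_apply, h.fderiv_frameField ha hx, smul_smul]
  congr 1
  linear_combination (-form ε n (g x) (a i) ^ 2) * sq_eq_one_of_sign hε

omit h in
theorem form_frameMean_self (hε : ε = 1 ∨ ε = -1) {x : EuclideanSpace ℝ (Fin r)} (hx : x ∈ V) :
    form ε n (frameMean ε n g a x) (frameMean ε n g a x) = ∑ i, form ε n (g x) (a i) ^ 2 := by
  rw [frameMean]
  simp only [map_sum, LinearMap.sum_apply, map_smul, LinearMap.smul_apply, smul_eq_mul]
  refine Finset.sum_congr rfl fun i _ => ?_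
  rw [Finset.sum_eq_single i]
  · have h1 : form ε n (frameField ε n g a i x) (frameField ε n g a i x) = 1 := by
      have := ha.orthonormal x hx i i
      rwa [if_pos rfl] at this
    rw [h1]
    linear_combination (form ε n (g x) (a i) ^ 2) * sq_eq_one_of_sign hε
  · intro j _ hji
    have h1 : form ε n (frameField ε n g a j x) (frameField ε n g a i x) = 0 := by
      have := ha.orthonormal x hx j i
      rwa [if_neg hji] at this
    rw [h1]
    ring
  · simp

/-- Pair the expansion of `v - c g` in the frame of `A` with `g`, using `⟨g, v⟩ = 0` and `⟨g, g⟩ =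
ε`. -/
theorem form_frameMean {x : EuclideanSpace ℝ (Fin r)} (hx : x ∈ V) (hε : ε = 1 ∨ ε = -1)
    {v : Flat n} {c : ℝ} (hv : v - c • g x ∈ A) (hvg : form ε n (g x) v = 0) :
    form ε n v (frameMean ε n g a x) = -c := by
  have h1 : ∀ i, form ε n (v - c • g x) (frameField ε n g a i x)
      = form ε n v (frameField ε n g a i x) := by
    intro i
    rw [map_sub, map_smul, LinearMap.sub_apply, LinearMap.smul_apply, form_comm (g x),
      h.form_frameField_self hε hx, smul_zero, sub_zero]
  have h3 : ∀ i, form ε n (v - c • g x) (tangentPart ε n (g x) (a i))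
      = form ε n v (frameField ε n g a i x) := h1
  have h2 := ha.expand x hx _ hv
  simp only [h3] at h2
  replace h2 := congrArg (form ε n (g x)) h2
  simp only [map_sum, map_smul, smul_eq_mul, map_sub, hvg, h.form_self hx, zero_sub] at h2
  rw [frameMean]
  simp only [map_sum, map_smul, smul_eq_mul]
  have h4 : ∑ i, ε * form ε n (g x) (a i) * form ε n v (frameField ε n g a i x)
      = ε * ∑ i, form ε n v (frameField ε n g a i x) * form ε n (g x) (a i) := by
    rw [Finset.mul_sum]
    exact Finset.sum_congr rfl fun i _ => by ring
  rw [h4, ← h2]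
  linear_combination (-c) * sq_eq_one_of_sign hε

omit ha in
-- The second derivative is orthogonal to `A`, and its product with `g` is `-⟨X, Y⟩` because `g`
-- stays in the quadric.
theorem form_normal_snd_fderiv {x : EuclideanSpace ℝ (Fin r)} (hx : x ∈ V) {v : Flat n} {c : ℝ}
    (hv : v - c • g x ∈ A) (X Y : EuclideanSpace ℝ (Fin r)) :
    form ε n v (fderiv ℝ (fderiv ℝ g) x X Y)
      = -c * form ε n (fderiv ℝ g x X) (fderiv ℝ g x Y) := by
  have h1 := h.form_snd_fderiv_axis hx X Y hv
  rw [map_sub, map_smul, bilin_snd_fderiv_self form_comm (h.contDiffAt hx)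
    (h.eventually_form_self hx), smul_eq_mul] at h1
  rw [form_comm]
  linarith

/-- Test against normal vectors `v`: each one is in `A + ℝ g`, and its coefficient `c` along `g`
determines the product with the second derivative and with `frameMean` alike. -/
theorem snd_fderiv_sub_mem (hε : ε = 1 ∨ ε = -1) {x : EuclideanSpace ℝ (Fin r)} (hx : x ∈ V)
    (X Y : EuclideanSpace ℝ (Fin r)) :
    fderiv ℝ (fderiv ℝ g) x X Y
      - form ε n (fderiv ℝ g x X) (fderiv ℝ g x Y) • frameMean ε n g a x
        ∈ tangentSpan g x ⊔ Submodule.span ℝ {g x} := by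
  have hp := posOff_form hε (h.immersion.2 x hx).1
  rw [← hp.orthogonal_orthogonal (tangentSpan g x ⊔ Submodule.span ℝ {g x})]
  intro v hv
  obtain ⟨hv1, hv2⟩ := mem_normalSpace_iff.1 hv
  obtain ⟨c, hc⟩ := h.exists_sub_smul_mem hε hx hv1
  show form ε n v _ = 0
  rw [map_sub, map_smul, h.form_normal_snd_fderiv hx hc, h.form_frameMean ha hx hε hc hv2,
    smul_eq_mul]
  ring

theorem sff_eq (hε : ε = 1 ∨ ε = -1) {x : EuclideanSpace ℝ (Fin r)} (hx : x ∈ V)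
    (X Y : EuclideanSpace ℝ (Fin r)) : sff (form ε n) (g x) g x X Y
      = form ε n (fderiv ℝ g x X) (fderiv ℝ g x Y) • frameMean ε n g a x := by
  rw [sff, normalSpace, (posOff_form hε (h.immersion.2 x hx).1).orthProj_iff]
  exact ⟨Submodule.smul_mem _ _ (h.frameMean_mem_normalSpace ha hε hx),
    h.snd_fderiv_sub_mem ha hε hx X Y⟩

theorem isUmbilicalOn (hε : ε = 1 ∨ ε = -1) : IsUmbilicalOn ε n V g :=
  ⟨frameMean ε n g a, h.contDiffOn_frameMean ha, fun _ hx =>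
    ⟨h.frameMean_mem_normalSpace ha hε hx, h.sff_eq ha hε hx⟩⟩

omit ha in
theorem isTotallyGeodesicOn (hε : ε = 1 ∨ ε = -1)
    (h0 : ∀ x ∈ V, ∀ a ∈ A, form ε n (g x) a = 0) : IsTotallyGeodesicOn ε n V g := by
  intro x hx X Y
  obtain ⟨a, ha1, ha2, ha3⟩ := h.exists_frame hε hx
  have ha : IsAxisFrame ε n A V g a := ⟨ha1, ha2, ha3⟩
  rw [h.sff_eq ha hε hx, frameMean]
  simp [h0 x hx _ (ha1 _)]

omit h ha in
theorem _root_.QxR.IsRoundOn.isGeodesicCircleOn (hε : ε = 1 ∨ ε = -1)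
    {V : Set (EuclideanSpace ℝ (Fin 1))} {g : EuclideanSpace ℝ (Fin 1) → Flat n}
    (h : IsRoundOn ε n A V g) (ha : IsAxisFrame ε n A V g a)
    (hunit : ∀ x ∈ V, form ε n (fderiv ℝ g x (diag 1 1)) (fderiv ℝ g x (diag 1 1)) = 1) :
    IsGeodesicCircleOn ε n {t | diag 1 t ∈ V} fun t => g (diag 1 t) := by
  have hJ : IsOpen {t | diag 1 t ∈ V} := h.isOpen.preimage contDiff_diag.continuous
  set γ : ℝ → Flat n := fun t => g (diag 1 t) with hγ
  set d := diag 1 1 with hd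
  have hγ' : ∀ t, diag 1 t ∈ V → deriv γ t = fderiv ℝ g (diag 1 t) d := fun t ht =>
    (hasDerivAt_comp_diag (h.differentiableAt ht)).deriv
  have hcov : ∀ t, diag 1 t ∈ V → covDeriv ε n γ (deriv γ) t = frameMean ε n g a (diag 1 t) := by
    intro t ht
    refine h.immersion.covDeriv_deriv hε h.isOpen hunit ht (h.frameMean_mem_normalSpace ha hε ht) ?_
    have hm := h.snd_fderiv_sub_mem ha hε ht d d
    rwa [hunit _ ht, one_smul] at hm
  intro t ht
  have ht : diag 1 t ∈ V := ht
  refine ⟨by rw [hγ' t ht]; exact hunit _ ht, ?_⟩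
  have h1 : covDeriv ε n γ (deriv γ) =ᶠ[𝓝 t] fun t => frameMean ε n g a (diag 1 t) := by
    filter_upwards [hJ.mem_nhds ht] with u hu using hcov u hu
  have h2 : deriv (covDeriv ε n γ (deriv γ)) t
      = -(∑ i, form ε n (g (diag 1 t)) (a i) ^ 2) • deriv γ t := by
    rw [h1.deriv_eq, (hasDerivAt_comp_diag (((h.contDiffOn_frameMean ha).contDiffAt
      (h.isOpen.mem_nhds ht)).differentiableAt (by simp))).deriv, h.fderiv_frameMean ha hε ht, hγ' t ht]
  rw [hcov t ht, form_frameMean_self ha hε ht, covDeriv, h2, hγ' t ht]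
  simp only [map_smul, LinearMap.smul_apply, hγ, h.form_fderiv_self ht]
  simp

end IsRoundOn

/-! ### Axial immersions are partial tubes -/

namespace IsAdapted

variable {ε : ℝ} {n r : ℕ} {A : Submodule ℝ (Flat n)} {V : Set (EuclideanSpace ℝ (Fin r))}
  {I : Set ℝ} {e : Flat n} {G : EuclideanSpace ℝ (Fin r) × ℝ → FlatR n}

/-- The immersion `l (G(·, s₀) + b)`, a homothetic copy of a leaf translated along the axis. -/
def base (G : EuclideanSpace ℝ (Fin r) × ℝ → FlatR n) (l : ℝ) (b : Flat n) (s₀ : ℝ)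
    (x : EuclideanSpace ℝ (Fin r)) : Flat n :=
  l • ((G (x, s₀)).1 + b)

variable (h : IsAdapted ε A V I e G) {l : ℝ} {b : Flat n} {s₀ : ℝ}
include h

theorem contDiffOn_base (hs₀ : s₀ ∈ I) : ContDiffOn ℝ ∞ (base G l b s₀) V :=
  ((h.contDiffOn_leaf hs₀).add contDiffOn_const).const_smul l

theorem differentiableAt_base (hs₀ : s₀ ∈ I) {x : EuclideanSpace ℝ (Fin r)} (hx : x ∈ V) :
    DifferentiableAt ℝ (base G l b s₀) x :=
  ((h.contDiffOn_base hs₀).contDiffAt (h.isOpen_left.mem_nhds hx)).differentiableAt (by simp)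

theorem fderiv_base (hs₀ : s₀ ∈ I) {x : EuclideanSpace ℝ (Fin r)} (hx : x ∈ V)
    (X : EuclideanSpace ℝ (Fin r)) : fderiv ℝ (base G l b s₀) x X = l • leafDeriv G x s₀ X := by
  have hd := h.differentiableAt_leaf hx hs₀
  rw [← h.fderiv_leaf hx hs₀]
  have : base G l b s₀ = fun y => l • ((G (y, s₀)).1 + b) := rfl
  rw [this, fderiv_fun_const_smul (hd.add_const b), fderiv_add_const]
  rfl

theorem form_base_axis (hs₀ : s₀ ∈ I) {x y : EuclideanSpace ℝ (Fin r)} (hx : x ∈ V) (hy : y ∈ V)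
    {a : Flat n} (ha : a ∈ A) :
    form ε n (base G l b s₀ x) a = form ε n (base G l b s₀ y) a := by
  simp only [base, map_smul, map_add, LinearMap.smul_apply, LinearMap.add_apply,
    h.form_axis_eq ha hx hy hs₀]

/-- The square of `base` involves only `⟨G, G⟩`, `⟨G, b⟩` and `⟨b, b⟩`, all constant along the leaf.
So the map stays in the quadric as soon as one of its points is there. -/
theorem isRoundOn_base (hs₀ : s₀ ∈ I) {x₀ : EuclideanSpace ℝ (Fin r)} (hx₀ : x₀ ∈ V)
    (hl : l ≠ 0) (hb : b ∈ A) (hq : base G l b s₀ x₀ ∈ quadric ε n) :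
    IsRoundOn ε n A V (base G l b s₀) where
  isOpen := h.isOpen_left
  immersion := by
    refine ⟨h.contDiffOn_base hs₀, fun x hx => ⟨?_, ?_⟩⟩
    · have hw := h.axial.mem (x, s₀) ⟨hx, hs₀⟩
      have hw₀ := h.axial.mem (x₀, s₀) ⟨hx₀, hs₀⟩
      have hxb := h.form_axis_eq hb hx hx₀ hs₀
      have hself : form ε n (base G l b s₀ x) (base G l b s₀ x) = ε := by
        refine Eq.trans ?_ hq.1
        simp only [base, map_smul, map_add, LinearMap.smul_apply, LinearMap.add_apply, hw.1, hw₀.1,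
          form_comm b, hxb]
      refine ⟨hself, ?_⟩
      -- The product of `base` with the position on the leaf is also constant, which keeps the map
      -- on the upper sheet.
      rintro rfl
      have h1 := form_neg_of_mem_hyperbolic hq.1 (hq.2 rfl) hw₀
      refine pos_of_form_neg hself hw ?_
      convert h1 using 1
      simp only [base, map_smul, map_add, LinearMap.smul_apply, LinearMap.add_apply, hw.1, hw₀.1,
        form_comm b, hxb]
    · rw [injective_iff_map_eq_zero]
      intro X hX
      rw [h.fderiv_base hs₀ hx] at hX
      exact (injective_iff_map_eq_zero _).1 (h.leafDeriv_injective hx hs₀) X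
        ((smul_eq_zero.1 hX).resolve_left hl)
  const x hx y hy a ha := h.form_base_axis hs₀ hx hy ha
  notMem x hx hmem := by
    rw [base, Submodule.smul_mem_iff _ hl, Submodule.add_mem_iff_left _ hb] at hmem
    exact h.notMem_axis hx hs₀ hmem
  finrank := by
    have := h.axial.finrank
    simp only [Module.finrank_prod, finrank_euclideanSpace, Fintype.card_fin,
      Module.finrank_self] at this
    omega

theorem form_leafDeriv_base (hs₀ : s₀ ∈ I) {x : EuclideanSpace ℝ (Fin r)} (hx : x ∈ V) {s : ℝ}
    (hs : s ∈ I) (hb : b ∈ A) (X : EuclideanSpace ℝ (Fin r)) :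
    form ε n (leafDeriv G x s X) (base G l b s₀ x) = 0 := by
  rw [base, map_smul, map_add, h.form_leafDeriv hx hs hs₀, form_comm _ b,
    show form ε n b (leafDeriv G x s X) = 0 from h.leafDeriv_mem hx hs X b hb, add_zero, smul_zero]

/-- The tangent spaces of the leaves at all heights, and of the base, are orthogonal to all
positions over the same `x`. So both terms of the derivative of the product vanish, and the first
coordinate of the tube depends on `s` alone. -/
theorem form_base_eq (hs₀ : s₀ ∈ I) {x y : EuclideanSpace ℝ (Fin r)} (hx : x ∈ V) (hy : y ∈ V)
    {s : ℝ} (hs : s ∈ I) (hb : b ∈ A) :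
    form ε n (G (x, s)).1 (base G l b s₀ x) = form ε n (G (y, s)).1 (base G l b s₀ y) := by
  refine eq_of_fderiv_eq_zero_on_convex (u := fun x => form ε n (G (x, s)).1 (base G l b s₀ x))
    h.isOpen_left h.convex_left (fun z hz => ?_) (fun z hz X => ?_) hx hy
  · exact (contDiffAt_bilin _ ((h.contDiffOn_leaf hs).contDiffAt (h.isOpen_left.mem_nhds hz))
      ((h.contDiffOn_base hs₀).contDiffAt (h.isOpen_left.mem_nhds hz))).differentiableAt (by simp)
  · rw [fderiv_bilin_apply _ (h.differentiableAt_leaf hz hs) (h.differentiableAt_base hs₀ hz),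
      h.fderiv_leaf hz hs, h.fderiv_base hs₀ hz, h.form_leafDeriv_base hs₀ hz hs hb, map_smul,
      form_comm _ (leafDeriv G z s₀ X), h.form_leafDeriv hz hs₀ hs, smul_zero, add_zero]

theorem sub_smul_base_mem (hε : ε = 1 ∨ ε = -1) (hs₀ : s₀ ∈ I) {x : EuclideanSpace ℝ (Fin r)}
    (hx : x ∈ V) {s : ℝ} (hs : s ∈ I) (hl : l ≠ 0) (hb : b ∈ A) :
    ∃ c : ℝ, (G (x, s)).1 - c • base G l b s₀ x ∈ A := by
  have h1 := h.sub_smul_mem hε hx hs hs₀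
  set β := form ε n (G (x, s)).1 e / form ε n (G (x, s₀)).1 e
  refine ⟨β / l, ?_⟩
  have : (G (x, s)).1 - (β / l) • base G l b s₀ x = (G (x, s)).1 - β • (G (x, s₀)).1 - β • b := by
    rw [base, smul_smul, div_mul_cancel₀ _ hl, smul_add]
    abel
  rw [this]
  exact Submodule.sub_mem _ h1 (Submodule.smul_mem _ _ hb)

omit h in
/-- The coordinates of the profile curve. -/
def profile (ε : ℝ) (G : EuclideanSpace ℝ (Fin r) × ℝ → FlatR n)
    (g : EuclideanSpace ℝ (Fin r) → Flat n) {k : ℕ} (a : Fin k → Flat n)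
    (x : EuclideanSpace ℝ (Fin r)) (s : ℝ) : Flat k :=
  Fin.cons (ε * form ε n (G (x, s)).1 (g x))
    fun i => form ε n (G (x, s)).1 (frameField ε n g a i x)

variable {k : ℕ} {a : Fin k → Flat n}

theorem profile_eq (hs₀ : s₀ ∈ I) (ha : IsAxisFrame ε n A V (base G l b s₀) a)
    {x y : EuclideanSpace ℝ (Fin r)} (hx : x ∈ V) (hy : y ∈ V) {s : ℝ} (hs : s ∈ I) (hb : b ∈ A) :
    profile ε G (base G l b s₀) a x s = profile ε G (base G l b s₀) a y s := by
  rw [profile, profile, h.form_base_eq hs₀ hx hy hs hb]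
  congr 1
  funext i
  rw [frameField, frameField, tangentPart_apply, tangentPart_apply, map_sub, map_sub, map_smul,
    map_smul, h.form_base_eq hs₀ hx hy hs hb, h.form_axis_eq (ha.mem i) hx hy hs, form_comm (a i),
    form_comm (a i), h.form_base_axis hs₀ hx hy (ha.mem i)]

theorem contDiffOn_profile {x : EuclideanSpace ℝ (Fin r)} (hx : x ∈ V)
    {g : EuclideanSpace ℝ (Fin r) → Flat n} : ContDiffOn ℝ ∞ (profile ε G g a x) I := by
  intro s hs
  have h1 : ContDiffAt ℝ ∞ (fun s => (G (x, s)).1) s :=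
    ((h.axial.contDiffAt (x := (x, s)) ⟨hx, hs⟩).comp s (contDiffAt_const.prodMk contDiffAt_id)).fst
  refine ContDiffAt.contDiffWithinAt (contDiffAt_pi.2 fun i => ?_)
  refine Fin.cases ?_ (fun i => ?_) i
  · exact contDiffAt_const.mul (contDiffAt_bilin _ h1 contDiffAt_const)
  · exact contDiffAt_bilin _ h1 contDiffAt_const

/-- The equation of the quadric is the expansion of the position paired with the position itself.
For `ε = -1` the first coordinate is minus the product of two points of `ℍⁿ`, hence positive. -/
theorem profile_mem (hε : ε = 1 ∨ ε = -1) (hs₀ : s₀ ∈ I) (hr : IsRoundOn ε n A V (base G l b s₀))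
    (ha : IsAxisFrame ε n A V (base G l b s₀) a) {x : EuclideanSpace ℝ (Fin r)} (hx : x ∈ V)
    {s : ℝ} (hs : s ∈ I) (hl : l ≠ 0) (hb : b ∈ A) :
    profile ε G (base G l b s₀) a x s ∈ quadric ε k := by
  have hw := h.axial.mem (x, s) ⟨hx, hs⟩
  constructor
  · obtain ⟨c, hc⟩ := h.sub_smul_base_mem hε hs₀ hx hs hl hb
    have h1 := congrArg (form ε n (G (x, s)).1) (hr.expand ha hε hx hc)
    simp only [map_add, map_sum, map_smul, smul_eq_mul] at h1
    rw [hw.1] at h1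
    conv_rhs => rw [h1]
    rw [form_apply]
    simp only [profile, Fin.cons_zero, Fin.cons_succ]
    congr 1
    linear_combination ε * form ε n (G (x, s)).1 (base G l b s₀ x) ^ 2 * sq_eq_one_of_sign hε
  · rintro rfl
    have := form_neg_of_mem_hyperbolic hw.1 (hw.2 rfl) (hr.immersion.2 x hx).1
    simp only [profile, Fin.cons_zero]
    linarith

/-- The squared speed `l⁻²` of the leaf compensates the homothety of ratio `l`. -/
theorem isGeodesicCircleOn_base (hε : ε = 1 ∨ ε = -1) (hs₀ : s₀ ∈ I)
    (hr : IsRoundOn ε n A V (base G l b s₀)) (ha : IsAxisFrame ε n A V (base G l b s₀) a)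
    (hl : l ≠ 0)
    (hspeed : r = 1 → ∀ x ∈ V,
      form ε n (leafDeriv G x s₀ (diag r 1)) (leafDeriv G x s₀ (diag r 1)) = (l ^ 2)⁻¹) :
    IsUmbilicalOrCircleOn ε n r V (base G l b s₀) := by
  refine ⟨hr.isUmbilicalOn ha hε, ?_⟩
  rintro rfl
  refine hr.isGeodesicCircleOn hε ha fun x hx => ?_
  rw [h.fderiv_base hs₀ hx, map_smul, map_smul, LinearMap.smul_apply, hspeed rfl x hx]
  simp only [smul_eq_mul]
  field_simp

end IsAdapted

section Tube

variable {ε : ℝ} {n m : ℕ} {M : Type*} [TopologicalSpace M]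
  [ChartedSpace (EuclideanSpace ℝ (Fin m)) M] [IsManifold (𝓡 m) ∞ M] {f : M → FlatR n}

/-- An axial immersion is a partial tube over the homothetic copies of its leaves in the quadric. -/
theorem IsLocallyAxial.isLocallyPartialTube (hε : ε = 1 ∨ ε = -1) (hm : 2 ≤ m)
    (hf : QxR.IsImmersion m ε f) (hT : ∀ p, pushT m ε f p ≠ 0)
    {C' : Submodule ℝ (Flat n) → Prop}
    {C : Set (EuclideanSpace ℝ (Fin (m - 1))) → (EuclideanSpace ℝ (Fin (m - 1)) → Flat n) → Prop}
    (h : IsLocallyAxial m ε f C')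
    (hC : ∀ A, C' A → finrank ℝ A + m = n + 1 → ∀ y ∈ quadric ε n, y ∉ A →
      ∃ (l : ℝ) (b : Flat n), l ≠ 0 ∧ b ∈ A ∧ l • (y + b) ∈ quadric ε n ∧
        ∀ V g, IsRoundOn ε n A V g → IsUmbilicalOrCircleOn ε n (m - 1) V g →
          (∀ x ∈ V, ∀ a ∈ A, form ε n (g x) a = form ε n (l • (y + b)) a) → C V g) :
    IsLocallyPartialTube m ε f C := by
  intro p
  obtain ⟨U, A, hU, hp, hA, hCA, hax⟩ := h p
  -- A preliminary parametrization shows that the position is not in `A`. This is needed to choose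
  -- `l`, on which the speed in the final parametrization depends.
  have hpA : (f p).1 ∉ A := by
    obtain ⟨ψ, V, I, x₀, s₀, e, hsrc, hx₀, hs₀, hψp, hψs, hψs', had⟩ :=
      exists_adapted_param hε hm hf hT hA hU hp hax
    have := had.notMem_axis hx₀ hs₀
    rwa [Function.comp_apply, hψp] at this
  obtain ⟨l, b, hl, hb, hq, hCb⟩ := hC A hCA hA _ (hf.2 p).1 hpA
  obtain ⟨ψ, V, I, x₀, s₀, e, hsrc, hx₀, hs₀, hψp, hψs, hψs', had, hspeed⟩ :=
    exists_adapted_param_speed hε hm hf hT hA hU hp hax (c := (l ^ 2)⁻¹) (by positivity)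
  have hG₀ : IsAdapted.base (f ∘ ψ) l b s₀ x₀ = l • ((f p).1 + b) := by
    rw [IsAdapted.base, Function.comp_apply, hψp]
  have hr := had.isRoundOn_base hs₀ hx₀ hl hb (by rwa [hG₀])
  obtain ⟨a, ha1, ha2, ha3⟩ := hr.exists_frame hε hx₀
  have ha : IsAxisFrame ε n A V (IsAdapted.base (f ∘ ψ) l b s₀) a := ⟨ha1, ha2, ha3⟩
  refine ⟨V, I, ψ, IsAdapted.base (f ∘ ψ) l b s₀, finrank ℝ A, frameField ε n _ a,
    fun s => (IsAdapted.profile ε (f ∘ ψ) (IsAdapted.base (f ∘ ψ) l b s₀) a x₀ s, s),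
    had.isOpen_left, had.isOpen_right, had.ordConnected_right, hsrc, ?_, hψs, hψs', hr.immersion,
    ?_, hr.isParallelFrameOn ha hε, (had.contDiffOn_profile hx₀).prodMk contDiffOn_id,
    fun s hs => ⟨had.profile_mem hε hs₀ hr ha hx₀ hs hl hb, by simp⟩, fun x hx s hs => ?_⟩
  · rw [← hψp]
    exact ψ.map_source (by rw [hsrc]; exact ⟨hx₀, hs₀⟩)
  · refine hCb _ _ hr (had.isGeodesicCircleOn_base hε hs₀ hr ha hl hspeed) fun x hx a ha => ?_
    rw [had.form_base_axis hs₀ hx hx₀ ha, hG₀]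
  · obtain ⟨c, hc⟩ := had.sub_smul_base_mem hε hs₀ hx hs hl hb
    refine Prod.ext ?_ (had.height x hx s hs)
    show ((f ∘ ψ) (x, s)).1 = _
    dsimp only
    rw [← had.profile_eq hs₀ ha hx hx₀ hs hb]
    exact hr.expand ha hε hx hc

end Tube

/-! ### Points of the quadric in given position with respect to the axis -/

section Position

variable {ε : ℝ} {n : ℕ} {A : Submodule ℝ (Flat n)}

/-- Split `y = a + u` along `A ⊕ A^⊥`, take `b = -a`, and normalize `u`. The sign `ε⟨u, u⟩ > 0`
holds for `ε = 1` by definiteness, and for `ε = -1` because `⟨u, u⟩ = -1 - ⟨a, a⟩`. A base through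
this point is orthogonal to `A`, hence totally geodesic. -/
theorem exists_smul_add_orthogonal (hε : ε = 1 ∨ ε = -1)
    (hA : ∀ a ∈ A, a ≠ 0 → 0 < form ε n a a) {y : Flat n} (hy : y ∈ quadric ε n) (hyA : y ∉ A) :
    ∃ (l : ℝ) (b : Flat n), 0 < l ∧ b ∈ A ∧ l • (y + b) ∈ quadric ε n ∧
      ∀ a ∈ A, form ε n (l • (y + b)) a = 0 := by
  obtain ⟨a, ha, u, hu, rfl⟩ := Submodule.mem_sup.1
    (show y ∈ A ⊔ (form ε n).orthogonal A by
      rw [(isCompl_orthogonal_of_pos form_comm hA).sup_eq_top]; trivial)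
  have hau : form ε n a u = 0 := hu a ha
  have hself : form ε n a a + form ε n u u = ε := by
    refine Eq.trans ?_ hy.1
    simp only [map_add, LinearMap.add_apply, form_comm u a, hau]
    ring
  have hpos : 0 < ε * form ε n u u := by
    rcases hε with rfl | rfl
    · rw [one_mul]
      refine form_self_pos_of_one ?_
      rintro rfl
      exact hyA (by simpa using ha)
    · have : 0 ≤ form (-1) n a a := by
        by_cases h0 : a = 0
        · simp [h0]
        · exact (hA a ha h0).le
      linarith
  set l := (Real.sqrt (ε * form ε n u u))⁻¹ with hl
  have hl0 : 0 < l := inv_pos.2 (Real.sqrt_pos.2 hpos)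
  have hl2 : l * l * (ε * form ε n u u) = 1 := by
    rw [hl, ← mul_inv, Real.mul_self_sqrt hpos.le, inv_mul_cancel₀ hpos.ne']
  have hu1 : a + u + -a = u := by abel
  have hlu : form ε n (l • u) (l • u) = ε := by
    simp only [map_smul, LinearMap.smul_apply, smul_eq_mul]
    linear_combination ε * hl2 - l * l * form ε n u u * sq_eq_one_of_sign hε
  refine ⟨l, -a, hl0, Submodule.neg_mem _ ha, ?_, fun c hc => ?_⟩
  · rw [hu1]
    refine ⟨hlu, ?_⟩
    rintro rfl
    refine pos_of_form_neg hlu hy ?_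
    rw [map_smul, LinearMap.smul_apply, map_add, form_comm u a, hau, zero_add, smul_eq_mul]
    exact mul_neg_of_pos_of_neg hl0 (by linarith)
  · rw [hu1, map_smul, LinearMap.smul_apply, form_comm u c, show form ε n c u = 0 from hu c hc,
      smul_zero]

/-- Start from the point `g` orthogonal to `A` and move along the geodesic in the direction of a
unit vector `b₁ ∈ A` to `cosh d • g + sinh d • b₁`. Its products with `A` are those of `sinh d •
b₁`. -/
theorem exists_smul_add_equidistant (hA : ∀ a ∈ A, a ≠ 0 → 0 < form (-1) n a a)
    (hA0 : A ≠ ⊥) {y : Flat n} (hy : y ∈ quadric (-1) n) (hyA : y ∉ A) (d : ℝ) :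
    ∃ (l : ℝ) (b b₁ : Flat n), l ≠ 0 ∧ b ∈ A ∧ l • (y + b) ∈ quadric (-1) n ∧
      b₁ ∈ A ∧ form (-1) n b₁ b₁ = 1 ∧
      (∀ a ∈ A, form (-1) n (l • (y + b)) a = Real.sinh d * form (-1) n b₁ a) ∧
      (((form (-1) n).orthogonal A : Set (Flat n)) ∩ quadric (-1) n).Nonempty := by
  obtain ⟨l, b, hl, hb, hq, horth⟩ := exists_smul_add_orthogonal (Or.inr rfl) hA hy hyA
  obtain ⟨b₀, hb₀, hb₀0⟩ := Submodule.exists_mem_ne_zero_of_ne_bot hA0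
  have hpos := hA b₀ hb₀ hb₀0
  set b₁ := (Real.sqrt (form (-1) n b₀ b₀))⁻¹ • b₀ with hb₁
  have hb₁A : b₁ ∈ A := Submodule.smul_mem _ _ hb₀
  have hb₁1 : form (-1) n b₁ b₁ = 1 := by
    simp only [hb₁, map_smul, LinearMap.smul_apply, smul_eq_mul]
    rw [← mul_assoc, ← mul_inv, Real.mul_self_sqrt hpos.le, inv_mul_cancel₀ hpos.ne']
  have hch := Real.cosh_pos d
  set g := l • (y + b) with hg
  have heq : (Real.cosh d * l) • (y + (b + (Real.sinh d / (Real.cosh d * l)) • b₁))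
      = Real.cosh d • g + Real.sinh d • b₁ := by
    rw [hg, ← add_assoc, smul_add, smul_smul, mul_div_cancel₀ _ (mul_pos hch hl).ne', mul_smul]
  have hself : form (-1) n (Real.cosh d • g + Real.sinh d • b₁)
      (Real.cosh d • g + Real.sinh d • b₁) = -1 := by
    simp only [map_add, map_smul, LinearMap.add_apply, LinearMap.smul_apply, smul_eq_mul, hq.1,
      hb₁1, form_comm b₁ g, horth b₁ hb₁A]
    linear_combination -Real.cosh_sq d
  refine ⟨Real.cosh d * l, b + (Real.sinh d / (Real.cosh d * l)) • b₁, b₁, (mul_pos hch hl).ne',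
    Submodule.add_mem _ hb (Submodule.smul_mem _ _ hb₁A), ?_, hb₁A, hb₁1, fun a ha => ?_,
    ⟨g, fun a ha => ?_, hq⟩⟩
  · rw [heq]
    refine ⟨hself, fun _ => pos_of_form_neg hself hq ?_⟩
    simp only [map_add, map_smul, LinearMap.add_apply, LinearMap.smul_apply, smul_eq_mul, hq.1,
      form_comm b₁ g, horth b₁ hb₁A]
    linarith
  · rw [heq]
    simp only [map_add, map_smul, LinearMap.add_apply, LinearMap.smul_apply, smul_eq_mul,
      horth a ha, mul_zero, zero_add]
  · show form (-1) n a g = 0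
    rw [form_comm, horth a ha]

/-- Write `g = cosh d • v + sinh d • b` with `v` in `A^⊥ ∩ ℍⁿ`. For `z` in this set `-⟨g, z⟩ = cosh
d * (-⟨v, z⟩) ≥ cosh d`, with equality at `z = v`, the foot of the perpendicular. -/
theorem isEquidistantOn_of_form {r : ℕ} {V : Set (EuclideanSpace ℝ (Fin r))}
    {g : EuclideanSpace ℝ (Fin r) → Flat n} (hdim : finrank ℝ A + r = n) {d : ℝ} (hd : 0 < d)
    (hg : ∀ x ∈ V, g x ∈ quadric (-1) n) {b : Flat n} (hb : b ∈ A) (hb1 : form (-1) n b b = 1)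
    (hform : ∀ x ∈ V, ∀ a ∈ A, form (-1) n (g x) a = Real.sinh d * form (-1) n b a)
    (hne : (((form (-1) n).orthogonal A : Set (Flat n)) ∩ quadric (-1) n).Nonempty) :
    IsEquidistantOn n r V g := by
  have hfr : finrank ℝ ((form (-1) n).orthogonal A) = r + 1 := by
    have := (posOff_form (Or.inr rfl) hne.choose_spec.2).finrank_orthogonal A
    simp only [Module.finrank_fin_fun] at this
    omega
  have hbS : b ∉ (form (-1) n).orthogonal A := fun h => by
    have h1 : form (-1) n b b = 0 := h b hb
    rw [hb1] at h1
    exact one_ne_zero h1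
  refine ⟨(form (-1) n).orthogonal A, (form (-1) n).orthogonal A ⊔ Submodule.span ℝ {b},
    le_sup_left, hfr, by rw [Submodule.finrank_sup_span_singleton hbS, hfr], hne, d, hd,
    fun x hx => ?_⟩
  set u := g x - Real.sinh d • b with hu
  have huA : ∀ a ∈ A, form (-1) n a u = 0 := fun a ha => by
    rw [hu, map_sub, map_smul, form_comm a, hform x hx a ha, form_comm a b, smul_eq_mul, sub_self]
  have hgu : g x = u + Real.sinh d • b := by rw [hu]; abel
  have hch := Real.cosh_pos d
  have hgz : ∀ z, (∀ a ∈ A, form (-1) n a z = 0) → form (-1) n (g x) z = form (-1) n u z := by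
    intro z hz
    rw [hgu]
    simp [hz b hb]
  have huu : form (-1) n u u = -Real.cosh d ^ 2 := by
    rw [← hgz u huA, hu, map_sub, map_smul, (hg x hx).1, hform x hx b hb, hb1, Real.cosh_sq,
      smul_eq_mul]
    ring
  obtain ⟨v, hv⟩ : ∃ v, v = (Real.cosh d)⁻¹ • u := ⟨_, rfl⟩
  have hvA : ∀ a ∈ A, form (-1) n a v = 0 := fun a ha => by
    rw [hv, map_smul, huA a ha, smul_zero]
  have huv : u = Real.cosh d • v := by rw [hv, smul_smul, mul_inv_cancel₀ hch.ne', one_smul]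
  have hvv : form (-1) n v v = -1 := by
    rw [hv]
    simp only [map_smul, LinearMap.smul_apply, huu, smul_eq_mul]
    field_simp
  have hgv : form (-1) n (g x) v = -Real.cosh d := by
    rw [hgz v hvA, huv, map_smul, LinearMap.smul_apply, hvv, smul_eq_mul, mul_neg_one]
  have hvq : v ∈ quadric (-1) n :=
    ⟨hvv, fun _ => pos_of_form_neg hvv (hg x hx) (by rw [form_comm, hgv]; linarith)⟩
  refine ⟨?_, IsLeast.isGLB ⟨⟨v, ⟨hvA, hvq⟩, ?_⟩, ?_⟩⟩
  · rw [hgu]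
    exact Submodule.add_mem_sup huA (Submodule.smul_mem _ _ (Submodule.mem_span_singleton_self _))
  · rw [hypDist, hgv, neg_neg, Real.arcosh_cosh hd.le]
  · rintro _ ⟨z, ⟨hzA, hzq⟩, rfl⟩
    have h1 := form_le_neg_one hvq hzq
    have h2 : Real.cosh d ≤ -form (-1) n (g x) z := by
      rw [hgz z hzA, huv, map_smul, LinearMap.smul_apply, smul_eq_mul]
      nlinarith
    rw [hypDist, ← Real.arcosh_cosh hd.le]
    exact (Real.arcosh_le_arcosh hch (hch.trans_le h2)).2 h2

end Position

/-! ### The three kinds of bases -/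

section Tube

variable {ε : ℝ} {n m : ℕ} {M : Type*} [TopologicalSpace M]
  [ChartedSpace (EuclideanSpace ℝ (Fin m)) M] [IsManifold (𝓡 m) ∞ M] {f : M → FlatR n}

theorem IsLocallyAxial.isLocallyPartialTube_umbilical (hε : ε = 1 ∨ ε = -1) (hm : 2 ≤ m)
    (hf : QxR.IsImmersion m ε f) (hT : ∀ p, pushT m ε f p ≠ 0)
    (h : IsLocallyAxial m ε f fun _ => True) :
    IsLocallyPartialTube m ε f (IsUmbilicalOrCircleOn ε n (m - 1)) :=
  h.isLocallyPartialTube hε hm hf hT fun A _ _ y hy _ =>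
    -- No translation or scaling is required: the leaf itself is the base.
    ⟨1, 0, one_ne_zero, A.zero_mem, by simpa using hy, fun _ _ _ hu _ => hu⟩

theorem IsLocallyAxial.isLocallyPartialTube_totallyGeodesic (hε : ε = 1 ∨ ε = -1) (hm : 2 ≤ m)
    (hf : QxR.IsImmersion m ε f) (hT : ∀ p, pushT m ε f p ≠ 0)
    (h : IsLocallyAxial m ε f fun A => ∀ a ∈ A, a ≠ 0 → 0 < form ε n a a) :
    IsLocallyPartialTube m ε f (IsTotallyGeodesicOn ε n) := by
  refine h.isLocallyPartialTube hε hm hf hT fun A hA _ y hy hyA => ?_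
  obtain ⟨l, b, hl, hb, hq, horth⟩ := exists_smul_add_orthogonal hε hA hy hyA
  exact ⟨l, b, hl.ne', hb, hq, fun V g hr _ hg =>
    hr.isTotallyGeodesicOn hε fun x hx a ha => (hg x hx a ha).trans (horth a ha)⟩

theorem IsLocallyAxial.isLocallyPartialTube_equidistant (hm : 2 ≤ m) (hmn : m ≤ n)
    (hf : QxR.IsImmersion m (-1) f) (hT : ∀ p, pushT m (-1) f p ≠ 0)
    (h : IsLocallyAxial m (-1) f fun A => ∀ a ∈ A, a ≠ 0 → 0 < form (-1) n a a) :
    IsLocallyPartialTube m (-1) f fun V g =>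
      IsUmbilicalOrCircleOn (-1) n (m - 1) V g ∧ IsEquidistantOn n (m - 1) V g := by
  refine h.isLocallyPartialTube (Or.inr rfl) hm hf hT fun A hA hdim y hy hyA => ?_
  -- The dimension `n - m + 1` of `A` is positive because `m ≤ n`; a direction in which to move off
  -- is thus available.
  have hA0 : A ≠ ⊥ := by
    rintro rfl
    rw [finrank_bot] at hdim
    omega
  obtain ⟨l, b, b₁, hl, hb, hq, hb₁, hb₁1, hform, hne⟩ :=
    -- Any positive distance would do.
    exists_smul_add_equidistant hA hA0 hy hyA 1
  exact ⟨l, b, hl, hb, hq, fun V g hr hu hg => ⟨hu, isEquidistantOn_of_form hr.finrank one_pos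
    (fun x hx => (hr.immersion.2 x hx).1) hb₁ hb₁1
    (fun x hx a ha => (hg x hx a ha).trans (hform a ha)) hne⟩⟩

end Tube

/-! ### Partial tubes are axial -/

section Base

variable {ε : ℝ} {n r : ℕ} {V : Set (EuclideanSpace ℝ (Fin r))}
  {g : EuclideanSpace ℝ (Fin r) → Flat n}

/-- The derivatives of parallel normal vector fields are tangent. -/
theorem IsParallelFrameOn.fderiv_mem (hε : ε = 1 ∨ ε = -1) (hg : IsImmersionOn ε n V g)
    (hV : IsOpen V) {k : ℕ} {ξ : Fin k → EuclideanSpace ℝ (Fin r) → Flat n}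
    (h : IsParallelFrameOn ε n V g ξ) {x : EuclideanSpace ℝ (Fin r)} (hx : x ∈ V) (i : Fin k)
    (X : EuclideanSpace ℝ (Fin r)) : fderiv ℝ (ξ i) x X ∈ tangentSpan g x := by
  obtain ⟨h1, -, h3⟩ := h.2 x hx
  have hd : DifferentiableAt ℝ (ξ i) x :=
    ((h.1 i).contDiffAt (hV.mem_nhds hx)).differentiableAt (by simp)
  have h4 := h3 i X
  rw [normalDeriv, normalSpace, (posOff_form hε (hg.2 x hx).1).orthProj_iff, sub_zero] at h4
  obtain ⟨_, ⟨Z, rfl⟩, z, hz, heq⟩ := Submodule.mem_sup.1 h4.2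
  obtain ⟨c, rfl⟩ := Submodule.mem_span_singleton.1 hz
  have h5 := fderiv_bilin_apply (form ε n) hd (hg.differentiableAt hV hx) X
  rw [fderiv_eq_zero_of_eventually_const (c := 0), form_comm (ξ i x),
    (mem_normalSpace_iff.1 (h1 i)).1, add_zero, ← heq] at h5
  · have h6 : c * ε = 0 := by
      have h7 : form ε n ((fderiv ℝ g x).toLinearMap Z) (g x) = 0 := hg.form_fderiv_self hV hx Z
      simp only [zero_apply, map_add, map_smul, LinearMap.add_apply, LinearMap.smul_apply, h7,
        (hg.2 x hx).1.1, smul_eq_mul, zero_add] at h5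
      exact h5.symm
    rw [(mul_eq_zero.1 h6).resolve_right (sign_ne_zero hε), zero_smul, add_zero] at heq
    exact ⟨Z, heq⟩
  · filter_upwards [hV.mem_nhds hx] with y hy
    rw [form_comm]
    exact (mem_normalSpace_iff.1 ((h.2 y hy).1 i)).2

/-- The second derivative of an immersion into the quadric in terms of its second fundamental form. -/
theorem IsImmersionOn.exists_snd_fderiv (hε : ε = 1 ∨ ε = -1) (hg : IsImmersionOn ε n V g)
    (hV : IsOpen V) {x : EuclideanSpace ℝ (Fin r)} (hx : x ∈ V) {ζ : Flat n}
    (hζ : ζ ∈ normalSpace (form ε n) (g x) g x) {X Y : EuclideanSpace ℝ (Fin r)}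
    (hs : sff (form ε n) (g x) g x X Y = form ε n (fderiv ℝ g x X) (fderiv ℝ g x Y) • ζ) :
    ∃ Z, fderiv ℝ (fderiv ℝ g) x X Y
      = form ε n (fderiv ℝ g x X) (fderiv ℝ g x Y) • (ζ - ε • g x) + fderiv ℝ g x Z := by
  rw [sff, normalSpace, (posOff_form hε (hg.2 x hx).1).orthProj_iff] at hs
  obtain ⟨_, ⟨Z, rfl⟩, z, hz, heq⟩ := Submodule.mem_sup.1 hs.2
  obtain ⟨c, rfl⟩ := Submodule.mem_span_singleton.1 hz
  have h2 := bilin_snd_fderiv_self (B := form ε n) form_comm (hg.contDiffAt hV hx)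
    (hg.eventually_form_self hV hx) X Y
  set q := form ε n (fderiv ℝ g x X) (fderiv ℝ g x Y)
  have heq : fderiv ℝ (fderiv ℝ g) x X Y = q • ζ + fderiv ℝ g x Z + c • g x := by
    rw [add_assoc, show fderiv ℝ g x Z + c • g x = _ from heq]
    abel
  refine ⟨Z, ?_⟩
  have hc : c = -(q * ε) := by
    have h7 : form ε n (fderiv ℝ g x Z) (g x) = 0 := hg.form_fderiv_self hV hx Z
    rw [heq] at h2
    simp only [map_add, map_smul, LinearMap.add_apply, LinearMap.smul_apply, h7,
      (hg.2 x hx).1.1, smul_eq_mul, form_comm ζ, (mem_normalSpace_iff.1 hζ).2] at h2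
    linear_combination ε * h2 - c * sq_eq_one_of_sign hε
  rw [heq, hc, smul_sub, smul_smul, neg_smul]
  abel

theorem finrank_comap_inl_of_le {L : Submodule ℝ (FlatR n)} (hL : ∀ w ∈ L, w.2 = 0) :
    finrank ℝ (L.comap (LinearMap.inl ℝ (Flat n) ℝ)) = finrank ℝ L := by
  have h1 : (L.comap (LinearMap.inl ℝ (Flat n) ℝ)).map (LinearMap.inl ℝ (Flat n) ℝ) = L := by
    rw [Submodule.map_comap_eq, inf_eq_right]
    exact fun w hw => ⟨w.1, Prod.ext rfl (hL w hw).symm⟩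
  rw [(Submodule.equivMapOfInjective (LinearMap.inl ℝ (Flat n) ℝ) LinearMap.inl_injective
    _).finrank_eq, h1]

/-- The cylinder over an immersion into the quadric. -/
def cylinder (g : EuclideanSpace ℝ (Fin r) → Flat n) (z : EuclideanSpace ℝ (Fin r) × ℝ) : FlatR n :=
  (g z.1, z.2)

theorem hasFDerivAt_comp_fst {W : Type*} [NormedAddCommGroup W] [NormedSpace ℝ W]
    {u : EuclideanSpace ℝ (Fin r) → W} {z : EuclideanSpace ℝ (Fin r) × ℝ}
    (hu : DifferentiableAt ℝ u z.1) :
    HasFDerivAt (fun z : EuclideanSpace ℝ (Fin r) × ℝ => u z.1)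
      (fderiv ℝ u z.1 ∘L ContinuousLinearMap.fst ℝ _ ℝ) z :=
  hu.hasFDerivAt.comp z hasFDerivAt_fst

theorem hasFDerivAt_cylinder {z : EuclideanSpace ℝ (Fin r) × ℝ} (hg : DifferentiableAt ℝ g z.1) :
    HasFDerivAt (cylinder g)
      ((fderiv ℝ g z.1 ∘L ContinuousLinearMap.fst ℝ _ ℝ).prod (ContinuousLinearMap.snd ℝ _ ℝ)) z :=
  (hasFDerivAt_comp_fst hg).prodMk hasFDerivAt_snd

theorem fderiv_cylinder {z : EuclideanSpace ℝ (Fin r) × ℝ} (hg : DifferentiableAt ℝ g z.1)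
    (X : EuclideanSpace ℝ (Fin r) × ℝ) :
    fderiv ℝ (cylinder g) z X = (fderiv ℝ g z.1 X.1, X.2) := by
  rw [(hasFDerivAt_cylinder hg).fderiv]
  rfl

theorem IsImmersionOn.snd_fderiv_cylinder (hg : IsImmersionOn ε n V g) (hV : IsOpen V)
    {z : EuclideanSpace ℝ (Fin r) × ℝ} (hz : z.1 ∈ V) (X Y : EuclideanSpace ℝ (Fin r) × ℝ) :
    fderiv ℝ (fderiv ℝ (cylinder g)) z X Y = (fderiv ℝ (fderiv ℝ g) z.1 X.1 Y.1, 0) := by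
  have hev : ∀ᶠ y : EuclideanSpace ℝ (Fin r) × ℝ in 𝓝 z, y.1 ∈ V :=
    continuousAt_fst.eventually (hV.mem_nhds hz)
  have hc : ContDiffAt ℝ ∞ (cylinder g) z :=
    ((hg.contDiffAt hV hz).comp z contDiffAt_fst).prodMk contDiffAt_snd
  have hd : DifferentiableAt ℝ (fderiv ℝ (cylinder g)) z :=
    (hc.fderiv_right (m := ∞) (by simp)).differentiableAt (by simp)
  have hd2 := (hg.contDiffAt_fderiv hV hz).differentiableAt (by simp)
  rw [← fderiv_clm_apply_const hd]
  have h1 : (fun y => fderiv ℝ (cylinder g) y Y) =ᶠ[𝓝 z] fun y => (fderiv ℝ g y.1 Y.1, Y.2) := by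
    filter_upwards [hev] with y hy using fderiv_cylinder (hg.differentiableAt hV hy) Y
  have h2 := (hasFDerivAt_comp_fst (u := fun y => fderiv ℝ g y Y.1) (z := z)
    (hd2.clm_apply (differentiableAt_const _))).prodMk (hasFDerivAt_const Y.2 z)
  rw [h1.fderiv_eq, h2.fderiv, ← fderiv_clm_apply_const hd2]
  rfl

/-- The tangent spaces of an umbilical immersion with parallel mean curvature are contained in a
fixed subspace that has one dimension more. -/
theorem IsImmersionOn.exists_subspace (hε : ε = 1 ∨ ε = -1) (hr : 1 ≤ r)
    (hg : IsImmersionOn ε n V g) (hV : IsOpen V) {ζ : EuclideanSpace ℝ (Fin r) → Flat n}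
    (hζs : ContDiffOn ℝ ∞ ζ V) (hζ : ∀ x ∈ V, ζ x ∈ normalSpace (form ε n) (g x) g x)
    (hs : ∀ x ∈ V, ∀ X Y, sff (form ε n) (g x) g x X Y
      = form ε n (fderiv ℝ g x X) (fderiv ℝ g x Y) • ζ x)
    (hζ' : r = 1 → ∀ x ∈ V, ∀ X, fderiv ℝ ζ x X ∈ tangentSpan g x) {x₀ : EuclideanSpace ℝ (Fin r)}
    (hx₀ : x₀ ∈ V) :
    ∃ L : Submodule ℝ (Flat n), finrank ℝ L = r + 1 ∧ ζ x₀ - ε • g x₀ ∈ L ∧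
      ∀ᶠ x in 𝓝 x₀, tangentSpan g x ≤ L := by
  set ℓ : FlatR n →L[ℝ] ℝ := ContinuousLinearMap.snd ℝ (Flat n) ℝ with hℓ
  have hℓa : ∀ w, ℓ w = w.2 := fun w => rfl
  set μ : EuclideanSpace ℝ (Fin r) × ℝ → FlatR n := fun z => (ζ z.1 - ε • g z.1, 0) with hμ
  have hζat : ∀ x ∈ V, ContDiffAt ℝ ∞ ζ x := fun x hx => hζs.contDiffAt (hV.mem_nhds hx)
  have hBa : ∀ u w, LinearMap.toContinuousBilinearMap (formR ε n) u w = formR ε n u w :=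
    fun u w => rfl
  -- The level sets of the height on the cylinder are copies of `g`, so the general result applies
  -- with `r + 1` in place of `r`. In the flat space the mean curvature of `g` is `ζ - ε g`, and the
  -- two-dimensional case is `r = 1`.
  have hU : IsUmbilicalAlong (LinearMap.toContinuousBilinearMap (formR ε n)) ℓ (cylinder g) μ
      (V ×ˢ univ) (0, 1) := by
    have hD : ∀ z ∈ V ×ˢ (univ : Set ℝ), ∀ X, fderiv ℝ (cylinder g) z X
        = (fderiv ℝ g z.1 X.1, X.2) := fun z hz X => fderiv_cylinder (hg.differentiableAt hV hz.1) X
    refine ⟨hV.prod isOpen_univ, ?_, ?_, ?_, ?_, ?_, ?_, ?_, ?_⟩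
    · intro z hz
      exact (((hg.contDiffAt hV hz.1).comp z contDiffAt_fst).prodMk
        contDiffAt_snd).contDiffWithinAt
    · intro z hz
      have h1 : ContDiffAt ℝ ∞ (fun x => ζ x - ε • g x) z.1 :=
        (hζat _ hz.1).sub ((hg.contDiffAt hV hz.1).const_smul ε)
      exact ((h1.comp z contDiffAt_fst).prodMk contDiffAt_const).contDiffWithinAt
    · intro z hz
      rw [injective_iff_map_eq_zero]
      intro X hX
      rw [hD z hz] at hX
      exact Prod.ext ((injective_iff_map_eq_zero _).1 (hg.2 _ hz.1).2 _ (congrArg Prod.fst hX))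
        (congrArg (fun w : FlatR n => w.2) hX)
    · rintro z hz ⟨X, hX⟩
      have hX : fderiv ℝ (cylinder g) z X = μ z := hX
      rw [hD z hz] at hX
      have h1 := congrArg (fun w : FlatR n => form ε n w.1 (g z.1)) hX
      simp only [hμ, hg.form_fderiv_self hV hz.1, map_sub, map_smul, LinearMap.sub_apply,
        LinearMap.smul_apply, form_comm (ζ z.1), (mem_normalSpace_iff.1 (hζ _ hz.1)).2,
        (hg.2 _ hz.1).1.1, smul_eq_mul, sq_eq_one_of_sign hε] at h1
      norm_num at h1
    · intro z hz X Y hY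
      rw [hℓa, hD z hz] at hY
      have hY : Y.2 = 0 := hY
      obtain ⟨Z, hZ⟩ := hg.exists_snd_fderiv hε hV hz.1 (hζ _ hz.1) (hs _ hz.1 X.1 Y.1)
      refine ⟨(Z, 0), ?_⟩
      rw [hBa, hD z hz, hD z hz, hD z hz, hg.snd_fderiv_cylinder hV hz.1, formR_apply, hZ]
      simp [hμ, hY]
    · intro z hz Y hY0 hY
      rw [hℓa, hD z hz] at hY
      have hY : Y.2 = 0 := hY
      rw [hBa, hD z hz, formR_apply]
      simp only [hY, mul_zero, add_zero]
      refine form_self_pos hε (hg.2 _ hz.1).1.1 (hg.form_fderiv_self hV hz.1 _) fun h0 => hY0 ?_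
      exact Prod.ext ((injective_iff_map_eq_zero _).1 (hg.2 _ hz.1).2 _ h0) hY
    · intro hdim z hz Y _
      simp only [Module.finrank_prod, finrank_euclideanSpace, Fintype.card_fin,
        Module.finrank_self] at hdim
      obtain ⟨Z, hZ⟩ := hζ' (by omega) z.1 hz.1 Y.1
      have hZ : fderiv ℝ g z.1 Z = fderiv ℝ ζ z.1 Y.1 := hZ
      have hgd := hg.differentiableAt hV hz.1
      have hζd := (hζat _ hz.1).differentiableAt (by simp)
      have h2 := (hasFDerivAt_comp_fst (u := fun y => ζ y - ε • g y) (z := z)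
        (hζd.sub (hgd.fun_const_smul ε))).prodMk (hasFDerivAt_const (0 : ℝ) z)
      refine ⟨(Z - ε • Y.1, 0), ?_⟩
      have h3 : fderiv ℝ (fun y => ζ y - ε • g y) z.1 Y.1
          = fderiv ℝ g z.1 (Z - ε • Y.1) := by
        rw [fderiv_fun_sub hζd (hgd.fun_const_smul ε), fderiv_fun_const_smul hgd, sub_apply,
          smul_apply, map_sub, map_smul, hZ]
      show fderiv ℝ (cylinder g) z _ = _
      rw [hD z hz, hμ, h2.fderiv, ← h3]
      rfl
    · intro z hz
      rw [hℓa, hD z hz]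
      exact one_ne_zero
  obtain ⟨L, hL1, hL2, hL3, hL4⟩ := hU.exists_subspace (x₀ := (x₀, 0)) ⟨hx₀, trivial⟩
    (by simp; omega)
  -- Here `μ` is horizontal, so the fixed subspace contains it.
  refine ⟨L.comap (LinearMap.inl ℝ (Flat n) ℝ), ?_, hL3 rfl, ?_⟩
  · rw [finrank_comap_inl_of_le hL2, hL1]
    simp
  · have hc : ContinuousAt (fun x : EuclideanSpace ℝ (Fin r) => (x, (0 : ℝ))) x₀ := by fun_prop
    filter_upwards [hc.eventually hL4, hV.mem_nhds hx₀] with x hx hxV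
    rintro _ ⟨X, rfl⟩
    have h1 := hx (X, 0)
    rw [fderiv_cylinder (z := (x, 0)) (hg.differentiableAt hV hxV)] at h1
    exact h1 rfl

/-- The curvature of a geodesic circle is constant, so that the mean curvature is parallel. -/
theorem IsUmbilicalOrCircleOn.fderiv_mem (hε : ε = 1 ∨ ε = -1)
    (hg : IsImmersionOn ε n V g) (hV : IsOpen V) (hr : r = 1)
    (hcirc : IsGeodesicCircleOn ε n {t | diag r t ∈ V} fun t => g (diag r t))
    {ζ : EuclideanSpace ℝ (Fin r) → Flat n}
    (hζs : ContDiffOn ℝ ∞ ζ V) (hζ : ∀ x ∈ V, ζ x ∈ normalSpace (form ε n) (g x) g x)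
    (hs : ∀ x ∈ V, ∀ X Y, sff (form ε n) (g x) g x X Y
      = form ε n (fderiv ℝ g x X) (fderiv ℝ g x Y) • ζ x) :
    ∀ x ∈ V, ∀ X, fderiv ℝ ζ x X ∈ tangentSpan g x := by
  subst hr
  have hJ : IsOpen {t | diag 1 t ∈ V} := hV.preimage contDiff_diag.continuous
  set γ : ℝ → Flat n := fun t => g (diag 1 t) with hγ
  have hγ' : ∀ t, diag 1 t ∈ V → deriv γ t = fderiv ℝ g (diag 1 t) (diag 1 1) := fun t ht =>
    (hasDerivAt_comp_diag (hg.differentiableAt hV ht)).deriv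
  have hunit : ∀ x ∈ V, form ε n (fderiv ℝ g x (diag 1 1)) (fderiv ℝ g x (diag 1 1)) = 1 := by
    intro x hx
    have hx' : diag 1 (x 0) ∈ V := by rwa [← eq_diag x]
    have := (hcirc (x 0) hx').1
    rwa [hγ' _ hx', ← eq_diag x] at this
  have hcov : ∀ t, diag 1 t ∈ V → covDeriv ε n γ (deriv γ) t = ζ (diag 1 t) := by
    intro t ht
    refine hg.covDeriv_deriv hε hV hunit ht (hζ _ ht) ?_
    have h1 := hs _ ht (diag 1 1) (diag 1 1)
    rw [hunit _ ht, one_smul, sff, normalSpace,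
      (posOff_form hε (hg.2 _ ht).1).orthProj_iff] at h1
    exact h1.2
  intro x hx X
  have hx' : diag 1 (x 0) ∈ V := by rwa [← eq_diag x]
  have hζd : DifferentiableAt ℝ ζ x := (hζs.contDiffAt (hV.mem_nhds hx)).differentiableAt (by simp)
  have h1 : covDeriv ε n γ (deriv γ) =ᶠ[𝓝 (x 0)] fun t => ζ (diag 1 t) := by
    filter_upwards [hJ.mem_nhds hx'] with u hu using hcov u hu
  have h2 : deriv (covDeriv ε n γ (deriv γ)) (x 0) = fderiv ℝ ζ x (diag 1 1) := by
    rw [h1.deriv_eq, (hasDerivAt_comp_diag (by rwa [← eq_diag x])).deriv, ← eq_diag x]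
  have h3 : form ε n (fderiv ℝ ζ x (diag 1 1)) (g x) = 0 := by
    have h4 := fderiv_bilin_apply (form ε n) hζd (hg.differentiableAt hV hx) (diag 1 1)
    rw [fderiv_eq_zero_of_eventually_const (c := 0), form_comm (ζ x),
      (mem_normalSpace_iff.1 (hζ x hx)).1, add_zero] at h4
    · exact h4.symm
    · filter_upwards [hV.mem_nhds hx] with y hy
      rw [form_comm]
      exact (mem_normalSpace_iff.1 (hζ y hy)).2
  have h5 := (hcirc (x 0) hx').2
  rw [covDeriv, h2, hγ' _ hx'] at h5
  simp only [hγ, ← eq_diag x, h3] at h5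
  rw [mul_zero, zero_smul, sub_zero] at h5
  have hX : X = X 0 • diag 1 1 := by
    conv_lhs => rw [eq_diag X, diag_eq_smul]
  rw [hX, map_smul, h5]
  exact Submodule.smul_mem _ _ (Submodule.smul_mem _ _ ⟨diag 1 1, rfl⟩)

theorem IsUmbilicalOrCircleOn.exists_subspace (hε : ε = 1 ∨ ε = -1) (hr : 1 ≤ r)
    (hg : IsImmersionOn ε n V g) (hV : IsOpen V) (hu : IsUmbilicalOrCircleOn ε n r V g)
    {x₀ : EuclideanSpace ℝ (Fin r)} (hx₀ : x₀ ∈ V) :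
    ∃ L : Submodule ℝ (Flat n), finrank ℝ L = r + 1 ∧ ∀ᶠ x in 𝓝 x₀, tangentSpan g x ≤ L := by
  obtain ⟨⟨ζ, hζs, hζ⟩, hcirc⟩ := hu
  obtain ⟨L, hL, -, hL'⟩ := hg.exists_subspace hε hr hV hζs (fun x hx => (hζ x hx).1)
    (fun x hx => (hζ x hx).2) (fun hr => IsUmbilicalOrCircleOn.fderiv_mem hε hg hV hr (hcirc hr) hζs
      (fun x hx => (hζ x hx).1) (fun x hx => (hζ x hx).2)) hx₀
  exact ⟨L, hL, hL'⟩

/-- With `ζ = 0` the parallelism required for `r = 1` is automatic, and the flat mean curvature `-ε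
g` puts the position itself into the fixed subspace. This will make its orthogonal complement
positive definite. -/
theorem IsTotallyGeodesicOn.exists_subspace (hε : ε = 1 ∨ ε = -1) (hr : 1 ≤ r)
    (hg : IsImmersionOn ε n V g) (hV : IsOpen V) (hu : IsTotallyGeodesicOn ε n V g)
    {x₀ : EuclideanSpace ℝ (Fin r)} (hx₀ : x₀ ∈ V) :
    ∃ L : Submodule ℝ (Flat n), finrank ℝ L = r + 1 ∧ g x₀ ∈ L ∧
      ∀ᶠ x in 𝓝 x₀, tangentSpan g x ≤ L := by
  obtain ⟨L, hL, hL', hL''⟩ := hg.exists_subspace hε hr hV (ζ := fun _ => 0) contDiffOn_const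
    (fun x hx => Submodule.zero_mem _) (fun x hx X Y => by rw [hu x hx, smul_zero])
    (fun hr x hx X => by simp) hx₀
  rw [zero_sub, Submodule.neg_mem_iff, Submodule.smul_mem_iff _ (sign_ne_zero hε)] at hL'
  exact ⟨L, hL, hL', hL''⟩

end Base

/-! ### Equidistant hypersurfaces -/

section Equidistant

variable {n r : ℕ} {V : Set (EuclideanSpace ℝ (Fin r))} {g : EuclideanSpace ℝ (Fin r) → Flat n}

/-- A subspace of one dimension more than `S` is the sum of `S` and a unit normal. -/
theorem exists_unit_normal {S S' : Submodule ℝ (Flat n)} (hSS' : S ≤ S')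
    (hdim : finrank ℝ S' = finrank ℝ S + 1) {z : Flat n} (hzS : z ∈ S)
    (hz : z ∈ quadric (-1) n) :
    ∃ b : Flat n, form (-1) n b b = 1 ∧ (∀ w ∈ S, form (-1) n w b = 0) ∧
      ∀ w ∈ S', w - form (-1) n w b • b ∈ S := by
  obtain ⟨w, hwS', hwS⟩ : ∃ w ∈ S', w ∉ S := by
    by_contra! hcon
    have : S' = S := le_antisymm hcon hSS'
    rw [this] at hdim
    omega
  have hc := (posOff_form (Or.inr rfl) hz).isCompl_sup_span S
  rw [sup_eq_left.2 ((Submodule.span_singleton_le_iff_mem _ _).2 hzS)] at hc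
  obtain ⟨u, hu, a, ha, rfl⟩ := Submodule.mem_sup.1
    (show w ∈ S ⊔ (form (-1) n).orthogonal S by rw [hc.sup_eq_top]; trivial)
  have ha0 : a ≠ 0 := by
    rintro rfl
    exact hwS (by simpa using hu)
  have haS : ∀ w ∈ S, form (-1) n w a = 0 := ha
  have hpos : 0 < form (-1) n a a :=
    form_self_pos (Or.inr rfl) hz.1 (by rw [form_comm]; exact haS z hzS) ha0
  obtain ⟨b, hb⟩ : ∃ b, b = (Real.sqrt (form (-1) n a a))⁻¹ • a := ⟨_, rfl⟩
  have hbb : form (-1) n b b = 1 := by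
    simp only [hb, map_smul, LinearMap.smul_apply, smul_eq_mul]
    rw [← mul_assoc, ← mul_inv, Real.mul_self_sqrt hpos.le, inv_mul_cancel₀ hpos.ne']
  have hbS : ∀ w ∈ S, form (-1) n w b = 0 := fun w hw => by rw [hb, map_smul, haS w hw, smul_zero]
  have hbS' : b ∈ S' := by
    rw [hb]
    refine Submodule.smul_mem _ _ ?_
    have := Submodule.sub_mem _ hwS' (hSS' hu)
    rwa [add_sub_cancel_left] at this
  have hbn : b ∉ S := fun h => by
    have := hbS b h
    rw [hbb] at this
    exact one_ne_zero this
  have hsup : S ⊔ Submodule.span ℝ {b} = S' := by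
    refine Submodule.eq_of_le_of_finrank_eq
      (sup_le hSS' ((Submodule.span_singleton_le_iff_mem _ _).2 hbS')) ?_
    rw [Submodule.finrank_sup_span_singleton hbn, hdim]
  refine ⟨b, hbb, hbS, fun w hw => ?_⟩
  rw [← hsup] at hw
  obtain ⟨v, hv, y, hy, rfl⟩ := Submodule.mem_sup.1 hw
  obtain ⟨c, rfl⟩ := Submodule.mem_span_singleton.1 hy
  rw [map_add, LinearMap.add_apply, hbS v hv, map_smul, LinearMap.smul_apply, hbb, smul_eq_mul,
    mul_one, zero_add, add_sub_cancel_right]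
  exact hv

/-- The distance of a point of the hyperbolic space from a totally geodesic hypersurface. -/
theorem sq_form_of_isGLB {S : Submodule ℝ (Flat n)} {b y : Flat n}
    (hbS : ∀ w ∈ S, form (-1) n w b = 0) (hy : y ∈ quadric (-1) n)
    (hyS : y - form (-1) n y b • b ∈ S) {d : ℝ}
    (hd : IsGLB (hypDist n y '' ((S : Set (Flat n)) ∩ quadric (-1) n)) d) :
    1 + form (-1) n y b ^ 2 = Real.cosh d ^ 2 := by
  obtain ⟨c, hc⟩ : ∃ c, c = form (-1) n y b := ⟨_, rfl⟩
  rw [← hc] at hyS ⊢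
  obtain ⟨u, hu⟩ : ∃ u, u = y - c • b := ⟨_, rfl⟩
  rw [← hu] at hyS
  have hyu : ∀ w ∈ S, form (-1) n y w = form (-1) n u w := fun w hw => by
    rw [hu, map_sub, map_smul, LinearMap.sub_apply, LinearMap.smul_apply, form_comm b, hbS w hw,
      smul_zero, sub_zero]
  have huu : form (-1) n u u = -(1 + c ^ 2) := by
    rw [← hyu u hyS, hu, map_sub, map_smul, hy.1, ← hc, smul_eq_mul]
    ring
  have hp : 0 < 1 + c ^ 2 := by positivity
  obtain ⟨k, hk⟩ : ∃ k, k = Real.sqrt (1 + c ^ 2) := ⟨_, rfl⟩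
  have hk0 : 0 < k := hk ▸ Real.sqrt_pos.2 hp
  have hk2 : k ^ 2 = 1 + c ^ 2 := hk ▸ Real.sq_sqrt hp.le
  have hk1 : 1 ≤ k := by nlinarith [sq_nonneg c]
  obtain ⟨v, hv⟩ : ∃ v, v = k⁻¹ • u := ⟨_, rfl⟩
  have hvS : v ∈ S := hv ▸ Submodule.smul_mem _ _ hyS
  have huv : u = k • v := by rw [hv, smul_smul, mul_inv_cancel₀ hk0.ne', one_smul]
  have hvv : form (-1) n v v = -1 := by
    rw [hv]
    simp only [map_smul, LinearMap.smul_apply, huu, smul_eq_mul, ← hk2]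
    field_simp
  have hyv : form (-1) n y v = -k := by
    rw [hyu v hvS, huv, map_smul, LinearMap.smul_apply, hvv, smul_eq_mul, mul_neg_one]
  have hvq : v ∈ quadric (-1) n :=
    ⟨hvv, fun _ => pos_of_form_neg hvv hy (by rw [form_comm, hyv]; linarith)⟩
  have hleast : IsLeast (hypDist n y '' ((S : Set (Flat n)) ∩ quadric (-1) n)) (Real.arcosh k) := by
    refine ⟨⟨v, ⟨hvS, hvq⟩, by rw [hypDist, hyv, neg_neg]⟩, ?_⟩
    rintro _ ⟨z, ⟨hzS, hzq⟩, rfl⟩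
    have h1 := form_le_neg_one hvq hzq
    have h2 : k ≤ -form (-1) n y z := by
      rw [hyu z hzS, huv, map_smul, LinearMap.smul_apply, smul_eq_mul]
      nlinarith
    exact (Real.arcosh_le_arcosh hk0 (hk0.trans_le h2)).2 h2
  rw [hd.unique hleast.isGLB, Real.cosh_arcosh hk1, hk2]

/-- Constant distance makes `⟨g, b⟩²` constant, equal to `sinh² d`, for a unit normal `b` of `S` in
`S'`. Since `d > 0`, `⟨g, b⟩` never vanishes, and differentiating the square shows that tangent
vectors are orthogonal to `b`; being in `S'`, they are in `S`. -/
theorem IsEquidistantOn.exists_subspace (hg : IsImmersionOn (-1) n V g) (hV : IsOpen V)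
    (h : IsEquidistantOn n r V g) :
    ∃ S : Submodule ℝ (Flat n), finrank ℝ S = r + 1 ∧
      ((S : Set (Flat n)) ∩ quadric (-1) n).Nonempty ∧ ∀ x ∈ V, tangentSpan g x ≤ S := by
  obtain ⟨S, S', hSS', hS, hS', hne, d, hd, hgS⟩ := h
  refine ⟨S, hS, hne, ?_⟩
  obtain ⟨z, hzS, hzq⟩ := hne
  obtain ⟨b, hbb, hbS, hbS'⟩ := exists_unit_normal hSS' (by omega) hzS hzq
  have hsq : ∀ x ∈ V, 1 + form (-1) n (g x) b ^ 2 = Real.cosh d ^ 2 := fun x hx =>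
    sq_form_of_isGLB hbS (hg.2 x hx).1 (hbS' _ (hgS x hx).1) (hgS x hx).2
  rintro x hx _ ⟨X, rfl⟩
  show fderiv ℝ g x X ∈ S
  have hgd := hg.differentiableAt hV hx
  have hX' : fderiv ℝ g x X ∈ S' := by
    rw [← (posOff_form (Or.inr rfl) hzq).orthogonal_orthogonal S']
    intro a ha
    show form (-1) n a _ = 0
    rw [form_comm, ← fderiv_bilin_const_apply _ hgd, fderiv_eq_zero_of_eventually_const (c := 0)]
    · rfl
    · filter_upwards [hV.mem_nhds hx] with y hy using ha _ (hgS y hy).1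
  have hne : form (-1) n (g x) b ≠ 0 := by
    intro h0
    have h1 := hsq x hx
    have h2 := (Real.sinh_pos_iff (x := d)).2 hd
    rw [h0, Real.cosh_sq] at h1
    nlinarith
  have hXb : form (-1) n (fderiv ℝ g x X) b = 0 := by
    have hdb : DifferentiableAt ℝ (fun y => form (-1) n (g y) b) x :=
      (contDiffAt_bilin _ (hg.contDiffAt hV hx) contDiffAt_const).differentiableAt (by simp)
    have h1 : fderiv ℝ (fun y => form (-1) n (g y) b * form (-1) n (g y) b) x = 0 := by
      apply fderiv_eq_zero_of_eventually_const (c := Real.cosh d ^ 2 - 1)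
      filter_upwards [hV.mem_nhds hx] with y hy
      linarith [hsq y hy]
    rw [fderiv_fun_mul hdb hdb] at h1
    have h2 := DFunLike.congr_fun h1 X
    simp only [add_apply, smul_apply, smul_eq_mul, zero_apply, fderiv_bilin_const_apply _ hgd] at h2
    have h3 : form (-1) n (g x) b * form (-1) n (fderiv ℝ g x X) b = 0 := by linarith
    exact (mul_eq_zero.1 h3).resolve_left hne
  have := hbS' _ hX'
  rwa [hXb, zero_smul, sub_zero] at this

end Equidistant

/-! ### Tangent spaces of the leaves of a partial tube -/

section Tube

variable {ε : ℝ} {n m : ℕ} {M : Type*} [TopologicalSpace M]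
  [ChartedSpace (EuclideanSpace ℝ (Fin m)) M] [IsManifold (𝓡 m) ∞ M] {f : M → FlatR n}

/-- The level sets of the height function of a partial tube are tangent to the base. -/
theorem fderiv_tube_mem {r k : ℕ} (hε : ε = 1 ∨ ε = -1) {V : Set (EuclideanSpace ℝ (Fin r))}
    {I : Set ℝ} {g : EuclideanSpace ℝ (Fin r) → Flat n}
    {ξ : Fin k → EuclideanSpace ℝ (Fin r) → Flat n} {α : ℝ → FlatR k}
    {G : EuclideanSpace ℝ (Fin r) × ℝ → FlatR n} (hV : IsOpen V) (hI : IsOpen I)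
    (hg : IsImmersionOn ε n V g) (hξ : IsParallelFrameOn ε n V g ξ)
    (hα : ∀ s ∈ I, deriv (fun s => (α s).2) s ≠ 0)
    (hG : ∀ x ∈ V, ∀ s ∈ I,
      G (x, s) = ((α s).1 0 • g x + ∑ i : Fin k, (α s).1 i.succ • ξ i x, (α s).2))
    {x : EuclideanSpace ℝ (Fin r)} (hx : x ∈ V) {s : ℝ} (hs : s ∈ I)
    (hd : DifferentiableAt ℝ G (x, s)) {Z : EuclideanSpace ℝ (Fin r) × ℝ}
    (hZ : (fderiv ℝ G (x, s) Z).2 = 0) : (fderiv ℝ G (x, s) Z).1 ∈ tangentSpan g x := by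
  obtain ⟨X, t⟩ := Z
  have hsl : (fun y => G (y, s)) =ᶠ[𝓝 x] fun y =>
      ((α s).1 0 • g y + ∑ i : Fin k, (α s).1 i.succ • ξ i y, (α s).2) := by
    filter_upwards [hV.mem_nhds hx] with y hy using hG y hy s hs
  have hgd := hg.differentiableAt hV hx
  have hξd : ∀ i, DifferentiableAt ℝ (ξ i) x := fun i =>
    ((hξ.1 i).contDiffAt (hV.mem_nhds hx)).differentiableAt (by simp)
  have hXd : fderiv ℝ G (x, s) (X, 0)
      = ((α s).1 0 • fderiv ℝ g x X + ∑ i : Fin k, (α s).1 i.succ • fderiv ℝ (ξ i) x X, 0) := by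
    rw [← fderiv_slice_apply hd, hsl.fderiv_eq]
    have h1 : HasFDerivAt (fun y => (α s).1 0 • g y + ∑ i : Fin k, (α s).1 i.succ • ξ i y)
        ((α s).1 0 • fderiv ℝ g x + ∑ i : Fin k, (α s).1 i.succ • fderiv ℝ (ξ i) x) x :=
      (hgd.hasFDerivAt.fun_const_smul _).fun_add
        (HasFDerivAt.fun_sum fun i _ => (hξd i).hasFDerivAt.fun_const_smul _)
    rw [(h1.prodMk (hasFDerivAt_const (α s).2 x)).fderiv]
    simp
  have hsplit : fderiv ℝ G (x, s) (X, t) = fderiv ℝ G (x, s) (X, 0) + t • fderiv ℝ G (x, s) (0, 1) := by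
    rw [← map_smul, ← map_add]
    simp
  have h1 : (fderiv ℝ G (x, s) (0, 1)).2 = deriv (fun s => (α s).2) s := by
    have h2 : HasDerivAt (fun t => (G (x, t)).2) (fderiv ℝ G (x, s) (0, 1)).2 s := by
      simpa using HasFDerivAt.hasDerivAt (hasDerivAt_slice hd).snd
    have h3 : (fun t => (G (x, t)).2) =ᶠ[𝓝 s] fun s => (α s).2 := by
      filter_upwards [hI.mem_nhds hs] with u hu
      rw [hG x hx u hu]
    rw [← h3.deriv_eq]
    exact h2.deriv.symm
  rw [hsplit, hXd] at hZ
  -- Since the height of the tube has nonzero derivative in `s`, a level vector has no component in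
  -- that direction.
  have ht : t = 0 := by
    simp only [Prod.snd_add, Prod.smul_snd, h1, smul_eq_mul, zero_add] at hZ
    exact (mul_eq_zero.1 hZ).resolve_right (hα s hs)
  rw [ht, hXd]
  exact Submodule.add_mem _ (Submodule.smul_mem _ _ ⟨X, rfl⟩)
    (Submodule.sum_mem _ fun i _ => Submodule.smul_mem _ _ (hξ.fderiv_mem hε hg hV hx i X))

/-- The axis is the orthogonal complement of a subspace of dimension `m` that contains the tangent
spaces of the base near a point. -/
theorem IsLocallyPartialTube.isLocallyAxial (hε : ε = 1 ∨ ε = -1) (hm : 2 ≤ m)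
    (hf : QxR.IsImmersion m ε f)
    {C : Set (EuclideanSpace ℝ (Fin (m - 1))) → (EuclideanSpace ℝ (Fin (m - 1)) → Flat n) → Prop}
    {C' : Submodule ℝ (Flat n) → Prop}
    (hC : ∀ V g, IsOpen V → IsImmersionOn ε n V g → C V g → ∀ x₀ ∈ V,
      ∃ L : Submodule ℝ (Flat n), finrank ℝ L = m - 1 + 1 ∧ C' ((form ε n).orthogonal L) ∧
        ∀ᶠ x in 𝓝 x₀, tangentSpan g x ≤ L)
    (h : IsLocallyPartialTube m ε f C) : IsLocallyAxial m ε f C' := by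
  intro p
  obtain ⟨V, I, ψ, g, k, ξ, α, hV, hI, -, hsrc, hp, hψ, hψ', hg, hCg, hξ, -, hα, hF⟩ := h p
  have hz := ψ.map_target hp
  rw [hsrc] at hz
  obtain ⟨L, hL, hCL, hev⟩ := hC V g hV hg hCg _ hz.1
  obtain ⟨V', hV', hV'o, hxV'⟩ := eventually_nhds_iff.1 hev
  have hpo := posOff_form hε (hf.2 p).1
  refine ⟨ψ.target ∩ ψ.symm ⁻¹' (V' ×ˢ univ), (form ε n).orthogonal L,
    ψ.isOpen_inter_preimage_symm (hV'o.prod isOpen_univ), ⟨hp, hxV', trivial⟩, ?_, hCL, ?_⟩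
  · have := hpo.finrank_orthogonal L
    simp only [Module.finrank_fin_fun] at this
    omega
  · rintro q ⟨hq, hqV', -⟩ Y hY
    have hzq := ψ.map_target hq
    obtain ⟨θ, hθ⟩ := exists_equiv_push hf.1 hψ hψ' hzq
    rw [ψ.right_inv hq] at hθ
    have h1 := hθ (θ.symm Y)
    rw [θ.apply_symm_apply] at h1
    rw [hpo.orthogonal_orthogonal]
    rw [← h1] at hY ⊢
    refine hV' _ hqV' ?_
    have hd : DifferentiableAt ℝ (f ∘ ψ) (ψ.symm q) :=
      ((contDiffOn_comp_param hψ hf.1).contDiffAt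
        (ψ.open_source.mem_nhds hzq)).differentiableAt (by simp)
    rw [hsrc] at hzq
    exact fderiv_tube_mem hε hV hI hg hξ (fun s hs => (hα s hs).2) hF hzq.1 hzq.2 hd hY

theorem IsLocallyPartialTube.isLocallyAxial_of_umbilical (hε : ε = 1 ∨ ε = -1) (hm : 2 ≤ m)
    (hf : QxR.IsImmersion m ε f)
    (h : IsLocallyPartialTube m ε f (IsUmbilicalOrCircleOn ε n (m - 1))) :
    IsLocallyAxial m ε f fun _ => True := by
  refine h.isLocallyAxial hε hm hf fun V g hV hg hu x₀ hx₀ => ?_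
  obtain ⟨L, hL, hL'⟩ := hu.exists_subspace hε (by omega) hg hV hx₀
  exact ⟨L, hL, trivial, hL'⟩

/-- The fixed subspace contains a point of the quadric, so vectors orthogonal to it are tangent to
the quadric there, hence spacelike. -/
theorem IsLocallyPartialTube.isLocallyAxial_of_totallyGeodesic (hε : ε = 1 ∨ ε = -1) (hm : 2 ≤ m)
    (hf : QxR.IsImmersion m ε f) (h : IsLocallyPartialTube m ε f (IsTotallyGeodesicOn ε n)) :
    IsLocallyAxial m ε f fun A => ∀ a ∈ A, a ≠ 0 → 0 < form ε n a a := by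
  refine h.isLocallyAxial hε hm hf fun V g hV hg hu x₀ hx₀ => ?_
  obtain ⟨L, hL, hgL, hL'⟩ := hu.exists_subspace hε (by omega) hg hV hx₀
  refine ⟨L, hL, fun a ha ha0 => form_self_pos hε (hg.2 x₀ hx₀).1.1 ?_ ha0, hL'⟩
  rw [form_comm]
  exact ha _ hgL

theorem IsLocallyPartialTube.isLocallyAxial_of_equidistant (hm : 2 ≤ m)
    (hf : QxR.IsImmersion m (-1) f)
    (h : IsLocallyPartialTube m (-1) f fun V g =>
      IsUmbilicalOrCircleOn (-1) n (m - 1) V g ∧ IsEquidistantOn n (m - 1) V g) :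
    IsLocallyAxial m (-1) f fun A => ∀ a ∈ A, a ≠ 0 → 0 < form (-1) n a a := by
  refine h.isLocallyAxial (Or.inr rfl) hm hf fun V g hV hg hu x₀ hx₀ => ?_
  obtain ⟨S, hS, ⟨z, hzS, hz⟩, hS'⟩ := hu.2.exists_subspace hg hV
  refine ⟨S, hS, fun a ha ha0 => form_self_pos (Or.inr rfl) hz.1 ?_ ha0, ?_⟩
  · rw [form_comm]
    exact ha _ hzS
  · filter_upwards [hV.mem_nhds hx₀] with x hx using hS' x hx

end Tube

/-! ### Umbilical leaves and axial immersions -/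

section SecondDerivative

variable {E E' W : Type*} [NormedAddCommGroup E] [NormedSpace ℝ E] [NormedAddCommGroup E']
  [NormedSpace ℝ E'] [NormedAddCommGroup W] [NormedSpace ℝ W] [FiniteDimensional ℝ E']
  [FiniteDimensional ℝ W]

theorem fderiv_comp_apply {G : E' → W} {τ : E → E'} {z : E} (hG : DifferentiableAt ℝ G (τ z))
    (hτ : DifferentiableAt ℝ τ z) (X : E) :
    fderiv ℝ (G ∘ τ) z X = fderiv ℝ G (τ z) (fderiv ℝ τ z X) := by
  rw [fderiv_comp z hG hτ]
  rfl

theorem snd_fderiv_comp_apply {G : E' → W} {τ : E → E'} {z : E} (hG : ContDiffAt ℝ ∞ G (τ z))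
    (hτ : ContDiffAt ℝ ∞ τ z) (X Y : E) :
    fderiv ℝ (fderiv ℝ (G ∘ τ)) z X Y
      = fderiv ℝ (fderiv ℝ G) (τ z) (fderiv ℝ τ z X) (fderiv ℝ τ z Y)
        + fderiv ℝ G (τ z) (fderiv ℝ (fderiv ℝ τ) z X Y) := by
  have hdG : ∀ᶠ y in 𝓝 z, DifferentiableAt ℝ G (τ y) := by
    have : ContDiffAt ℝ 1 G (τ z) := hG.of_le (by simp)
    refine hτ.continuousAt.eventually (p := fun y => DifferentiableAt ℝ G y) ?_
    filter_upwards [this.eventually fun h => by simpa using WithTop.coe_injective h] with y hy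
      using hy.differentiableAt (by simp)
  have hdτ : ∀ᶠ y in 𝓝 z, DifferentiableAt ℝ τ y := by
    have : ContDiffAt ℝ 1 τ z := hτ.of_le (by simp)
    filter_upwards [this.eventually fun h => by simpa using WithTop.coe_injective h] with y hy
      using hy.differentiableAt (by simp)
  have h1 : (fun y => fderiv ℝ (G ∘ τ) y Y) =ᶠ[𝓝 z] fun y => fderiv ℝ G (τ y) (fderiv ℝ τ y Y) := by
    filter_upwards [hdG, hdτ] with y hy1 hy2 using fderiv_comp_apply hy1 hy2 Y
  have hd : DifferentiableAt ℝ (fderiv ℝ (G ∘ τ)) z :=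
    ((hG.comp z hτ).fderiv_right (m := ∞) (by simp)).differentiableAt (by simp)
  have hG' : DifferentiableAt ℝ (fderiv ℝ G) (τ z) :=
    (hG.fderiv_right (m := ∞) (by simp)).differentiableAt (by simp)
  have hτ' : DifferentiableAt ℝ (fderiv ℝ τ) z :=
    (hτ.fderiv_right (m := ∞) (by simp)).differentiableAt (by simp)
  have hτd := hτ.differentiableAt (by simp)
  have hGτ : DifferentiableAt ℝ (fun y => fderiv ℝ G (τ y)) z := hG'.comp z hτd
  rw [← fderiv_clm_apply_const hd, h1.fderiv_eq,
    fderiv_clm_apply hGτ (hτ'.clm_apply (differentiableAt_const Y)), add_apply,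
    ContinuousLinearMap.comp_apply, fderiv_clm_apply_const hτ', ContinuousLinearMap.flip_apply,
    show fderiv ℝ (fun y => fderiv ℝ G (τ y)) z X = fderiv ℝ (fderiv ℝ G) (τ z) (fderiv ℝ τ z X) from
      fderiv_comp_apply hG' hτd X, add_comm]

end SecondDerivative

/-! ### Change of charts -/

section Leaves

variable {ε : ℝ} {n m : ℕ} {M : Type*} [TopologicalSpace M]
  [ChartedSpace (EuclideanSpace ℝ (Fin m)) M] {f : M → FlatR n}

/-- Pointwise notions are computed in the preferred chart of each point, while differentiation needs
one chart on an open set. The two differ by a transition map. -/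
theorem inChart_eventuallyEq {W : Type*} (u : M → W) {p : M} {z : EuclideanSpace ℝ (Fin m)}
    (hz : z ∈ (chartAt (EuclideanSpace ℝ (Fin m)) p).target) :
    inChart m u p =ᶠ[𝓝 z]
      inChart m u ((chartAt (EuclideanSpace ℝ (Fin m)) p).symm z) ∘
        (chartAt (EuclideanSpace ℝ (Fin m)) ((chartAt (EuclideanSpace ℝ (Fin m)) p).symm z) ∘
          (chartAt (EuclideanSpace ℝ (Fin m)) p).symm) := by
  set q := (chartAt (EuclideanSpace ℝ (Fin m)) p).symm z with hq
  have h1 : ∀ᶠ y in 𝓝 z, (chartAt (EuclideanSpace ℝ (Fin m)) p).symm y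
      ∈ (chartAt (EuclideanSpace ℝ (Fin m)) q).source :=
    ((chartAt (EuclideanSpace ℝ (Fin m)) p).continuousAt_symm hz).eventually
      ((chartAt (EuclideanSpace ℝ (Fin m)) q).open_source.mem_nhds
        (by rw [← hq]; exact mem_chart_source _ q))
  filter_upwards [h1] with y hy
  rw [inChart_eq, inChart_eq]
  simp only [Function.comp_apply]
  rw [(chartAt (EuclideanSpace ℝ (Fin m)) q).left_inv hy]

variable [IsManifold (𝓡 m) ∞ M]

theorem contDiffAt_transition {p : M} {z : EuclideanSpace ℝ (Fin m)}
    (hz : z ∈ (chartAt (EuclideanSpace ℝ (Fin m)) p).target) :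
    ContDiffAt ℝ ∞
      (chartAt (EuclideanSpace ℝ (Fin m)) ((chartAt (EuclideanSpace ℝ (Fin m)) p).symm z) ∘
          (chartAt (EuclideanSpace ℝ (Fin m)) p).symm) z := by
  set q := (chartAt (EuclideanSpace ℝ (Fin m)) p).symm z with hq
  have h1 := (contMDiffOn_chart_symm p).contMDiffAt
    ((chartAt (EuclideanSpace ℝ (Fin m)) p).open_target.mem_nhds hz)
  have h2 := (contMDiffOn_chart q).contMDiffAt
    ((chartAt (EuclideanSpace ℝ (Fin m)) q).open_source.mem_nhds (mem_chart_source _ q))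
  exact contMDiffAt_iff_contDiffAt.1 (ContMDiffAt.comp z h2 h1)

theorem contDiffAt_inChart {W : Type*} [NormedAddCommGroup W] [NormedSpace ℝ W] {u : M → W}
    (hu : ContMDiff (𝓡 m) 𝓘(ℝ, W) ∞ u) {p : M} {z : EuclideanSpace ℝ (Fin m)}
    (hz : z ∈ (chartAt (EuclideanSpace ℝ (Fin m)) p).target) :
    ContDiffAt ℝ ∞ (inChart m u p) z :=
  (contDiffOn_comp_param (contMDiffOn_chart_symm p) hu).contDiffAt
    ((chartAt (EuclideanSpace ℝ (Fin m)) p).open_target.mem_nhds hz)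

theorem pt_mem_target (p : M) : pt m p ∈ (chartAt (EuclideanSpace ℝ (Fin m)) p).target := by
  rw [pt_eq]; exact mem_chart_target _ p

/-- Change of charts, for the first derivative. -/
theorem fderiv_inChart {W : Type*} [NormedAddCommGroup W] [NormedSpace ℝ W]
    [FiniteDimensional ℝ W] {u : M → W} (hu : ContMDiff (𝓡 m) 𝓘(ℝ, W) ∞ u)
    {p q : M} {z : EuclideanSpace ℝ (Fin m)}
    (hz : z ∈ (chartAt (EuclideanSpace ℝ (Fin m)) p).target)
    (hq : q = (chartAt (EuclideanSpace ℝ (Fin m)) p).symm z) (X : EuclideanSpace ℝ (Fin m)) :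
    fderiv ℝ (inChart m u p) z X = fderiv ℝ (inChart m u q) (pt m q)
      (fderiv ℝ (chartAt (EuclideanSpace ℝ (Fin m)) q ∘
        (chartAt (EuclideanSpace ℝ (Fin m)) p).symm) z X) := by
  subst hq
  have h1 : ContDiffAt ℝ ∞ (inChart m u _)
      ((chartAt (EuclideanSpace ℝ (Fin m)) ((chartAt (EuclideanSpace ℝ (Fin m)) p).symm z) ∘
        (chartAt (EuclideanSpace ℝ (Fin m)) p).symm) z) := contDiffAt_inChart hu (pt_mem_target _)
  rw [(inChart_eventuallyEq u hz).fderiv_eq]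
  exact fderiv_comp_apply (h1.differentiableAt (by simp))
    ((contDiffAt_transition hz).differentiableAt (by simp)) X

/-- Change of charts, for the second derivative. -/
theorem snd_fderiv_inChart {W : Type*} [NormedAddCommGroup W] [NormedSpace ℝ W]
    [FiniteDimensional ℝ W] {u : M → W} (hu : ContMDiff (𝓡 m) 𝓘(ℝ, W) ∞ u)
    {p q : M} {z : EuclideanSpace ℝ (Fin m)}
    (hz : z ∈ (chartAt (EuclideanSpace ℝ (Fin m)) p).target)
    (hq : q = (chartAt (EuclideanSpace ℝ (Fin m)) p).symm z) (X Y : EuclideanSpace ℝ (Fin m)) :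
    fderiv ℝ (fderiv ℝ (inChart m u p)) z X Y
      - fderiv ℝ (fderiv ℝ (inChart m u q)) (pt m q)
        (fderiv ℝ (chartAt (EuclideanSpace ℝ (Fin m)) q ∘
          (chartAt (EuclideanSpace ℝ (Fin m)) p).symm) z X)
        (fderiv ℝ (chartAt (EuclideanSpace ℝ (Fin m)) q ∘
          (chartAt (EuclideanSpace ℝ (Fin m)) p).symm) z Y)
      ∈ tangentSpan (inChart m u q) (pt m q) := by
  subst hq
  have h1 : ContDiffAt ℝ ∞ (inChart m u _)
      ((chartAt (EuclideanSpace ℝ (Fin m)) ((chartAt (EuclideanSpace ℝ (Fin m)) p).symm z) ∘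
        (chartAt (EuclideanSpace ℝ (Fin m)) p).symm) z) := contDiffAt_inChart hu (pt_mem_target _)
  rw [(inChart_eventuallyEq u hz).fderiv.fderiv_eq,
    snd_fderiv_comp_apply h1 (contDiffAt_transition hz)]
  exact ⟨_, (add_sub_cancel_left _ _).symm⟩

theorem tangentSpan_inChart (hf : ContMDiff (𝓡 m) 𝓘(ℝ, FlatR n) ∞ f) {p q : M}
    {z : EuclideanSpace ℝ (Fin m)} (hz : z ∈ (chartAt (EuclideanSpace ℝ (Fin m)) p).target)
    (hq : q = (chartAt (EuclideanSpace ℝ (Fin m)) p).symm z) :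
    tangentSpan (inChart m f p) z = tangentSpan (inChart m f q) (pt m q) := by
  subst hq
  obtain ⟨θ, hθ⟩ := exists_equiv_push hf (contMDiffOn_chart_symm p) (contMDiffOn_chart p) hz
  apply le_antisymm
  · rintro _ ⟨X, rfl⟩
    exact ⟨θ X, (hθ X).symm⟩
  · rintro _ ⟨X, rfl⟩
    refine ⟨θ.symm X, (hθ _).trans ?_⟩
    rw [θ.apply_symm_apply]
    rfl

end Leaves

/-! ### Umbilical leaves give axial immersions -/

section UmbilicalLeaves

variable {ε : ℝ} {n m : ℕ} {M : Type*} [TopologicalSpace M]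
  [ChartedSpace (EuclideanSpace ℝ (Fin m)) M] [IsManifold (𝓡 m) ∞ M] {f : M → FlatR n}

theorem nu_fst (y : FlatR n) : (nu y).1 = y.1 := rfl

theorem formR_nu (w y : FlatR n) : formR ε n w (nu y) = form ε n w.1 y.1 := by
  simp [formR_apply, nu]

/-- The second fundamental form of `ℚ_ε^n × ℝ`, in terms of an immersion into it. -/
theorem form_snd_fderiv_fst {E : Type*} [NormedAddCommGroup E] [NormedSpace ℝ E] {F : E → FlatR n}
    {z : E} (hF : ContDiffAt ℝ ∞ F z) (h : ∀ᶠ y in 𝓝 z, (F y).1 ∈ quadric ε n) (X Y : E) :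
    form ε n (fderiv ℝ (fderiv ℝ F) z X Y).1 (F z).1
      = -form ε n (fderiv ℝ F z X).1 (fderiv ℝ F z Y).1 := by
  set B : LinearMap.BilinForm ℝ (FlatR n) :=
    (form ε n).compl₁₂ (LinearMap.fst ℝ (Flat n) ℝ) (LinearMap.fst ℝ (Flat n) ℝ)
  exact bilin_snd_fderiv_self (B := B) (fun x y => form_comm x.1 y.1) hF
    (by filter_upwards [h] with y hy using hy.1) X Y

omit [IsManifold (𝓡 m) ∞ M] in
theorem eventually_inChart_mem (hf : QxR.IsImmersion m ε f) (p : M) (z : EuclideanSpace ℝ (Fin m)) :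
    ∀ᶠ y in 𝓝 z, (inChart m f p y).1 ∈ quadric ε n :=
  Eventually.of_forall fun _ => (hf.2 _).1

/-- The mean curvature of the leaves in the flat space. -/
def leafMean (m : ℕ) {M : Type*} [TopologicalSpace M] [ChartedSpace (EuclideanSpace ℝ (Fin m)) M]
    (ε : ℝ) (f ζ : M → FlatR n) (p : M) (z : EuclideanSpace ℝ (Fin m)) : FlatR n :=
  inChart m ζ p z - ε • nu (inChart m f p z)

theorem contDiffAt_nu_inChart (hf : QxR.IsImmersion m ε f) {p : M} {z : EuclideanSpace ℝ (Fin m)}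
    (hz : z ∈ (chartAt (EuclideanSpace ℝ (Fin m)) p).target) :
    ContDiffAt ℝ ∞ (fun y => nu (inChart m f p y)) z :=
  (contDiffAt_inChart hf.1 hz).fst.prodMk contDiffAt_const

theorem fderiv_nu_inChart (hf : QxR.IsImmersion m ε f) {p : M} {z : EuclideanSpace ℝ (Fin m)}
    (hz : z ∈ (chartAt (EuclideanSpace ℝ (Fin m)) p).target) (Y : EuclideanSpace ℝ (Fin m)) :
    fderiv ℝ (fun y => nu (inChart m f p y)) z Y = ((fderiv ℝ (inChart m f p) z Y).1, 0) := by
  have hd := (contDiffAt_inChart hf.1 hz).differentiableAt (by simp)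
  have h2 := hd.fst.hasFDerivAt.prodMk (hasFDerivAt_const (0 : ℝ) z)
  rw [show (fun y => nu (inChart m f p y)) = fun y => ((inChart m f p y).1, (0 : ℝ)) from rfl,
    h2.fderiv]
  exact Prod.ext (fderiv_fst_apply hd Y) rfl

/-- Vectors in the span of the tangent space and the normal of `ℚ_ε^n × ℝ`. -/
theorem exists_of_mem_tangentSpan_sup (hε : ε = 1 ∨ ε = -1) (hf : QxR.IsImmersion m ε f) {p : M}
    {z : EuclideanSpace ℝ (Fin m)} (hz : z ∈ (chartAt (EuclideanSpace ℝ (Fin m)) p).target)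
    {v : FlatR n} (hv : v ∈ tangentSpan (inChart m f p) z ⊔ Submodule.span ℝ {nu (inChart m f p z)}) :
    v - (ε * form ε n v.1 (inChart m f p z).1) • nu (inChart m f p z)
      ∈ tangentSpan (inChart m f p) z := by
  obtain ⟨_, ⟨Z, rfl⟩, w, hw, rfl⟩ := Submodule.mem_sup.1 hv
  obtain ⟨c, rfl⟩ := Submodule.mem_span_singleton.1 hw
  have hq : (inChart m f p z).1 ∈ quadric ε n := (hf.2 _).1
  have h0 : form ε n (fderiv ℝ (inChart m f p) z Z).1 (inChart m f p z).1 = 0 := by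
    have hd := (contDiffAt_inChart hf.1 hz).differentiableAt (by simp)
    have := bilin_fderiv_self (B := form ε n) form_comm (g := fun y => (inChart m f p y).1) (c := ε)
      hd.fst (by filter_upwards [eventually_inChart_mem hf p z] with y hy using hy.1) Z
    rwa [fderiv_fst_apply hd] at this
  have h1 : ε * form ε n ((fderiv ℝ (inChart m f p) z).toLinearMap Z
      + c • nu (inChart m f p z)).1 (inChart m f p z).1 = c := by
    rw [Prod.fst_add, map_add, LinearMap.add_apply,
      show form ε n ((fderiv ℝ (inChart m f p) z).toLinearMap Z).1 (inChart m f p z).1 = 0 from h0,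
      Prod.smul_fst, map_smul, LinearMap.smul_apply, nu_fst, hq.1,
      smul_eq_mul]
    linear_combination c * sq_eq_one_of_sign hε
  rw [h1, add_sub_cancel_right]
  exact ⟨Z, rfl⟩

/-- In the flat space the second derivative acquires the component `-ε⟨X, Y⟩` along the normal of
`ℚ_ε^n × ℝ` when `Y` is horizontal, so the mean curvature becomes `ζ - ε ν`. The domain is cut down
to where `Z₀` is transversal to the leaves. -/
theorem HasUmbilicalLeaves.isUmbilicalAlong (hε : ε = 1 ∨ ε = -1)
    (hf : QxR.IsImmersion m ε f) {ζ : M → FlatR n} (hζs : ContMDiff (𝓡 m) 𝓘(ℝ, FlatR n) ∞ ζ)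
    (hζ : ∀ p, ζ p ∈ normalSpace (formR ε n) (nu (f p)) (inChart m f p) (pt m p) ∧
      ∀ Y, formR ε n (push m f p Y) (pushT m ε f p) = 0 →
        (∀ X, sff (formR ε n) (nu (f p)) (inChart m f p) (pt m p) X Y
          = formR ε n (push m f p X) (push m f p Y) • ζ p) ∧
        (m = 2 →
          normalDeriv (formR ε n) (nu (f p)) (inChart m f p) (inChart m ζ p) (pt m p) Y = 0))
    (p : M) (Z₀ : EuclideanSpace ℝ (Fin m)) :
    IsUmbilicalAlong (LinearMap.toContinuousBilinearMap (formR ε n))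
      (ContinuousLinearMap.snd ℝ (Flat n) ℝ) (inChart m f p) (leafMean m ε f ζ p)
      ((chartAt (EuclideanSpace ℝ (Fin m)) p).target
        ∩ {z | (fderiv ℝ (inChart m f p) z Z₀).2 ≠ 0}) Z₀ := by
  set χ := chartAt (EuclideanSpace ℝ (Fin m)) p with hχ
  have hFs : ∀ z ∈ χ.target, ContDiffAt ℝ ∞ (inChart m f p) z := fun z hz =>
    contDiffAt_inChart hf.1 hz
  have hζF : ∀ z ∈ χ.target, ContDiffAt ℝ ∞ (inChart m ζ p) z := fun z hz =>
    contDiffAt_inChart hζs hz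
  have hT : ∀ z ∈ χ.target, tangentSpan (inChart m f p) z
      = tangentSpan (inChart m f (χ.symm z)) (pt m (χ.symm z)) := fun z hz =>
    tangentSpan_inChart hf.1 hz rfl
  have hnorm : ∀ z ∈ χ.target, (∀ w ∈ tangentSpan (inChart m f p) z,
      formR ε n w (inChart m ζ p z) = 0) ∧ form ε n (inChart m ζ p z).1 (inChart m f p z).1 = 0 := by
    intro z hz
    have h1 := (hζ (χ.symm z)).1
    rw [normalSpace, mem_orthogonal_sup_span, ← hT z hz, formR_comm, formR_nu] at h1
    exact h1
  have htan : ∀ z ∈ χ.target, ∀ w ∈ tangentSpan (inChart m f p) z,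
      form ε n w.1 (inChart m f p z).1 = 0 := by
    intro z hz w hw
    rw [hT z hz] at hw
    obtain ⟨X, rfl⟩ := hw
    exact form_push_self hf (χ.symm z) X
  have hlevel : ∀ z ∈ χ.target, ∀ Y, (fderiv ℝ (inChart m f p) z Y).2 = 0 →
      formR ε n (push m f (χ.symm z) (fderiv ℝ (chartAt (EuclideanSpace ℝ (Fin m)) (χ.symm z)
        ∘ χ.symm) z Y)) (pushT m ε f (χ.symm z)) = 0 := by
    intro z hz Y hY
    rw [formR_push_pushT hε hf, push, ← fderiv_inChart hf.1 hz rfl]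
    exact hY
  have hqz : ∀ z, inChart m f p z = f (χ.symm z) := fun z => rfl
  refine ⟨?_, ?_, ?_, ?_, ?_, ?_, ?_, ?_, fun z hz => hz.2⟩
  · refine ContinuousOn.isOpen_inter_preimage (t := {0}ᶜ) (f := fun z =>
      (fderiv ℝ (inChart m f p) z Z₀).2) (fun z hz => ?_) χ.open_target isOpen_compl_singleton
    have h1 := (hFs z hz).fderiv_right (m := ∞) (by simp)
    exact ((h1.clm_apply contDiffAt_const).snd.continuousAt).continuousWithinAt
  · exact fun z hz => (hFs z hz.1).contDiffWithinAt
  · exact fun z hz => ((hζF z hz.1).sub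
      ((contDiffAt_nu_inChart hf hz.1).const_smul ε)).contDiffWithinAt
  · intro z hz
    obtain ⟨θ, hθ⟩ := exists_equiv_push hf.1 (contMDiffOn_chart_symm p) (contMDiffOn_chart p) hz.1
    intro X Y hXY
    have hXY : fderiv ℝ (f ∘ χ.symm) z X = fderiv ℝ (f ∘ χ.symm) z Y := hXY
    rw [hθ, hθ] at hXY
    exact θ.injective (push_injective hf _ hXY)
  -- Tangent vectors are orthogonal to the position, with which `leafMean` has product `-1`.
  · intro z hz hmem
    have h1 := htan z hz.1 _ hmem
    have h2 : form ε n (f (χ.symm z)).1 (f (χ.symm z)).1 = ε := (hf.2 _).1.1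
    rw [leafMean, Prod.fst_sub, map_sub, LinearMap.sub_apply, (hnorm z hz.1).2, Prod.smul_fst,
      map_smul, LinearMap.smul_apply, nu_fst, hqz, h2,
      smul_eq_mul, sq_eq_one_of_sign hε] at h1
    norm_num at h1
  · intro z hz X Y hY
    have hY : (fderiv ℝ (inChart m f p) z Y).2 = 0 := hY
    have h1 := ((hζ (χ.symm z)).2 _ (hlevel z hz.1 Y hY)).1
      (fderiv ℝ (chartAt (EuclideanSpace ℝ (Fin m)) (χ.symm z) ∘ χ.symm) z X)
    rw [sff, normalSpace, (posOff_formR hε (hf.2 _).1).orthProj_iff, ← hT z hz.1, push, push,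
      ← fderiv_inChart hf.1 hz.1 rfl, ← fderiv_inChart hf.1 hz.1 rfl] at h1
    -- Changing the chart alters the second derivative only by a tangent vector.
    have h2 := snd_fderiv_inChart hf.1 hz.1 rfl X Y
    rw [← hT z hz.1] at h2
    have h3 := exists_of_mem_tangentSpan_sup hε hf hz.1
      (Submodule.add_mem _ (Submodule.mem_sup_left h2) h1.2)
    rw [sub_add_sub_cancel] at h3
    set q := formR ε n (fderiv ℝ (inChart m f p) z X) (fderiv ℝ (inChart m f p) z Y) with hq
    have hq' : q = form ε n (fderiv ℝ (inChart m f p) z X).1 (fderiv ℝ (inChart m f p) z Y).1 := by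
      rw [hq, formR_apply, hY, mul_zero, add_zero]
    have h4 : form ε n (fderiv ℝ (fderiv ℝ (inChart m f p)) z X Y - q • ζ (χ.symm z)).1
        (inChart m f p z).1 = -q := by
      rw [Prod.fst_sub, map_sub, LinearMap.sub_apply,
        form_snd_fderiv_fst (hFs z hz.1) (eventually_inChart_mem hf p z), Prod.smul_fst, map_smul,
        LinearMap.smul_apply,
        show form ε n (ζ (χ.symm z)).1 (inChart m f p z).1 = 0 from (hnorm z hz.1).2, hq']
      simp
    rw [h4] at h3
    obtain ⟨Z, hZ⟩ := h3
    refine ⟨Z, ?_⟩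
    show _ = q • _ + _
    rw [show fderiv ℝ (inChart m f p) z Z = _ from hZ, leafMean, smul_sub, smul_smul,
      show inChart m ζ p z = ζ (χ.symm z) from rfl, mul_neg, neg_smul, mul_comm ε q]
    abel
  · intro z hz Y hY0 _
    obtain ⟨θ, hθ⟩ := exists_equiv_push hf.1 (contMDiffOn_chart_symm p) (contMDiffOn_chart p) hz.1
    refine formR_push_pos hε hf (χ.symm z) ?_ ?_
    · rw [← hT z hz.1]
      exact ⟨Y, rfl⟩
    · intro h0
      have h0 : fderiv ℝ (f ∘ χ.symm) z Y = 0 := h0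
      rw [hθ] at h0
      apply hY0
      have h1 : push m f (χ.symm z) (θ Y) = push m f (χ.symm z) 0 :=
        h0.trans (map_zero (fderiv ℝ (inChart m f (χ.symm z)) (pt m (χ.symm z)))).symm
      exact (map_eq_zero_iff θ θ.injective).1 (push_injective hf _ h1)
  · intro hdim z hz Y hY
    have hY : (fderiv ℝ (inChart m f p) z Y).2 = 0 := hY
    rw [finrank_euclideanSpace, Fintype.card_fin] at hdim
    have h1 := ((hζ (χ.symm z)).2 _ (hlevel z hz.1 Y hY)).2 hdim
    rw [normalDeriv, normalSpace, (posOff_formR hε (hf.2 _).1).orthProj_iff, ← hT z hz.1,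
      ← fderiv_inChart hζs hz.1 rfl, sub_zero] at h1
    have h2 := exists_of_mem_tangentSpan_sup hε hf hz.1 h1.2
    have hζd := (hζF z hz.1).differentiableAt (by simp)
    have hνd := (contDiffAt_nu_inChart hf hz.1).differentiableAt (by simp)
    -- Along a leaf the normal `ν` varies as the position does, since the height is stationary.
    have hνY : fderiv ℝ (fun y => nu (inChart m f p y)) z Y = fderiv ℝ (inChart m f p) z Y := by
      rw [fderiv_nu_inChart hf hz.1]
      exact Prod.ext rfl hY.symm
    have h3 : form ε n (fderiv ℝ (inChart m ζ p) z Y).1 (inChart m f p z).1 = 0 := by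
      have h4 := fderiv_bilin_apply (formR ε n) hζd hνd Y
      rw [fderiv_eq_zero_of_eventually_const (c := 0), hνY, formR_comm (inChart m ζ p z),
        show formR ε n (fderiv ℝ (inChart m f p) z Y) (inChart m ζ p z) = 0 from
          (hnorm z hz.1).1 _ ⟨Y, rfl⟩, add_zero, formR_nu] at h4
      · exact h4.symm
      · filter_upwards [χ.open_target.mem_nhds hz.1] with y hy
        rw [formR_nu]
        exact (hnorm y hy).2
    rw [h3, mul_zero, zero_smul, sub_zero] at h2
    have h5 : fderiv ℝ (leafMean m ε f ζ p) z Y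
        = fderiv ℝ (inChart m ζ p) z Y - ε • fderiv ℝ (inChart m f p) z Y := by
      rw [show leafMean m ε f ζ p = fun y => inChart m ζ p y - ε • nu (inChart m f p y) from rfl,
        fderiv_fun_sub hζd (hνd.fun_const_smul ε), fderiv_fun_const_smul hνd, sub_apply, smul_apply,
        hνY]
    rw [h5]
    exact Submodule.sub_mem _ h2 (Submodule.smul_mem _ _ ⟨Y, rfl⟩)

theorem HasUmbilicalLeaves.isLocallyAxial (hε : ε = 1 ∨ ε = -1) (hm : 2 ≤ m)
    (hf : QxR.IsImmersion m ε f) (hT : ∀ p, pushT m ε f p ≠ 0) (h : HasUmbilicalLeaves m ε f) :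
    IsLocallyAxial m ε f fun _ => True := by
  obtain ⟨ζ, hζs, hζ⟩ := h
  intro p
  obtain ⟨Z₀, hZ₀⟩ := exists_push_snd_ne_zero hε hf (hT p)
  have hU := HasUmbilicalLeaves.isUmbilicalAlong hε hf hζs hζ p Z₀
  obtain ⟨L, hL1, hL2, -, hL4⟩ := hU.exists_subspace (x₀ := pt m p) ⟨pt_mem_target p, hZ₀⟩
    (by simpa using hm)
  obtain ⟨O, hO, hOo, hpO⟩ := eventually_nhds_iff.1 hL4
  have hpo := posOff_form hε (hf.2 p).1
  set χ := chartAt (EuclideanSpace ℝ (Fin m)) p with hχ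
  refine ⟨χ.source ∩ χ ⁻¹' O, (form ε n).orthogonal (L.comap (LinearMap.inl ℝ (Flat n) ℝ)),
    χ.isOpen_inter_preimage hOo, ⟨mem_chart_source _ p, hpO⟩, ?_, trivial, ?_⟩
  · have h1 := hpo.finrank_orthogonal (L.comap (LinearMap.inl ℝ (Flat n) ℝ))
    rw [finrank_comap_inl_of_le hL2, hL1] at h1
    simpa using h1
  · rintro q ⟨hq, hqO⟩ Y hY
    rw [hpo.orthogonal_orthogonal]
    have hz : χ q ∈ χ.target := χ.map_source hq
    obtain ⟨θ, hθ⟩ := exists_equiv_push hf.1 (contMDiffOn_chart_symm p) (contMDiffOn_chart p) hz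
    have h1 := hθ (θ.symm Y)
    rw [θ.apply_symm_apply, ← hχ, χ.left_inv hq] at h1
    have h2 := hO _ hqO (θ.symm Y)
    rw [show fderiv ℝ (inChart m f p) (χ q) (θ.symm Y) = _ from h1] at h2
    have h3 := h2 hY
    show ((push m f q Y).1, (0 : ℝ)) ∈ L
    rwa [show ((push m f q Y).1, (0 : ℝ)) = push m f q Y from Prod.ext rfl hY.symm]

end UmbilicalLeaves

/-! ### Mean curvature of the leaves of an axial immersion -/

section MeanCurvature

variable {E : Type*} [NormedAddCommGroup E] [NormedSpace ℝ E] {ε : ℝ} {n : ℕ}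

/-- The mean curvature vector of the leaves of an axial immersion `F`, for a vector `e` orthogonal to
the axis. -/
def axialMean (ε : ℝ) (n : ℕ) (e : Flat n) (F : E → FlatR n) (z : E) : FlatR n :=
  -(form ε n (F z).1 e)⁻¹ • orthProj (formR ε n) (normalSpace (formR ε n) (nu (F z)) F z) (e, 0)

namespace IsAxial

variable [FiniteDimensional ℝ E] {A : Submodule ℝ (Flat n)} {F : E → FlatR n} {O : Set E}
  (h : IsAxial ε n A F O) {z : E} (hz : z ∈ O)
include h hz

theorem formR_fderiv_nu (X : E) : formR ε n (fderiv ℝ F z X) (nu (F z)) = 0 := by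
  rw [formR_nu]
  exact h.form_fderiv_self hz X

theorem formR_tangentSpan_pos (hε : ε = 1 ∨ ε = -1) {w : FlatR n} (hw : w ∈ tangentSpan F z)
    (hw0 : w ≠ 0) : 0 < formR ε n w w := by
  obtain ⟨X, rfl⟩ := hw
  exact (posOff_formR hε (h.mem z hz)).pos _ (h.formR_fderiv_nu hz X) hw0

/-- The projection to the tangent spaces of a constant vector is a smooth vector field. -/
theorem exists_tangentField (hε : ε = 1 ∨ ε = -1) (e₁ : FlatR n) :
    ∃ Z : E → E, ContDiffAt ℝ ∞ Z z ∧ ∀ᶠ y in 𝓝 z, ∀ X,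
      formR ε n (fderiv ℝ F y X) (fderiv ℝ F y (Z y)) = formR ε n (fderiv ℝ F y X) e₁ := by
  set B := LinearMap.toContinuousBilinearMap (formR ε n) with hB
  have hBa : ∀ u w, B u w = formR ε n u w := fun u w => rfl
  -- `v` is the induced metric, regarded as a map to the dual. It is injective, and a smooth left
  -- inverse solves for the tangential component.
  set v : E → E →L[ℝ] E →L[ℝ] ℝ := fun y =>
    (ContinuousLinearMap.compL ℝ E (FlatR n) ℝ).flip (fderiv ℝ F y) ∘L B ∘L fderiv ℝ F y with hv
  have hva : ∀ y X X', v y X X' = formR ε n (fderiv ℝ F y X) (fderiv ℝ F y X') :=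
    fun y X X' => rfl
  have hvs : ContDiffOn ℝ ∞ v O := fun y hy => by
    have h1 := h.contDiffAt_fderiv hy
    exact ContDiffAt.contDiffWithinAt ((contDiffAt_const.clm_apply h1).clm_comp
      (contDiffAt_const.clm_comp h1))
  have hinj : Function.Injective (v z) := by
    rw [injective_iff_map_eq_zero]
    intro X hX
    by_contra hX0
    have h1 := h.formR_tangentSpan_pos hz hε ⟨X, rfl⟩
      (fun h0 => hX0 ((injective_iff_map_eq_zero _).1 (h.inj z hz) X h0))
    have h2 := hva z X X
    rw [hX] at h2
    exact h1.ne h2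
  obtain ⟨R, O', hO', hzO', hO'O, hR, hRv⟩ := exists_smooth_leftInverse h.isOpen hz hvs hinj
  set φ : E → E →L[ℝ] ℝ := fun y => B e₁ ∘L fderiv ℝ F y with hφ
  refine ⟨fun y => R y (φ y), ?_, ?_⟩
  · exact (hR.contDiffAt (hO'.mem_nhds hzO')).clm_apply
      (contDiffAt_const.clm_comp (h.contDiffAt_fderiv hz))
  · filter_upwards [hO'.mem_nhds hzO'] with y hy X
    have hyO := hO'O hy
    obtain ⟨⟨Z, hZ⟩, h2⟩ := orthProj_mem_of_isCompl (isCompl_orthogonal_of_pos formR_comm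
      fun w hw hw0 => h.formR_tangentSpan_pos hyO hε hw hw0) e₁
    rw [← hZ] at h2
    have h3 : ∀ X, formR ε n (fderiv ℝ F y X) (fderiv ℝ F y Z) = formR ε n (fderiv ℝ F y X) e₁ := by
      intro X
      have h4 : formR ε n (fderiv ℝ F y X) (e₁ - fderiv ℝ F y Z) = 0 := h2 _ ⟨X, rfl⟩
      rw [map_sub, sub_eq_zero] at h4
      exact h4.symm
    have h5 : φ y = v y Z := by
      ext X
      rw [hva, formR_comm, h3, formR_comm]
      rfl
    rw [h5, hRv y hy, h3]

theorem orthProj_normalSpace (hε : ε = 1 ∨ ε = -1) {e : Flat n} {Z : E}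
    (hZ : ∀ X, formR ε n (fderiv ℝ F z X) (fderiv ℝ F z Z) = formR ε n (fderiv ℝ F z X) (e, 0)) :
    orthProj (formR ε n) (normalSpace (formR ε n) (nu (F z)) F z) (e, 0)
      = (e, 0) - fderiv ℝ F z Z - (ε * form ε n (F z).1 e) • nu (F z) := by
  rw [normalSpace, (posOff_formR hε (h.mem z hz)).orthProj_iff, mem_orthogonal_sup_span]
  refine ⟨⟨?_, ?_⟩, ?_⟩
  · rintro _ ⟨X, rfl⟩
    show formR ε n (fderiv ℝ F z X) _ = 0
    rw [map_sub, map_sub, hZ, sub_self, map_smul, h.formR_fderiv_nu hz, smul_zero, sub_zero]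
  · rw [map_sub, map_sub, map_smul, formR_comm _ (fderiv ℝ F z Z), h.formR_fderiv_nu hz, formR_nu,
      nu_fst, (h.mem z hz).1, formR_comm, formR_nu, form_comm, smul_eq_mul]
    linear_combination (-form ε n (F z).1 e) * sq_eq_one_of_sign hε
  · rw [sub_sub, sub_sub_cancel]
    exact Submodule.add_mem_sup ⟨Z, rfl⟩
      (Submodule.smul_mem _ _ (Submodule.mem_span_singleton_self _))

/-- `A^⊥` has the dimension of the tangent space, and the vectors of height zero cut this down by at
most one. -/
theorem finrank_orthogonal_le (hε : ε = 1 ∨ ε = -1) :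
    Module.finrank ℝ ((form ε n).orthogonal A)
      ≤ Module.finrank ℝ ((tangentSpan F z).comap (LinearMap.inl ℝ (Flat n) ℝ)) + 1 := by
  set K : Submodule ℝ (FlatR n) := LinearMap.ker (LinearMap.snd ℝ (Flat n) ℝ) with hK
  have h1 : (tangentSpan F z).comap (LinearMap.inl ℝ (Flat n) ℝ)
      = (tangentSpan F z ⊓ K).comap (LinearMap.inl ℝ (Flat n) ℝ) := by
    ext w
    simp [hK]
  have h2 := (posOff_form hε (h.mem z hz)).finrank_orthogonal A
  have h3 := Submodule.finrank_sup_add_finrank_inf_eq (tangentSpan F z) K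
  have h4 := (tangentSpan F z ⊔ K).finrank_le
  have h5 : 1 + Module.finrank ℝ K = Module.finrank ℝ (FlatR n) := by
    have := (LinearMap.snd ℝ (Flat n) ℝ).finrank_range_add_finrank_ker
    rwa [LinearMap.range_eq_top.2 LinearMap.snd_surjective, finrank_top, Module.finrank_self] at this
  have h6 := h.finrank
  rw [h1, finrank_comap_inl_of_le (L := tangentSpan F z ⊓ K) fun w hw => hw.2]
  rw [tangentSpan, LinearMap.finrank_range_of_inj (h.inj z hz)] at h3
  rw [tangentSpan] at h4 ⊢
  simp only [Module.finrank_prod, Module.finrank_fin_fun, Module.finrank_self] at h2 h4 h5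
  omega

/-- The products with the axis have derivative proportional to that of the height. -/
theorem exists_form_snd_fderiv_axis {a : Flat n} (ha : a ∈ A) : ∃ κ : ℝ,
    (∀ X, form ε n a (fderiv ℝ F z X).1 = κ * (fderiv ℝ F z X).2) ∧
    ∀ X Y, (fderiv ℝ F z Y).2 = 0 →
      form ε n a (fderiv ℝ (fderiv ℝ F) z X Y).1 = κ * (fderiv ℝ (fderiv ℝ F) z X Y).2 := by
  obtain ⟨Z₀, hZ₀⟩ := h.transversal z hz
  have hDc := h.contDiffAt_fderiv hz
  have hDd := hDc.differentiableAt (by simp)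
  have hsnd : ∀ Y, DifferentiableAt ℝ (fun y => (fderiv ℝ F y Y).2) z := fun Y =>
    (hDd.clm_apply (differentiableAt_const Y)).snd
  have hκc : ContDiffAt ℝ ∞ (fun y => form ε n (fderiv ℝ F y Z₀).1 a / (fderiv ℝ F y Z₀).2) z :=
    (contDiffAt_bilin _ (hDc.clm_apply contDiffAt_const).fst contDiffAt_const).div
      (hDc.clm_apply contDiffAt_const).snd hZ₀
  set κ : E → ℝ := fun y => form ε n (fderiv ℝ F y Z₀).1 a / (fderiv ℝ F y Z₀).2 with hκ
  have hev : ∀ᶠ y in 𝓝 z, ∀ X, form ε n (fderiv ℝ F y X).1 a = κ y * (fderiv ℝ F y X).2 := by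
    have h1 : ∀ᶠ y in 𝓝 z, (fderiv ℝ F y Z₀).2 ≠ 0 := (hsnd Z₀).continuousAt.eventually_ne hZ₀
    filter_upwards [h.eventually_mem hz, h1] with y hy hy0 X
    set c := (fderiv ℝ F y X).2 / (fderiv ℝ F y Z₀).2 with hc
    have h2 : (fderiv ℝ F y (X - c • Z₀)).2 = 0 := by
      rw [map_sub, map_smul, Prod.snd_sub, Prod.smul_snd, smul_eq_mul, hc, div_mul_cancel₀ _ hy0,
        sub_self]
    have h3 : form ε n a (fderiv ℝ F y (X - c • Z₀)).1 = 0 := h.axis y hy _ h2 a ha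
    rw [map_sub, map_smul, Prod.fst_sub, Prod.smul_fst, map_sub, map_smul, smul_eq_mul,
      sub_eq_zero, form_comm a, form_comm a] at h3
    rw [h3, hκ, hc]
    ring
  refine ⟨κ z, fun X => by rw [form_comm]; exact hev.self_of_nhds X, fun X Y hY => ?_⟩
  have h1 : (fun y => form ε n (fderiv ℝ F y Y).1 a) =ᶠ[𝓝 z] fun y => κ y * (fderiv ℝ F y Y).2 := by
    filter_upwards [hev] with y hy using hy Y
  have hYd := hDd.clm_apply (differentiableAt_const Y)
  have h2 := fderiv_bilin_const_apply (form ε n) hYd.fst X a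
  -- The derivative of `κ` is multiplied by the height component of `dF(Y)`, which is zero.
  rw [h1.fderiv_eq, fderiv_fun_mul (hκc.differentiableAt (by simp)) (hsnd Y), add_apply, smul_apply,
    smul_apply, hY, zero_smul, add_zero, fderiv_snd_apply hYd, fderiv_fst_apply hYd,
    fderiv_clm_apply_const hDd, smul_eq_mul] at h2
  rw [form_comm]
  exact h2.symm

/-- The second derivative of an axial immersion. -/
theorem snd_fderiv_add_mem (hε : ε = 1 ∨ ε = -1) {e : Flat n} (he : e ∈ (form ε n).orthogonal A)
    (hρ : form ε n (F z).1 e ≠ 0) (X : E) {Y : E} (hY : (fderiv ℝ F z Y).2 = 0) :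
    fderiv ℝ (fderiv ℝ F) z X Y
      + (formR ε n (fderiv ℝ F z X) (fderiv ℝ F z Y) / form ε n (F z).1 e) • ((e, 0) : FlatR n)
      ∈ tangentSpan F z ⊔ Submodule.span ℝ {nu (F z)} := by
  have hp := posOff_formR hε (h.mem z hz)
  have hp' := posOff_form hε (h.mem z hz)
  rw [← hp.orthogonal_orthogonal (tangentSpan F z ⊔ Submodule.span ℝ {nu (F z)})]
  intro v hv
  obtain ⟨hv1, hv2⟩ := mem_orthogonal_sup_span.1 hv
  rw [formR_comm, formR_nu] at hv2
  set T₀ := (tangentSpan F z).comap (LinearMap.inl ℝ (Flat n) ℝ) with hT₀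
  have hT₀' : ∀ w ∈ T₀, ∃ Y, fderiv ℝ F z Y = (w, 0) := fun w hw => hw
  -- The horizontal part of a normal vector is in `A + ℝ F`; the product with `e` gives the
  -- coefficient `c` of the position.
  have ha := exists_sub_smul_mem_orthogonal (B := form ε n) (T := T₀)
    (L := (form ε n).orthogonal A) (y := (F z).1) (v := v.1) (e := e)
    (by
      intro w hw
      obtain ⟨Y, hY⟩ := hT₀' w hw
      have h1 := h.axis z hz Y (by rw [hY])
      rwa [hY] at h1)
    (by
      intro w hw
      obtain ⟨Y, hY⟩ := hT₀' w hw
      have h1 := h.form_fderiv_self hz Y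
      rwa [hY] at h1)
    (h.finrank_orthogonal_le hz hε) he (by rwa [form_comm])
    (by
      intro w hw
      have h1 := hv1 (w, 0) hw
      simpa [formR_apply] using h1)
  rw [hp'.orthogonal_orthogonal] at ha
  set c := form ε n e v.1 / form ε n e (F z).1 with hc
  obtain ⟨κ, hκ1, hκ2⟩ := h.exists_form_snd_fderiv_axis hz ha
  -- Pair the normal `v` with a transversal tangent vector: its `A`-part contributes `κ` times the
  -- height component, its position part nothing.
  have hv2' : v.2 = -κ := by
    obtain ⟨Z₀, hZ₀⟩ := h.transversal z hz
    have h1 := hκ1 Z₀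
    have h2 : formR ε n (fderiv ℝ F z Z₀) v = 0 := hv1 _ ⟨Z₀, rfl⟩
    rw [map_sub, map_smul, LinearMap.sub_apply, LinearMap.smul_apply, form_comm (F z).1,
      h.form_fderiv_self hz, smul_zero, sub_zero] at h1
    rw [formR_apply, form_comm, h1] at h2
    have h3 : (fderiv ℝ F z Z₀).2 * (κ + v.2) = 0 := by linarith
    have h4 := (mul_eq_zero.1 h3).resolve_left hZ₀
    linarith
  have h1 := hκ2 X Y hY
  rw [map_sub, map_smul, LinearMap.sub_apply, LinearMap.smul_apply, form_comm (F z).1,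
    form_snd_fderiv_fst (h.contDiffAt hz)
      (by filter_upwards [h.eventually_mem hz] with y hy using h.mem y hy), smul_eq_mul] at h1
  show formR ε n v _ = 0
  have h5 : formR ε n (fderiv ℝ F z X) (fderiv ℝ F z Y)
      = form ε n (fderiv ℝ F z X).1 (fderiv ℝ F z Y).1 := by
    rw [formR_apply, hY, mul_zero, add_zero]
  have h6 : form ε n v.1 e = c * form ε n (F z).1 e := by
    rw [hc, form_comm e, form_comm e, div_mul_cancel₀ _ hρ]
  rw [h5, map_add, map_smul, formR_apply, formR_apply, hv2']
  simp only [h6, mul_zero, add_zero, smul_eq_mul]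
  rw [div_mul_eq_mul_div, mul_comm c, ← mul_assoc, mul_div_right_comm, mul_div_cancel_right₀ _ hρ]
  linarith

theorem axialMean_mem (hε : ε = 1 ∨ ε = -1) (e : Flat n) :
    axialMean ε n e F z ∈ normalSpace (formR ε n) (nu (F z)) F z :=
  Submodule.smul_mem _ _ (((posOff_formR hε (h.mem z hz)).orthProj_iff (v := ((e, 0) : FlatR n))).1
    rfl).1

theorem sff_eq (hε : ε = 1 ∨ ε = -1) {e : Flat n} (he : e ∈ (form ε n).orthogonal A)
    (hρ : form ε n (F z).1 e ≠ 0) (X : E) {Y : E} (hY : (fderiv ℝ F z Y).2 = 0) :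
    sff (formR ε n) (nu (F z)) F z X Y
      = formR ε n (fderiv ℝ F z X) (fderiv ℝ F z Y) • axialMean ε n e F z := by
  have hp := posOff_formR hε (h.mem z hz)
  have h1 := h.snd_fderiv_add_mem hz hε he hρ X hY
  have h2 : orthProj (formR ε n) (normalSpace (formR ε n) (nu (F z)) F z)
      (fderiv ℝ (fderiv ℝ F) z X Y + (formR ε n (fderiv ℝ F z X) (fderiv ℝ F z Y)
        / form ε n (F z).1 e) • ((e, 0) : FlatR n)) = 0 := by
    rw [normalSpace, hp.orthProj_iff, sub_zero]
    exact ⟨Submodule.zero_mem _, h1⟩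
  rw [map_add, map_smul] at h2
  rw [sff, eq_neg_of_add_eq_zero_left h2, axialMean, smul_smul, div_eq_mul_inv, mul_neg, neg_smul]

theorem axialMean_eventuallyEq (hε : ε = 1 ∨ ε = -1) {e : Flat n}
    (hρ : form ε n (F z).1 e ≠ 0) {Z : E → E}
    (hZ : ∀ᶠ y in 𝓝 z, ∀ X, formR ε n (fderiv ℝ F y X) (fderiv ℝ F y (Z y))
      = formR ε n (fderiv ℝ F y X) (e, 0)) :
    axialMean ε n e F =ᶠ[𝓝 z] fun y =>
      -(form ε n (F y).1 e)⁻¹ • ((e, 0) - fderiv ℝ F y (Z y)) + ε • nu (F y) := by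
  have h1 : ∀ᶠ y in 𝓝 z, form ε n (F y).1 e ≠ 0 :=
    (contDiffAt_bilin (form ε n) (h.contDiffAt hz).fst
      contDiffAt_const).continuousAt.eventually_ne hρ
  filter_upwards [hZ, h1, h.eventually_mem hz] with y hy1 hy2 hy3
  rw [axialMean, h.orthProj_normalSpace hy3 hε hy1, smul_sub _ (_ - _), smul_smul, neg_mul, neg_smul,
    neg_smul, sub_neg_eq_add, mul_left_comm, inv_mul_cancel₀ hy2, mul_one]

theorem contDiffAt_nu : ContDiffAt ℝ ∞ (fun y => nu (F y)) z :=
  (h.contDiffAt hz).fst.prodMk contDiffAt_const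

theorem contDiffAt_axialMean (hε : ε = 1 ∨ ε = -1) {e : Flat n}
    (hρ : form ε n (F z).1 e ≠ 0) : ContDiffAt ℝ ∞ (axialMean ε n e F) z := by
  obtain ⟨Z, hZs, hZ⟩ := h.exists_tangentField hz hε (e, 0)
  refine ContDiffAt.congr_of_eventuallyEq ?_ (h.axialMean_eventuallyEq hz hε hρ hZ)
  have h1 := contDiffAt_bilin (form ε n) (h.contDiffAt hz).fst (contDiffAt_const (c := e))
  have h2 : ContDiffAt ℝ ∞ (fun y => ((e, 0) : FlatR n) - fderiv ℝ F y (Z y)) z :=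
    contDiffAt_const.sub ((h.contDiffAt_fderiv hz).clm_apply hZs)
  exact ((h1.inv hρ).neg.smul h2).add ((h.contDiffAt_nu hz).const_smul ε)

/-- The mean curvature vector of the leaves is parallel along the leaves. -/
theorem normalDeriv_axialMean (hε : ε = 1 ∨ ε = -1) {e : Flat n}
    (he : e ∈ (form ε n).orthogonal A) (hρ : form ε n (F z).1 e ≠ 0) {Y : E}
    (hY : (fderiv ℝ F z Y).2 = 0) :
    normalDeriv (formR ε n) (nu (F z)) F (axialMean ε n e F) z Y = 0 := by
  obtain ⟨Z, hZs, hZ⟩ := h.exists_tangentField hz hε (e, 0)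
  have hDd := (h.contDiffAt_fderiv hz).differentiableAt (by simp)
  have hZd := hZs.differentiableAt (by simp)
  have hFd := h.differentiableAt hz
  have hρd : DifferentiableAt ℝ (fun y => form ε n (F y).1 e) z :=
    (contDiffAt_bilin (form ε n) (h.contDiffAt hz).fst
      (contDiffAt_const (c := e))).differentiableAt (by simp)
  set ρ : E → ℝ := fun y => form ε n (F y).1 e with hρdef
  have hρY : fderiv ℝ ρ z Y = form ε n (fderiv ℝ F z Y).1 e := by
    rw [hρdef, fderiv_bilin_const_apply _ hFd.fst, fderiv_fst_apply hFd]
  have hq : formR ε n (fderiv ℝ F z (Z z)) (fderiv ℝ F z Y) = form ε n (fderiv ℝ F z Y).1 e := by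
    rw [formR_comm, hZ.self_of_nhds, formR_apply]
    simp
  set q := form ε n (fderiv ℝ F z Y).1 e with hqdef
  have hw := h.snd_fderiv_add_mem hz hε he hρ (Z z) hY
  rw [hq] at hw
  have hsymm : fderiv ℝ (fderiv ℝ F) z (Z z) Y = fderiv ℝ (fderiv ℝ F) z Y (Z z) :=
    ((h.contDiffAt hz).isSymmSndFDerivAt minSmoothness_two_le_infty) _ _
  rw [hsymm] at hw
  have hνd := (h.contDiffAt_nu hz).differentiableAt (by simp)
  have hνY : fderiv ℝ (fun y => nu (F y)) z Y = fderiv ℝ F z Y := by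
    have h2 := hFd.fst.hasFDerivAt.prodMk (hasFDerivAt_const (0 : ℝ) z)
    rw [show (fun y => nu (F y)) = fun y => ((F y).1, (0 : ℝ)) from rfl, h2.fderiv]
    exact Prod.ext (fderiv_fst_apply hFd Y) hY.symm
  have htd : DifferentiableAt ℝ (fun y => fderiv ℝ F y (Z y)) z := hDd.clm_apply hZd
  have ht : fderiv ℝ (fun y => fderiv ℝ F y (Z y)) z Y
      = fderiv ℝ (fderiv ℝ F) z Y (Z z) + fderiv ℝ F z (fderiv ℝ Z z Y) := by
    rw [fderiv_clm_apply hDd hZd, add_apply, ContinuousLinearMap.comp_apply,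
      ContinuousLinearMap.flip_apply, add_comm]
  have hinv : HasFDerivAt (fun y => (ρ y)⁻¹) (-(ρ z ^ 2)⁻¹ • fderiv ℝ ρ z) z :=
    (hasDerivAt_inv hρ).comp_hasFDerivAt z hρd.hasFDerivAt
  have hD : fderiv ℝ (axialMean ε n e F) z Y
      = -(ρ z)⁻¹ • -fderiv ℝ (fun y => fderiv ℝ F y (Z y)) z Y
        + ((ρ z ^ 2)⁻¹ * q) • ((e, 0) - fderiv ℝ F z (Z z)) + ε • fderiv ℝ F z Y := by
    rw [(h.axialMean_eventuallyEq hz hε hρ hZ).fderiv_eq]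
    have h1 := ((hinv.fun_neg.fun_smul (htd.hasFDerivAt.const_sub ((e, 0) : FlatR n))).fun_add
      (hνd.hasFDerivAt.fun_const_smul ε)).fderiv
    rw [h1]
    simp [hνY, hρY]
  rw [normalDeriv, normalSpace, (posOff_formR hε (h.mem z hz)).orthProj_iff, sub_zero]
  refine ⟨Submodule.zero_mem _, ?_⟩
  -- The terms with `e` and the second derivative regroup, up to tangent vectors, into a multiple of
  -- the combination in `snd_fderiv_add_mem` for the tangential component `Z` of `e`, which has no
  -- normal part.
  have hsum : fderiv ℝ (axialMean ε n e F) z Y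
      = (ρ z)⁻¹ • (fderiv ℝ (fderiv ℝ F) z Y (Z z) + (q / ρ z) • ((e, 0) : FlatR n))
        + fderiv ℝ F z ((ρ z)⁻¹ • fderiv ℝ Z z Y - ((ρ z ^ 2)⁻¹ * q) • Z z + ε • Y) := by
    rw [hD, ht]
    simp only [map_add, map_sub, map_smul, smul_add, smul_sub, smul_smul, neg_smul, smul_neg]
    rw [show (ρ z)⁻¹ * (q / ρ z) = (ρ z ^ 2)⁻¹ * q by field_simp]
    abel
  rw [hsum]
  exact Submodule.add_mem _ (Submodule.smul_mem _ _ hw) (Submodule.mem_sup_left ⟨_, rfl⟩)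

end IsAxial

end MeanCurvature

/-! ### Uniqueness and gluing of the mean curvature field -/

section Gluing

variable {ε : ℝ} {n m : ℕ} {M : Type*} [TopologicalSpace M]
  [ChartedSpace (EuclideanSpace ℝ (Fin m)) M] {f : M → FlatR n}

/-- The condition of `HasUmbilicalLeaves` at a point. -/
def IsLeafMeanAt (m : ℕ) {M : Type*} [TopologicalSpace M] [ChartedSpace (EuclideanSpace ℝ (Fin m)) M]
    (ε : ℝ) (f ζ : M → FlatR n) (p : M) : Prop :=
  ζ p ∈ normalSpace (formR ε n) (nu (f p)) (inChart m f p) (pt m p) ∧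
    ∀ Y, formR ε n (push m f p Y) (pushT m ε f p) = 0 →
      (∀ X, sff (formR ε n) (nu (f p)) (inChart m f p) (pt m p) X Y
        = formR ε n (push m f p X) (push m f p Y) • ζ p) ∧
      (m = 2 →
        normalDeriv (formR ε n) (nu (f p)) (inChart m f p) (inChart m ζ p) (pt m p) Y = 0)

theorem inChart_pt {W : Type*} (u : M → W) (p : M) : inChart m u p (pt m p) = u p := by
  rw [inChart_eq, pt_eq, Function.comp_apply,
    OpenPartialHomeomorph.left_inv _ (mem_chart_source _ p)]

theorem eventually_inChart {P : M → Prop} {p : M} (h : ∀ᶠ q in 𝓝 p, P q) :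
    ∀ᶠ z in 𝓝 (pt m p), P ((chartAt (EuclideanSpace ℝ (Fin m)) p).symm z) := by
  have h1 := (chartAt (EuclideanSpace ℝ (Fin m)) p).continuousAt_symm (mem_chart_target _ p)
  refine h1.eventually ?_
  rwa [OpenPartialHomeomorph.left_inv _ (mem_chart_source _ p)]

theorem IsLeafMeanAt.congr {ζ ζ' : M → FlatR n} {p : M} (h : IsLeafMeanAt m ε f ζ p)
    (heq : ζ' =ᶠ[𝓝 p] ζ) : IsLeafMeanAt m ε f ζ' p := by
  have h1 : inChart m ζ' p =ᶠ[𝓝 (pt m p)] inChart m ζ p := eventually_inChart heq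
  rw [IsLeafMeanAt, heq.self_of_nhds]
  refine ⟨h.1, fun Y hY => ⟨(h.2 Y hY).1, fun hm => ?_⟩⟩
  rw [normalDeriv, h1.fderiv_eq]
  exact (h.2 Y hY).2 hm

variable [IsManifold (𝓡 m) ∞ M]

/-- As `m ≥ 2`, the leaf has a nonzero tangent vector `Y`, and `α(Y, Y) = ⟨Y, Y⟩ ζ` determines `ζ`.
-/
theorem IsLeafMeanAt.eq (hε : ε = 1 ∨ ε = -1) (hm : 2 ≤ m) (hf : QxR.IsImmersion m ε f)
    {ζ ζ' : M → FlatR n} {p : M} (h : IsLeafMeanAt m ε f ζ p) (h' : IsLeafMeanAt m ε f ζ' p) :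
    ζ p = ζ' p := by
  obtain ⟨Y, hY, hY0⟩ : ∃ Y, (push m f p Y).2 = 0 ∧ Y ≠ 0 := by
    set φ : EuclideanSpace ℝ (Fin m) →ₗ[ℝ] ℝ :=
      LinearMap.snd ℝ (Flat n) ℝ ∘ₗ (fderiv ℝ (inChart m f p) (pt m p)).toLinearMap with hφ
    have h1 := φ.finrank_range_add_finrank_ker
    have h2 := (LinearMap.range φ).finrank_le
    rw [finrank_euclideanSpace, Fintype.card_fin] at h1
    rw [Module.finrank_self] at h2
    have h3 : LinearMap.ker φ ≠ ⊥ := fun h0 => by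
      rw [h0, finrank_bot] at h1
      omega
    obtain ⟨Y, hY, hY0⟩ := Submodule.exists_mem_ne_zero_of_ne_bot h3
    exact ⟨Y, hY, hY0⟩
  have hYT : formR ε n (push m f p Y) (pushT m ε f p) = 0 := by rw [formR_push_pushT hε hf, hY]
  have h1 := ((h.2 Y hYT).1 Y).symm.trans ((h'.2 Y hYT).1 Y)
  have hpos := formR_push_pos hε hf p (w := push m f p Y) ⟨Y, rfl⟩ fun h0 => hY0
    (push_injective hf p (h0.trans (map_zero (fderiv ℝ (inChart m f p) (pt m p))).symm))
  exact smul_right_injective _ hpos.ne' h1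

/-- The mean curvature vectors of the leaves of an axial immersion. -/
theorem exists_isLeafMeanAt (hε : ε = 1 ∨ ε = -1) (hm : 2 ≤ m) (hf : QxR.IsImmersion m ε f)
    (hT : ∀ p, pushT m ε f p ≠ 0) {A : Submodule ℝ (Flat n)} (hA : finrank ℝ A + m = n + 1)
    {U : Set M} (hU : IsOpen U) {p : M} (hp : p ∈ U)
    (hax : ∀ q ∈ U, ∀ Y, (push m f q Y).2 = 0 → (push m f q Y).1 ∈ (form ε n).orthogonal A) :
    ∃ ζ : M → FlatR n, ∀ᶠ q in 𝓝 p,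
      ContMDiffAt (𝓡 m) 𝓘(ℝ, FlatR n) ∞ ζ q ∧ IsLeafMeanAt m ε f ζ q := by
  have hax' : ∀ q : M, IsAxial ε n A (inChart m f q)
      ((chartAt (EuclideanSpace ℝ (Fin m)) q).symm.source
        ∩ (chartAt (EuclideanSpace ℝ (Fin m)) q).symm ⁻¹' U) := fun q =>
    isAxial_param hε hf hT hA hU hax (contMDiffOn_chart_symm q) (contMDiffOn_chart q) (by simp)
  have hpt : ∀ q ∈ U, pt m q ∈ (chartAt (EuclideanSpace ℝ (Fin m)) q).symm.source
        ∩ (chartAt (EuclideanSpace ℝ (Fin m)) q).symm ⁻¹' U := fun q hq => by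
    refine ⟨pt_mem_target q, ?_⟩
    rw [mem_preimage, pt_eq, OpenPartialHomeomorph.left_inv _ (mem_chart_source _ q)]
    exact hq
  obtain ⟨e, he, hpos⟩ := (hax' p).exists_form_pos (hpt p hp) hε (by simpa using hm)
  rw [inChart_pt] at hpos
  set ζ : M → FlatR n := fun q => axialMean ε n e (inChart m f q) (pt m q) with hζ
  -- `axialMean` depends on the immersion only through the position and the tangent space, so it
  -- does not depend on the chart.
  have hζc : ∀ q : M, inChart m ζ q =ᶠ[𝓝 (pt m q)] axialMean ε n e (inChart m f q) := by
    intro q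
    filter_upwards [(chartAt (EuclideanSpace ℝ (Fin m)) q).open_target.mem_nhds (pt_mem_target q)]
      with z hz
    have h1 := tangentSpan_inChart hf.1 hz rfl
    show axialMean ε n e (inChart m f ((chartAt (EuclideanSpace ℝ (Fin m)) q).symm z))
      (pt m ((chartAt (EuclideanSpace ℝ (Fin m)) q).symm z)) = _
    rw [axialMean, axialMean, normalSpace, normalSpace, ← h1, inChart_pt]
    rfl
  have hfc : ContinuousAt (fun q => form ε n (f q).1 e) p := by
    have h1 : Continuous fun w : FlatR n => form ε n w.1 e :=
      ((form ε n).flip e ∘ₗ LinearMap.fst ℝ (Flat n) ℝ).continuous_of_finiteDimensional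
    exact (h1.comp hf.1.continuous).continuousAt
  refine ⟨ζ, ?_⟩
  filter_upwards [hU.mem_nhds hp, hfc.eventually_ne hpos.ne'] with q hq hρ
  have hρ' : form ε n (inChart m f q (pt m q)).1 e ≠ 0 := by rwa [inChart_pt]
  have hνq : nu (inChart m f q (pt m q)) = nu (f q) := by rw [inChart_pt]
  have hs := (hax' q).contDiffAt_axialMean (hpt q hq) hε hρ'
  refine ⟨?_, ?_, fun Y hY => ⟨fun X => ?_, fun _ => ?_⟩⟩
  · have h1 : ContDiffAt ℝ ∞ (inChart m ζ q) (pt m q) := hs.congr_of_eventuallyEq (hζc q)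
    have h2 := (contMDiffOn_chart q).contMDiffAt
      ((chartAt (EuclideanSpace ℝ (Fin m)) q).open_source.mem_nhds (mem_chart_source _ q))
    have h1' : ContMDiffAt (𝓡 m) 𝓘(ℝ, FlatR n) ∞ (inChart m ζ q)
      ((chartAt (EuclideanSpace ℝ (Fin m)) q).symm.symm q) := contMDiffAt_iff_contDiffAt.2 h1
    have h3 := ContMDiffAt.comp q h1' h2
    refine h3.congr_of_eventuallyEq ?_
    filter_upwards [(chartAt (EuclideanSpace ℝ (Fin m)) q).open_source.mem_nhds
      (mem_chart_source _ q)] with y hy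
    show ζ y = ζ _
    exact congrArg ζ ((chartAt (EuclideanSpace ℝ (Fin m)) q).left_inv hy).symm
  · have := (hax' q).axialMean_mem (hpt q hq) hε e
    rwa [hνq] at this
  · rw [formR_push_pushT hε hf] at hY
    have := (hax' q).sff_eq (hpt q hq) hε he hρ' X hY
    rwa [hνq] at this
  · rw [formR_push_pushT hε hf] at hY
    have := (hax' q).normalDeriv_axialMean (hpt q hq) hε he hρ' hY
    rw [normalDeriv, (hζc q).fderiv_eq, ← hνq]
    exact this

theorem IsLocallyAxial.hasUmbilicalLeaves (hε : ε = 1 ∨ ε = -1) (hm : 2 ≤ m)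
    (hf : QxR.IsImmersion m ε f) (hT : ∀ p, pushT m ε f p ≠ 0)
    (h : IsLocallyAxial m ε f fun _ => True) : HasUmbilicalLeaves m ε f := by
  have hloc : ∀ p : M, ∃ ζ : M → FlatR n, ∀ᶠ q in 𝓝 p,
      ContMDiffAt (𝓡 m) 𝓘(ℝ, FlatR n) ∞ ζ q ∧ IsLeafMeanAt m ε f ζ q := by
    intro p
    obtain ⟨U, A, hU, hp, hA, -, hax⟩ := h p
    exact exists_isLeafMeanAt hε hm hf hT hA hU hp hax
  choose ζ hζ using hloc
  have heq : ∀ p, (fun q => ζ q q) =ᶠ[𝓝 p] ζ p := by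
    intro p
    filter_upwards [hζ p] with q hq
    exact (hζ q).self_of_nhds.2.eq hε hm hf hq.2
  -- By uniqueness the diagonal choice agrees with each local field near its base point, so it
  -- inherits smoothness and parallelism.
  exact ⟨fun q => ζ q q, fun p => (hζ p).self_of_nhds.1.congr_of_eventuallyEq (heq p),
    fun p => (hζ p).self_of_nhds.2.congr (heq p)⟩

end Gluing

end QxR

end

theorem corollary9 {ε : ℝ} (hε : ε = 1 ∨ ε = -1) {n m : ℕ} (hm : 2 ≤ m)
    {M : Type*} [TopologicalSpace M] [ChartedSpace (EuclideanSpace ℝ (Fin m)) M]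
    [IsManifold (𝓡 m) ∞ M] (f : M → FlatR n) (hf : QxR.IsImmersion m ε f)
    (hT : ∀ p, pushT m ε f p ≠ 0) :
    List.TFAE [
      IsRotational m ε f,
      IsLocallyPartialTube m ε f (IsUmbilicalOrCircleOn ε n (m - 1)),
      HasUmbilicalLeaves m ε f] ∧
    (ε = 1 → (IsRotational m ε f ↔ IsLocallyPartialTube m ε f (IsTotallyGeodesicOn ε n))) ∧
    (ε = -1 →
      (IsRotationalHyperbolic m ε f ↔ IsLocallyPartialTube m ε f (IsTotallyGeodesicOn ε n)) ∧
      (m ≤ n → (IsRotationalHyperbolic m ε f ↔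
        IsLocallyPartialTube m ε f fun V g =>
          IsUmbilicalOrCircleOn ε n (m - 1) V g ∧ IsEquidistantOn n (m - 1) V g))) := by
  have hrot : IsRotational m ε f ↔ IsLocallyAxial m ε f fun _ => True :=
    ⟨fun h => IsRotationalWith.isLocallyAxial hε hf hT (fun _ _ => trivial) h,
      fun h => h.isRotationalWith hε hm hf hT fun _ _ => trivial⟩
  have hhyp : IsRotationalHyperbolic m ε f ↔
      IsLocallyAxial m ε f fun A => ∀ a ∈ A, a ≠ 0 → 0 < form ε n a a := by
    constructor
    · refine fun h => IsRotationalWith.isLocallyAxial hε hf hT (fun A hA a ha ha0 => ?_) h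
      have h1 := hA (a, 0) ha fun h0 => ha0 (congrArg Prod.fst h0)
      simpa [formR_apply] using h1
    -- The product metric is positive definite on `A × ℝ` once it is so on `A`.
    · refine fun h => h.isRotationalWith hε hm hf hT fun A hA x hx hx0 => ?_
      rw [formR_apply]
      by_cases h0 : x.1 = 0
      · have h2 : x.2 ≠ 0 := fun h2 => hx0 (Prod.ext h0 h2)
        simpa [h0] using mul_self_pos.2 h2
      · exact add_pos_of_pos_of_nonneg (hA _ hx.1 h0) (mul_self_nonneg _)
  refine ⟨?_, ?_, ?_⟩
  · tfae_have 1 ↔ 2 := hrot.trans ⟨fun h => h.isLocallyPartialTube_umbilical hε hm hf hT,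
      fun h => h.isLocallyAxial_of_umbilical hε hm hf⟩
    tfae_have 1 ↔ 3 := hrot.trans ⟨fun h => h.hasUmbilicalLeaves hε hm hf hT,
      fun h => h.isLocallyAxial hε hm hf hT⟩
    tfae_finish
  · rintro rfl
    rw [hrot]
    refine ⟨fun h => IsLocallyAxial.isLocallyPartialTube_totallyGeodesic hε hm hf hT fun p => ?_,
      fun h p => ?_⟩
    -- For `ε = 1` every subspace is positive definite, so each axis admits a totally geodesic base.
    · obtain ⟨U, A, hU, hp, hA, -, hax⟩ := h p
      exact ⟨U, A, hU, hp, hA, fun a _ ha0 => form_self_pos_of_one ha0, hax⟩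
    · obtain ⟨U, A, hU, hp, hA, -, hax⟩ := h.isLocallyAxial_of_totallyGeodesic hε hm hf p
      exact ⟨U, A, hU, hp, hA, trivial, hax⟩
  · rintro rfl
    exact ⟨hhyp.trans ⟨fun h => h.isLocallyPartialTube_totallyGeodesic hε hm hf hT,
      fun h => h.isLocallyAxial_of_totallyGeodesic hε hm hf⟩,
      fun hmn => hhyp.trans ⟨fun h => h.isLocallyPartialTube_equidistant hm hmn hf hT,
        fun h => h.isLocallyAxial_of_equidistant hm hf⟩⟩
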